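/- **Setting.** Let $d\in\mathbb N$, let $U\in\mathcal C^2(\mathbb R^d)$, and let $L,m>0$ be such that for all $x,y\in\mathbb R^d$, $$|\nabla U(x)-\nabla U(y)|\le L|x-y|,\qquad (x-y)\cdot(\nabla U(x)-\nabla U(y))\ge m|x-y|^2 .$$ Let $\gamma\ge 2\sqrt L$, $0<\delta\le m/(33\gamma^3)$, $\eta=e^{-\delta\gamma/2}$, $H(x,v)=U(x)+|v|^2/2$. *Unadjusted (OBABO) chain.* $P$ is the Markov kernel on $\mathbb R^{2d}$ of the transition $$x_1=x_0+\delta\big(\eta v_0+\sqrt{1-\eta^2}\,G\big)-\tfrac{\delta^2}{2}\nabla U(x_0),\qquad v_1=\eta^2v_0-\tfrac{\delta\eta}{2}\big(\nabla U(x_0)+\nabla U(x_1)\big)+\sqrt{1-\eta^2}\,(\eta G+G'),$$ with $G,G'$ independent standard Gaussian vectors of $\mathbb R^d$. *Metropolis-adjusted chain.* Let $\Phi_V(x,v)=\big(x',\,v-\tfrac\delta2(\nabla U(x)+\nabla U(x'))\big)$ with $x'=x+\delta v-\tfrac{\delta^2}{2}\nabla U(x)$, and $\alpha=\exp(-(H\circ\Phi_V-H)_+)$.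 $P_M$ is the Markov kernel of the transition $$v_0'=\eta v_0+\sqrt{1-\eta^2}\,G,\qquad (x_1,v_1')=\begin{cases}\Phi_V(x_0,v_0')&\text{if }W\le\alpha(x_0,v_0'),\\(x_0,-v_0')&\text{otherwise,}\end{cases}\qquad v_1=\eta v_1'+\sqrt{1-\eta^2}\,G',$$ with $G,G'$ standard Gaussian, $W$ uniform on $[0,1]$, all independent. *Distances and moments.* $\|\nu-\mu\|_{TV}=\inf 2\,\mathbb P(X\ne Y)$ over the couplings $(X,Y)$ of $\nu$ and $\mu$. $\mathcal P_p(\mathbb R^{2d})$ is the set of probability measures with finite $p$-th moment for the Euclidean norm. The potential $U$ has a unique global minimiser $x_\star$; put $z_\star=(x_\star,0)$ and $M_{\nu,p}=\int|z-z_\star|^p\,\nu(\mathrm dz)$. *Additional conditions.* - $(\nabla^2\mathrm{pol}(\ell))$: $\ell\ge2$ and $L_\ell\ge0$ are real numbers such that, for the operator norm and all $x,y\in\mathbb R^d$, $|\nabla^2U(y)-\nabla^2U(x)|\le L_\ell|x-y|\,(2+|x-x_\star|^{\ell-2}+|y-x_\star|^{\ell-2})/4$. - (separable): $\ell\ge2$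 and $L_\ell\ge0$ are real numbers, $\mathcal Q$ is an orthogonal $d\times d$ matrix and $U_1,\dots,U_d\in\mathcal C^2(\mathbb R)$ are such that $U(\mathcal Qx)=\sum_iU_i(x_i)$ for all $x\in\mathbb R^d$, and, with $y_\star=\mathcal Q^{-1}x_\star$, $|U_i''(t)-U_i''(s)|\le L_\ell|s-t|\,(2+|s-y_{\star,i}|^{\ell-2}+|t-y_{\star,i}|^{\ell-2})/4$ for all $i$ and $s,t\in\mathbb R$. *Constants.* $K_1=\sqrt3\max(L^{1/2},L^{-1/2})$, $\ \kappa=\frac{m}{3\gamma}$, $\ K_3=L\big[1+e^{L\delta^2}\big(\tfrac\delta6+\tfrac{\delta^2L}{24}\big)\big]\big(1+\tfrac{\delta L}{2\sqrt m}\big)$, $\ A=1+\frac1{\sqrt m}+\frac{2\delta K_1K_3}{\kappa}$, $$K_9=2L(K_1+3)^2A^2\Big(1+\frac1\kappa\Big)\Big[\frac{\delta L}{8}+\Big(1+\frac\delta4+\frac{\delta^2L}{4}\Big)\Big(1+\frac{\delta^2L^2}{4}\Big)\Big],$$ $$K_{10}=\Big[1+2^\ell(K_1+3)^{\ell+1}A^{\ell+1}\Big(\frac1\kappa+1\Big)\Big]\Big[\frac{L+2L^2}{4}\Big(1+\frac{\delta^2L^2}{4}\Big)+2^{(\ell-3)/2}L_\ell\Big(1+\frac{L\delta}{2}\Big)^3\Big(1+\delta+\frac{\delta^2L}{2}\Big)^{\ell-2}\Big].$$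 **Statement.** There is a real-valued error function $\mathcal E(\nu,n)$ (depending also on $U,\gamma,\delta,d$, but not on $\ell$, $L_\ell$, $\mathcal Q$, $U_i$) such that for all $n\ge1$ and all $\nu,\mu\in\mathcal P_2(\mathbb R^{2d})$, $$\|\nu P_M^n-\mu P_M^n\|_{TV}\le\|\nu P^n-\mu P^n\|_{TV}+\mathcal E(\nu,n)+\mathcal E(\mu,n),$$ and, for all $n\ge1$: 1. for all $\nu\in\mathcal P_2(\mathbb R^{2d})$, $\ \mathcal E(\nu,n)\le\delta K_9\big(M_{\nu,2}+\delta nd\big)$; 2. whenever $(\nabla^2\mathrm{pol}(\ell))$ holds and $\nu\in\mathcal P_{\ell+1}(\mathbb R^{2d})$, $\ \mathcal E(\nu,n)\le\delta^2K_{10}\big(M_{\nu,\ell+1}+\delta n(d+\ell-1)^{(\ell+1)/2}\big)$; 3. whenever the separable condition holds and $\nu\in\mathcal P_{\ell+1}(\mathbb R^{2d})$, $\ \mathcal E(\nu,n)\le\delta^2K_{10}\big(\sum_{i=1}^dM_{\nu_i,\ell+1}+\delta nd\,\ell^{(\ell+1)/2}\big)$, where $\nu_i$ is the law of $(Y_i,W_i)$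 for $(Y,W)=(\mathcal Q^{-1}X,\mathcal Q^{-1}V)$, $(X,V)\sim\nu$, and $M_{\nu_i,p}=\int|z-(y_{\star,i},0)|^p\,\nu_i(\mathrm dz)$ on $\mathbb R^2$. -/

import Mathlib

open MeasureTheory ProbabilityTheory

noncomputable section

namespace OBABO

/-- The space `ℝ^d` with its Euclidean norm. -/
abbrev E (d : ℕ) : Type := EuclideanSpace ℝ (Fin d)

/-- The Euclidean norm `|(x, v)| = (|x|² + |v|²)^{1/2}` of a point of phase space
(the norm that Mathlib puts on a product is the sup norm). -/
def phaseNorm {F : Type*} [NormedAddCommGroup F] (z : F × F) : ℝ :=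
  Real.sqrt (‖z.1‖ ^ 2 + ‖z.2‖ ^ 2)

/-- `ν ∈ 𝒫_p`: a probability measure on phase space with a finite moment of order `p`. -/
def MemP {F : Type*} [NormedAddCommGroup F] [MeasurableSpace F]
    (p : ℝ) (ν : Measure (F × F)) : Prop :=
  IsProbabilityMeasure ν ∧ Integrable (fun z => phaseNorm z ^ p) ν

/-- `M_{ν,p} = 𝔼_ν |Z - z⋆|^p` with `z⋆ = (x⋆, 0)`. -/
def moment {F : Type*} [NormedAddCommGroup F] [MeasurableSpace F]
    (xstar : F) (p : ℝ) (ν : Measure (F × F)) : ℝ :=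
  ∫ z, phaseNorm (z - (xstar, 0)) ^ p ∂ν

/-- `c` is a coupling (transference plan) of `ν` and `μ`. -/
def IsCoupling {S : Type*} [MeasurableSpace S] (ν μ : Measure S) (c : Measure (S × S)) : Prop :=
  c.map Prod.fst = ν ∧ c.map Prod.snd = μ

/-- The total variation distance `‖ν - μ‖_TV = inf 2 ℙ(X ≠ Y)`, the infimum being over the
couplings `(X, Y)` of the probability measures `ν` and `μ` (so it takes values in `[0, 2]`). -/
def tvDist {S : Type*} [MeasurableSpace S] (ν μ : Measure S) : ℝ :=
  sInf {t : ℝ | ∃ c : Measure (S × S), IsCoupling ν μ c ∧ t = 2 * c.real {q | q.1 ≠ q.2}}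

/-- The law `ν Qⁿ` at time `n` of a Markov chain with kernel `Q` and initial law `ν`. -/
def lawAt {S : Type*} [MeasurableSpace S] (Q : Kernel S S) (ν : Measure S) (n : ℕ) : Measure S :=
  (fun ρ : Measure S => ρ.bind Q)^[n] ν

variable {d : ℕ}

/-! ### Assumptions on the potential -/

/-- `∇U` is `L`-Lipschitz, with `L > 0`. -/
def GradLip (U : E d → ℝ) (L : ℝ) : Prop :=
  0 < L ∧ ∀ x y, ‖gradient U x - gradient U y‖ ≤ L * ‖x - y‖

/-- `U` is `m`-convex, with `m > 0`. -/
def Conv (U : E d → ℝ) (m : ℝ) : Prop :=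
  0 < m ∧ ∀ x y, m * ‖x - y‖ ^ 2 ≤ inner ℝ (x - y) (gradient U x - gradient U y)

/-- The condition `(∇² pol(ℓ))` with constants `ℓ ≥ 2`, `L_ℓ` and centre `x⋆`. The Hessian is the
derivative of the gradient, and its norm is the operator norm. -/
def HessPol (U : E d → ℝ) (xstar : E d) (ℓ Lℓ : ℝ) : Prop :=
  2 ≤ ℓ ∧ 0 ≤ Lℓ ∧ ∀ x y,
    ‖fderiv ℝ (gradient U) y - fderiv ℝ (gradient U) x‖ ≤
      Lℓ * ‖x - y‖ * (2 + ‖x - xstar‖ ^ (ℓ - 2) + ‖y - xstar‖ ^ (ℓ - 2)) / 4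

/-- The separability condition: in the orthonormal coordinates `y = 𝒬⁻¹ x`, the potential is
`∑ᵢ Uᵢ(yᵢ)` with `Uᵢ ∈ 𝒞²(ℝ)`, and each `Uᵢ''` satisfies the polynomial local Lipschitz bound
around the `i`-th new coordinate of `x⋆`. An orthogonal matrix is given as the linear isometry
that it induces. -/
def Separable (U : E d → ℝ) (xstar : E d) (ℓ Lℓ : ℝ)
    (Q : E d ≃ₗᵢ[ℝ] E d) (Ui : Fin d → ℝ → ℝ) : Prop :=
  2 ≤ ℓ ∧ 0 ≤ Lℓ ∧ (∀ i, ContDiff ℝ 2 (Ui i)) ∧ (∀ x, U (Q x) = ∑ i, Ui i (x i)) ∧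
    ∀ i, ∀ s t : ℝ,
      |iteratedDeriv 2 (Ui i) t - iteratedDeriv 2 (Ui i) s| ≤
        Lℓ * |s - t| *
          (2 + |s - Q.symm xstar i| ^ (ℓ - 2) + |t - Q.symm xstar i| ^ (ℓ - 2)) / 4

/-- The law `νᵢ` on `ℝ × ℝ` of the `i`-th position and velocity coordinates of `(𝒬⁻¹X, 𝒬⁻¹V)`,
where `(X, V) ∼ ν`. -/
def coordLaw (Q : E d ≃ₗᵢ[ℝ] E d) (ν : Measure (E d × E d)) (i : Fin d) : Measure (ℝ × ℝ) :=
  ν.map fun z => (Q.symm z.1 i, Q.symm z.2 i)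

/-! ### The two chains

All the maps below are measurable as soon as `U` is `𝒞¹`, so that the kernels are the intended
Markov kernels. -/

/-- The Hamiltonian `H(x, v) = U(x) + |v|² / 2`. -/
def ham (U : E d → ℝ) (z : E d × E d) : ℝ := U z.1 + ‖z.2‖ ^ 2 / 2

/-- The damping factor `η = exp(-δ γ / 2)`. -/
def eta (δ γ : ℝ) : ℝ := Real.exp (-(δ * γ) / 2)

/-- One step of the OBABO chain from `z = (x₀, v₀)` with Gaussian inputs `g = (G, G')`. -/
def obaboMap (U : E d → ℝ) (δ γ : ℝ) (z g : E d × E d) : E d × E d :=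
  let x₁ : E d := z.1 + δ • (eta δ γ • z.2 + Real.sqrt (1 - eta δ γ ^ 2) • g.1)
    - (δ ^ 2 / 2) • gradient U z.1
  (x₁, eta δ γ ^ 2 • z.2 - (δ * eta δ γ / 2) • (gradient U z.1 + gradient U x₁)
    + Real.sqrt (1 - eta δ γ ^ 2) • (eta δ γ • g.1 + g.2))

/-- The OBABO transition `P`: `G` and `G'` are independent standard Gaussian vectors. -/
def kernelP (U : E d → ℝ) (δ γ : ℝ) : Kernel (E d × E d) (E d × E d) :=
  (Kernel.id ×ₖ Kernel.const (E d × E d) ((stdGaussian (E d)).prod (stdGaussian (E d)))).map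
    fun w => obaboMap U δ γ w.1 w.2

/-- The velocity Verlet map `Φ_V`. -/
def verlet (U : E d → ℝ) (δ : ℝ) (z : E d × E d) : E d × E d :=
  let x₁ : E d := z.1 + δ • z.2 - (δ ^ 2 / 2) • gradient U z.1
  (x₁, z.2 - (δ / 2) • (gradient U z.1 + gradient U x₁))

/-- The reflection `Φ_R` of the velocity. -/
def reflect (z : E d × E d) : E d × E d := (z.1, -z.2)

/-- The acceptance probability `α = exp(-(H ∘ Φ_V - H)₊)`. -/
def accept (U : E d → ℝ) (δ : ℝ) (z : E d × E d) : ℝ :=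
  Real.exp (-max (ham U (verlet U δ z) - ham U z) 0)

/-- The partial refreshment transition `P_O`: `(x, v) ↦ (x, η v + (1 - η²)^{1/2} G)`. -/
def kernelO (δ γ : ℝ) : Kernel (E d × E d) (E d × E d) :=
  (Kernel.id ×ₖ Kernel.const (E d × E d) (stdGaussian (E d))).map fun w =>
    (w.1.1, eta δ γ • w.1.2 + Real.sqrt (1 - eta δ γ ^ 2) • w.2)

open Classical in
/-- The Metropolis–Hastings transition `P_MH` with deterministic proposal `Φ_R ∘ Φ_V`; the
proposal is accepted when `W ≤ α`, with `W` uniform over `[0, 1]`. -/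
def kernelMH (U : E d → ℝ) (δ : ℝ) : Kernel (E d × E d) (E d × E d) :=
  (Kernel.id ×ₖ Kernel.const (E d × E d) (volume.restrict (Set.Icc (0 : ℝ) 1))).map fun w =>
    if w.2 ≤ accept U δ w.1 then reflect (verlet U δ w.1) else w.1

/-- The Metropolis-adjusted Verlet transition `P_MV`: a step of `P_MH`, then the reflection of the
velocity. From `(x, v)` it goes to `Φ_V(x, v)` in case of acceptance, to `(x, -v)` otherwise. -/
def kernelMV (U : E d → ℝ) (δ : ℝ) : Kernel (E d × E d) (E d × E d) :=
  (kernelMH U δ).map reflect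

/-- The OM(BAB)O transition `P_M`: successively a step of `P_O`, of `P_MV` and of `P_O`. -/
def kernelM (U : E d → ℝ) (δ γ : ℝ) : Kernel (E d × E d) (E d × E d) :=
  kernelO δ γ ∘ₖ (kernelMV U δ ∘ₖ kernelO δ γ)

/-! ### The constants -/

/-- `K₁ = √3 max(L^{1/2}, L^{-1/2})`. -/
def K1 (L : ℝ) : ℝ := Real.sqrt 3 * max (Real.sqrt L) (Real.sqrt L)⁻¹

/-- `κ = m / (3γ)`. -/
def kappa (m γ : ℝ) : ℝ := m / (3 * γ)

/-- `K₃ = L [1 + e^{Lδ²} (δ/6 + δ²L/24)] (1 + δL / (2√m))`. -/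
def K3 (L m δ : ℝ) : ℝ :=
  L * (1 + Real.exp (L * δ ^ 2) * (δ / 6 + δ ^ 2 * L / 24)) * (1 + δ * L / (2 * Real.sqrt m))

/-- The factor `1 + 1/√m + 2 δ K₁ K₃ / κ`, common to `K₉` and `K₁₀`. -/
def momentFactor (L m γ δ : ℝ) : ℝ :=
  1 + 1 / Real.sqrt m + 2 * δ * K1 L * K3 L m δ / kappa m γ

/-- The constant `K₉`. -/
def K9 (L m γ δ : ℝ) : ℝ :=
  2 * L * (K1 L + 3) ^ 2 * momentFactor L m γ δ ^ 2 * (1 + 1 / kappa m γ) *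
    (δ * L / 8 + (1 + δ / 4 + δ ^ 2 * L / 4) * (1 + δ ^ 2 * (L ^ 2 / 4)))

/-- The constant `K₁₀`. -/
def K10 (L m γ δ ℓ Lℓ : ℝ) : ℝ :=
  (1 + (2 : ℝ) ^ ℓ * (K1 L + 3) ^ (ℓ + 1) * momentFactor L m γ δ ^ (ℓ + 1) *
      (1 / kappa m γ + 1)) *
    ((L + 2 * L ^ 2) / 4 * (1 + δ ^ 2 * (L ^ 2 / 4)) +
      (2 : ℝ) ^ ((ℓ - 3) / 2) * Lℓ * (1 + L * δ / 2) ^ 3 *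
        (1 + δ + δ ^ 2 * L / 2) ^ (ℓ - 2))

end OBABO

end

/-! The error `Err ν n` is taken to be the total variation distance between `ν P_M^n` and `ν P^n`.
The first inequality is then the triangle inequality, and the three bounds are estimates of one and
the same quantity, which explains why it does not depend on `ℓ`, `L_ℓ`, `𝒬`, `U_i`.

Both chains consist of a half-refreshment, a Verlet move and another half-refreshment, and they
differ only when a Verlet move is rejected. Markov kernels contract total variation, so replacing
`P_M` by `P` one step at a time costs at step `k` at most `2 𝔼(1 - α) ≤ 2 𝔼|H ∘ Φ_V - H|`, the mean
being taken along the unadjusted chain just before its Verlet move (`tvDist_lawAt_le`). What remains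
is a pointwise bound of the energy error and a bound of the moments of the unadjusted chain.

Energy error. An exact identity (`norm_sq_snd_verletField_sub`) writes it as the error of the
trapezoidal rule for `U` on the segment from `x` to `x₁`, plus `δ²/8 (|∇U(x₁)|² - |∇U(x)|²)`. It is
of order `δ²` when the gradient is Lipschitz and of order `δ³` when the Hessian is locally
Lipschitz. One power of `δ` is then used up by summing over the steps, which leaves `δ n` or `1/κ`.

Moments. The chain is coupled synchronously with a copy started at `z⋆`. In the twisted norm `|x +
βv|² + |βv|²` with `β = δ/(1-η²) ≈ 1/γ`, one transition contracts differences
(`twisted_drift_sub_le`). The distance between the copies decays geometrically, so the initial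
moment enters with a total weight of order `1/κ`. The copy started at `z⋆` has exponential moments
bounded uniformly in time (`lintegral_exp_step_le`), which give the terms in `δ n` with their
dependence on the dimension.

In the separable case each coordinate is itself a one-dimensional chain of the same type and the
energy errors add up, so the one-dimensional bound is summed over the coordinates. -/

noncomputable section

namespace OBABO

/-! ### Couplings and total variation. -/

section TotalVariation

variable {S : Type*} [MeasurableSpace S]

theorem bddBelow_coupling_costs (ν μ : Measure S) :
    BddBelow {t : ℝ | ∃ c : Measure (S × S), IsCoupling ν μ c ∧ t = 2 * c.real {q | q.1 ≠ q.2}} := by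
  refine ⟨0, ?_⟩
  rintro t ⟨c, -, rfl⟩
  positivity

theorem tvDist_le_of_isCoupling {ν μ : Measure S} {c : Measure (S × S)} (hc : IsCoupling ν μ c) :
    tvDist ν μ ≤ 2 * c.real {q | q.1 ≠ q.2} :=
  csInf_le (bddBelow_coupling_costs ν μ) ⟨c, hc, rfl⟩

theorem isCoupling_prod (ν μ : Measure S) [IsProbabilityMeasure ν] [IsProbabilityMeasure μ] :
    IsCoupling ν μ (ν.prod μ) := by
  constructor
  · simp [Measure.map_fst_prod]
  · simp [Measure.map_snd_prod]

theorem exists_isCoupling_lt (ν μ : Measure S) [IsProbabilityMeasure ν] [IsProbabilityMeasure μ]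
    {ε : ℝ} (hε : 0 < ε) :
    ∃ c : Measure (S × S), IsCoupling ν μ c ∧ 2 * c.real {q | q.1 ≠ q.2} < tvDist ν μ + ε := by
  obtain ⟨t, ⟨c, hc, rfl⟩, ht⟩ := Real.lt_sInf_add_pos
    (s := {t : ℝ | ∃ c : Measure (S × S), IsCoupling ν μ c ∧ t = 2 * c.real {q | q.1 ≠ q.2}})
    ⟨_, _, isCoupling_prod ν μ, rfl⟩ hε
  exact ⟨c, hc, ht⟩

theorem IsCoupling.isProbabilityMeasure {ν μ : Measure S} [IsProbabilityMeasure ν]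
    {c : Measure (S × S)} (hc : IsCoupling ν μ c) : IsProbabilityMeasure c := by
  constructor
  have h := congrArg (fun ρ => ρ Set.univ) hc.1
  simpa [Measure.map_apply measurable_fst MeasurableSet.univ] using h

theorem tvDist_comm (ν μ : Measure S) : tvDist ν μ = tvDist μ ν := by
  have key : ∀ ν μ : Measure S,
      {t : ℝ | ∃ c : Measure (S × S), IsCoupling ν μ c ∧ t = 2 * c.real {q | q.1 ≠ q.2}} ⊆
      {t : ℝ | ∃ c : Measure (S × S), IsCoupling μ ν c ∧ t = 2 * c.real {q | q.1 ≠ q.2}} := by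
    rintro ν μ t ⟨c, hc, rfl⟩
    refine ⟨c.map Prod.swap, ⟨?_, ?_⟩, ?_⟩
    · rw [Measure.map_map measurable_fst measurable_swap]; exact hc.2
    · rw [Measure.map_map measurable_snd measurable_swap]; exact hc.1
    · rw [Measure.real, Measure.real, MeasurableEquiv.prodComm.map_apply (μ := c)
        |> fun h => show (c.map Prod.swap) _ = _ from h _]
      congr 2
      congr 1
      ext q
      exact not_congr eq_comm
  exact congrArg sInf (Set.Subset.antisymm (key ν μ) (key μ ν))

/-- Gluing: from nearly optimal couplings of `(ν, μ)` and `(μ, ρ)`, the third variable is drawn from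
the conditional law of the second coupling given the middle one. If the extreme variables differ,
one of the two consecutive pairs differs. The standard Borel structure provides the conditional
kernel. -/
theorem tvDist_triangle [StandardBorelSpace S] (ν μ ρ : Measure S) [IsProbabilityMeasure ν]
    [IsProbabilityMeasure μ] [IsProbabilityMeasure ρ] :
    tvDist ν ρ ≤ tvDist ν μ + tvDist μ ρ := by
  have : Nonempty S := nonempty_of_isProbabilityMeasure ν
  refine le_of_forall_pos_le_add fun ε hε => ?_
  obtain ⟨c₁, hc₁, h₁⟩ := exists_isCoupling_lt ν μ (half_pos hε)
  obtain ⟨c₂, hc₂, h₂⟩ := exists_isCoupling_lt μ ρ (half_pos hε)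
  have := hc₁.isProbabilityMeasure
  have := hc₂.isProbabilityMeasure
  set κ : Kernel S S := c₂.condKernel with hκ
  have hc₂' : μ ⊗ₘ κ = c₂ := by
    have h := c₂.disintegrate c₂.condKernel
    rwa [show c₂.fst = μ from hc₂.1] at h
  set τ : Measure ((S × S) × S) := c₁ ⊗ₘ (κ.comap Prod.snd measurable_snd) with hτ
  have hτ1 : τ.map Prod.fst = c₁ := Measure.fst_compProd _ _
  have hτ2 : τ.map (fun w => (w.1.2, w.2)) = c₂ := by
    rw [← hc₂', ← hc₁.2]
    ext s hs
    rw [Measure.map_apply (by fun_prop) hs, hτ,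
      Measure.compProd_apply (hs.preimage (by fun_prop)), Measure.compProd_apply hs,
      lintegral_map (Kernel.measurable_kernel_prodMk_left hs) measurable_snd]
    rfl
  have hcoup : IsCoupling ν ρ (τ.map fun w => (w.1.1, w.2)) := by
    constructor
    · rw [Measure.map_map measurable_fst (by fun_prop), ← hc₁.1, ← hτ1,
        Measure.map_map measurable_fst measurable_fst]
      rfl
    · rw [Measure.map_map measurable_snd (by fun_prop), ← hc₂.2, ← hτ2,
        Measure.map_map measurable_snd (by fun_prop)]
      rfl
  have hms : MeasurableSet {q : S × S | q.1 ≠ q.2} :=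
    (measurableSet_eq_fun measurable_fst measurable_snd).compl
  have hτp : IsProbabilityMeasure τ := by rw [hτ]; infer_instance
  have hsub : (τ.map fun w => (w.1.1, w.2)).real {q | q.1 ≠ q.2} ≤
      c₁.real {q | q.1 ≠ q.2} + c₂.real {q | q.1 ≠ q.2} := by
    rw [← hτ2, map_measureReal_apply (by fun_prop) hms, map_measureReal_apply (by fun_prop) hms]
    conv_rhs => rw [← hτ1, map_measureReal_apply (by fun_prop) hms]
    refine (measureReal_mono ?_).trans (measureReal_union_le _ _)
    intro w hw
    by_contra hcon
    simp only [Set.mem_union, Set.mem_preimage, Set.mem_ofPred_eq, not_or, not_not] at hcon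
    exact hw (hcon.1.trans hcon.2)
  have := tvDist_le_of_isCoupling hcoup
  linarith

/-- Copies that coincide are moved together and the others independently, so a transition creates no
new disagreement. -/
theorem tvDist_bind_le [MeasurableEq S] (ν μ : Measure S) [IsProbabilityMeasure ν]
    [IsProbabilityMeasure μ] (κ : Kernel S S) [IsMarkovKernel κ] :
    tvDist (ν.bind κ) (μ.bind κ) ≤ tvDist ν μ := by
  classical
  refine le_of_forall_pos_le_add fun ε hε => ?_
  obtain ⟨c, hc, h⟩ := exists_isCoupling_lt ν μ hε
  have := hc.isProbabilityMeasure
  have hms : MeasurableSet {q : S × S | q.1 = q.2} :=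
    measurableSet_eq_fun measurable_fst measurable_snd
  have hdiag : Measurable fun x : S => (x, x) := by fun_prop
  set K : Kernel (S × S) (S × S) := Kernel.piecewise hms
    ((κ.comap Prod.fst measurable_fst).map fun x => (x, x))
    ((κ.comap Prod.fst measurable_fst) ×ₖ (κ.comap Prod.snd measurable_snd)) with hK
  have hfst : K.map Prod.fst = κ.comap Prod.fst measurable_fst := by
    ext q s hs
    rw [Kernel.map_apply _ measurable_fst, hK, Kernel.piecewise_apply]
    split_ifs with hq
    · rw [Kernel.map_apply _ hdiag, Measure.map_map measurable_fst hdiag]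
      simp [Function.comp_def]
    · rw [Kernel.prod_apply, Measure.map_fst_prod]
      simp
  have hsnd : K.map Prod.snd = κ.comap Prod.snd measurable_snd := by
    ext q s hs
    rw [Kernel.map_apply _ measurable_snd, hK, Kernel.piecewise_apply]
    split_ifs with hq
    · rw [Kernel.map_apply _ hdiag, Measure.map_map measurable_snd hdiag]
      have hq' : q.1 = q.2 := hq
      simp [Function.comp_def, hq']
    · rw [Kernel.prod_apply, Measure.map_snd_prod]
      simp
  have hcomap : ∀ f : S × S → S, ∀ hf : Measurable f,
      c.bind (κ.comap f hf) = (c.map f).bind κ := by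
    intro f hf
    ext s hs
    rw [Measure.bind_apply hs (Kernel.aemeasurable _), Measure.bind_apply hs (Kernel.aemeasurable _),
      lintegral_map (Kernel.measurable_coe _ hs) hf]
    rfl
  have hcoup : IsCoupling (ν.bind κ) (μ.bind κ) (c.bind K) := by
    constructor
    · rw [Measure.map_comp _ _ measurable_fst, hfst, hcomap, hc.1]
    · rw [Measure.map_comp _ _ measurable_snd, hsnd, hcomap, hc.2]
  have hne : (c.bind K) {q | q.1 ≠ q.2} ≤ c {q | q.1 ≠ q.2} := by
    change (c.bind K) {q : S × S | q.1 = q.2}ᶜ ≤ c {q : S × S | q.1 = q.2}ᶜ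
    rw [Measure.bind_apply hms.compl (Kernel.aemeasurable _), ← lintegral_indicator_one hms.compl]
    refine lintegral_mono fun q => ?_
    by_cases hq : q.1 = q.2
    · rw [hK, Kernel.piecewise_apply, if_pos (show q ∈ {q : S × S | q.1 = q.2} from hq),
        Kernel.map_apply' _ hdiag _ hms.compl]
      simp
    · rw [Set.indicator_of_mem (show q ∈ {q : S × S | q.1 = q.2}ᶜ from hq)]
      rw [hK, Kernel.piecewise_apply, if_neg (show q ∉ {q : S × S | q.1 = q.2} from hq),
        Kernel.prod_apply]
      exact prob_le_one
  have h2 : (c.bind K).real {q | q.1 ≠ q.2} ≤ c.real {q | q.1 ≠ q.2} :=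
    ENNReal.toReal_mono (measure_ne_top _ _) hne
  have := tvDist_le_of_isCoupling hcoup
  linarith

theorem bind_map_id_prod_const {Ω S' : Type*} [MeasurableSpace Ω] [MeasurableSpace S']
    (ρ : Measure S) [SFinite ρ] (γ : Measure Ω) [SFinite γ] {f : S × Ω → S'} (hf : Measurable f) :
    ρ.bind ((Kernel.id ×ₖ Kernel.const S γ).map f) = (ρ.prod γ).map f := by
  rw [← Measure.map_comp _ _ hf, ← Measure.compProd_eq_comp_prod, Measure.compProd_const]

theorem lawAt_succ (Q : Kernel S S) (ν : Measure S) (n : ℕ) :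
    lawAt Q ν (n + 1) = (lawAt Q ν n).bind Q :=
  Function.iterate_succ_apply' _ _ _

theorem isProbabilityMeasure_lawAt (Q : Kernel S S) [IsMarkovKernel Q] (ν : Measure S)
    [IsProbabilityMeasure ν] (n : ℕ) : IsProbabilityMeasure (lawAt Q ν n) := by
  induction n with
  | zero => exact ‹_›
  | succ n ih => rw [lawAt_succ]; infer_instance

end TotalVariation

/-! ### Gaussian refreshment of the velocity. -/

section Refresh

variable {F : Type*} [NormedAddCommGroup F] [InnerProductSpace ℝ F] [FiniteDimensional ℝ F]
  [MeasurableSpace F] [BorelSpace F]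

/-- The velocity Verlet map driven by the field `G`. -/
def verletField {F : Type*} [NormedAddCommGroup F] [InnerProductSpace ℝ F]
    (G : F → F) (δ : ℝ) (z : F × F) : F × F :=
  let x₁ : F := z.1 + δ • z.2 - (δ ^ 2 / 2) • G z.1
  (x₁, z.2 - (δ / 2) • (G z.1 + G x₁))

/-- The map `(z, g) ↦ (x, a v + b g)`. -/
def refreshMap {F : Type*} [NormedAddCommGroup F] [InnerProductSpace ℝ F]
    (a b : ℝ) (w : (F × F) × F) : F × F :=
  (w.1.1, a • w.1.2 + b • w.2)

theorem measurable_refreshMap (a b : ℝ) : Measurable (refreshMap (F := F) a b) := by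
  unfold refreshMap; fun_prop

theorem measurable_verletField {G : F → F} (hG : Continuous G) (δ : ℝ) :
    Measurable (verletField G δ) := by
  have : Continuous (verletField G δ) := by unfold verletField; fun_prop
  exact this.measurable

/-- The law of `(x, a v + b g)` when `(x, v) ∼ ρ` and `g` is an independent standard Gaussian. -/
def refresh (a b : ℝ) (ρ : Measure (F × F)) : Measure (F × F) :=
  (ρ.prod (stdGaussian F)).map (refreshMap a b)

instance isProbabilityMeasure_refresh (a b : ℝ) (ρ : Measure (F × F)) [IsProbabilityMeasure ρ] :
    IsProbabilityMeasure (refresh a b ρ) :=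
  Measure.isProbabilityMeasure_map (measurable_refreshMap a b).aemeasurable

theorem map_combination_stdGaussian {a b c : ℝ} (h : a ^ 2 + b ^ 2 = c ^ 2) :
    ((stdGaussian F).prod (stdGaussian F)).map (fun p => a • p.1 + b • p.2) =
      (stdGaussian F).map (fun g => c • g) := by
  have h1 : ((stdGaussian F).prod (stdGaussian F)).map (fun p => a • p.1 + b • p.2) =
      (((stdGaussian F).map (fun g => a • g)).prod ((stdGaussian F).map (fun g => b • g))).map
        (fun p => p.1 + p.2) := by
    rw [Measure.map_prod_map _ _ (by fun_prop) (by fun_prop),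
      Measure.map_map (by fun_prop) (by fun_prop)]
    rfl
  have : IsProbabilityMeasure ((stdGaussian F).map (fun g => a • g)) :=
    Measure.isProbabilityMeasure_map (by fun_prop)
  have : IsProbabilityMeasure ((stdGaussian F).map (fun g => b • g)) :=
    Measure.isProbabilityMeasure_map (by fun_prop)
  rw [h1]
  apply Measure.ext_of_charFun
  ext t
  have e : (((stdGaussian F).map (fun g => a • g)).prod ((stdGaussian F).map (fun g => b • g))).map
        (fun p => p.1 + p.2) =
      ((stdGaussian F).map (fun g => a • g)).conv ((stdGaussian F).map (fun g => b • g)) := rfl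
  rw [e, charFun_conv, charFun_map_smul, charFun_map_smul, charFun_map_smul, charFun_stdGaussian,
    charFun_stdGaussian, charFun_stdGaussian, ← Complex.exp_add]
  congr 1
  have e2 : ∀ r : ℝ, ((‖r • t‖ : ℂ)) ^ 2 = ((r ^ 2 : ℝ) : ℂ) * (‖t‖ : ℂ) ^ 2 := by
    intro r
    rw [norm_smul, Real.norm_eq_abs]
    norm_cast
    rw [mul_pow, sq_abs]
  rw [e2, e2, e2, ← h]
  push_cast
  ring

/-- Two refreshments inject the noise `ab g + b g'`, which has the law of `c g`. With `a = η`, `b² =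
1 - η²` and `c² = 1 - η⁴`, the two half-refreshments between consecutive Verlet moves merge into
one. -/
theorem refresh_refresh {a b c : ℝ} (h : (a * b) ^ 2 + b ^ 2 = c ^ 2) (ρ : Measure (F × F))
    [IsProbabilityMeasure ρ] :
    refresh a b (refresh a b ρ) = refresh (a ^ 2) c ρ := by
  have hm := measurable_refreshMap (F := F) a b
  have e1 : refresh a b (refresh a b ρ) =
      (ρ.prod ((stdGaussian F).prod (stdGaussian F))).map
        (fun w => (w.1.1, (a ^ 2) • w.1.2 + ((a * b) • w.2.1 + b • w.2.2))) := by
    rw [refresh, refresh, ← Measure.map_id (μ := stdGaussian F),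
      Measure.map_prod_map _ _ hm measurable_id, Measure.map_id,
      Measure.map_map hm (hm.prodMap measurable_id),
      ← Measure.prodAssoc_prod, Measure.map_map (by fun_prop) (by fun_prop)]
    congr 1
    ext w
    · rfl
    · simp [refreshMap, smul_smul, pow_two, add_assoc, MeasurableEquiv.prodAssoc]
  have e2 : refresh (a ^ 2) c ρ = (ρ.prod ((stdGaussian F).map (fun g => c • g))).map
      (fun w => (w.1.1, (a ^ 2) • w.1.2 + w.2)) := by
    conv_rhs => rw [← Measure.map_id (μ := ρ)]
    rw [Measure.map_prod_map _ _ measurable_id (by fun_prop),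
      Measure.map_map (by fun_prop) (by fun_prop)]
    rfl
  rw [e1, e2, ← map_combination_stdGaussian h]
  conv_rhs => rw [← Measure.map_id (μ := ρ)]
  rw [Measure.map_prod_map _ _ measurable_id (by fun_prop),
    Measure.map_map (by fun_prop) (by fun_prop)]
  rfl

end Refresh

/-! ### Splitting of the two kernels, and the cost of rejections. -/

section Kernels

variable {d : ℕ} {U : E d → ℝ} {δ γ : ℝ}

theorem measurable_verlet (hG : Continuous (gradient U)) : Measurable (verlet U δ) :=
  measurable_verletField hG δ

theorem bind_kernelO (ρ : Measure (E d × E d)) [SFinite ρ] :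
    ρ.bind (kernelO δ γ) = refresh (eta δ γ) (Real.sqrt (1 - eta δ γ ^ 2)) ρ :=
  bind_map_id_prod_const ρ _ (measurable_refreshMap _ _)

theorem measurable_obaboMap (hG : Continuous (gradient U)) :
    Measurable fun w : (E d × E d) × (E d × E d) => obaboMap U δ γ w.1 w.2 := by
  have : Continuous fun w : (E d × E d) × (E d × E d) => obaboMap U δ γ w.1 w.2 := by
    unfold obaboMap; fun_prop
  exact this.measurable

/-- `G` is the noise of the first half-refreshment and `G'` that of the last. This puts `P` in the
form of `P_M`, with the Verlet map in place of its adjusted version. -/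
theorem bind_kernelP (hG : Continuous (gradient U)) (ρ : Measure (E d × E d))
    [IsProbabilityMeasure ρ] :
    ρ.bind (kernelP U δ γ) =
      ((ρ.bind (kernelO δ γ)).map (verlet U δ)).bind (kernelO δ γ) := by
  have hV := measurable_verlet (δ := δ) hG
  set a := eta δ γ with ha
  set b := Real.sqrt (1 - a ^ 2) with hb
  have hm := measurable_refreshMap (F := E d) a b
  have : IsProbabilityMeasure ((refresh a b ρ).map (verlet U δ)) :=
    Measure.isProbabilityMeasure_map hV.aemeasurable
  rw [kernelP, bind_map_id_prod_const _ _ (measurable_obaboMap hG), bind_kernelO ρ, ← ha, ← hb,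
    bind_kernelO, ← ha, ← hb]
  rw [refresh, refresh, Measure.map_map hV hm]
  conv_rhs => rw [← Measure.map_id (μ := stdGaussian (E d))]
  rw [Measure.map_prod_map _ _ (hV.comp hm) measurable_id,
    Measure.map_id, Measure.map_map hm ((hV.comp hm).prodMap measurable_id),
    ← Measure.prodAssoc_prod, Measure.map_map (measurable_obaboMap hG) (by fun_prop)]
  congr 1
  ext w : 1
  simp only [Function.comp_apply, MeasurableEquiv.prodAssoc, MeasurableEquiv.coe_mk,
    Equiv.prodAssoc_apply, obaboMap, refreshMap, verlet, Prod.map, id, ← ha, ← hb]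
  refine Prod.ext rfl ?_
  simp only [smul_add, smul_sub, smul_smul]
  module

theorem isMarkovKernel_kernelO : IsMarkovKernel (kernelO (d := d) δ γ) :=
  Kernel.IsMarkovKernel.map _ (measurable_refreshMap (F := E d) _ _)

theorem isMarkovKernel_kernelP (hG : Continuous (gradient U)) :
    IsMarkovKernel (kernelP U δ γ) :=
  Kernel.IsMarkovKernel.map _ (measurable_obaboMap hG)

theorem measurable_ham (hU : Continuous U) : Measurable (ham U) := by
  have := hU.measurable
  unfold ham; fun_prop

theorem measurable_accept (hU : Continuous U) (hG : Continuous (gradient U)) :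
    Measurable (accept U δ) := by
  have h1 := measurable_ham hU
  have h2 := measurable_verlet (δ := δ) hG
  unfold accept
  fun_prop

theorem measurable_reflect : Measurable (reflect (d := d)) := by
  unfold reflect; fun_prop

open Classical in
/-- The Metropolis-adjusted Verlet move from `w.1` with acceptance variable `w.2`. -/
def adjustedMap (U : E d → ℝ) (δ : ℝ) (w : (E d × E d) × ℝ) : E d × E d :=
  if w.2 ≤ accept U δ w.1 then verlet U δ w.1 else reflect w.1

theorem measurableSet_accepted (hU : Continuous U) (hG : Continuous (gradient U)) :
    MeasurableSet {w : (E d × E d) × ℝ | w.2 ≤ accept U δ w.1} :=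
  measurableSet_le measurable_snd ((measurable_accept hU hG).comp measurable_fst)

theorem measurable_adjustedMap (hU : Continuous U) (hG : Continuous (gradient U)) :
    Measurable (adjustedMap U δ) := by
  classical
  exact Measurable.ite (measurableSet_accepted hU hG)
    ((measurable_verlet hG).comp measurable_fst) (measurable_reflect.comp measurable_fst)

theorem kernelMV_eq (hU : Continuous U) (hG : Continuous (gradient U)) :
    kernelMV U δ = (Kernel.id ×ₖ Kernel.const (E d × E d)
      (volume.restrict (Set.Icc (0 : ℝ) 1))).map (adjustedMap U δ) := by
  classical
  rw [kernelMV, kernelMH, ← Kernel.map_comp_right _ _ measurable_reflect]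
  · congr 1
    ext w : 1
    simp only [Function.comp_apply, adjustedMap]
    split_ifs
    · simp [reflect]
    · rfl
  · exact Measurable.ite (measurableSet_accepted hU hG)
      (measurable_reflect.comp ((measurable_verlet hG).comp measurable_fst)) measurable_fst

instance : IsProbabilityMeasure (volume.restrict (Set.Icc (0 : ℝ) 1)) := ⟨by simp⟩

theorem isMarkovKernel_kernelMV (hU : Continuous U) (hG : Continuous (gradient U)) :
    IsMarkovKernel (kernelMV U δ) := by
  rw [kernelMV_eq hU hG]
  exact Kernel.IsMarkovKernel.map _ (measurable_adjustedMap hU hG)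

theorem isMarkovKernel_kernelM (hU : Continuous U) (hG : Continuous (gradient U)) :
    IsMarkovKernel (kernelM U δ γ) := by
  have := isMarkovKernel_kernelMV (δ := δ) hU hG
  have := isMarkovKernel_kernelO (d := d) (δ := δ) (γ := γ)
  rw [kernelM]; infer_instance

theorem accept_le_one (z : E d × E d) : accept U δ z ≤ 1 := by
  rw [accept, Real.exp_le_one_iff]
  simp

theorem one_sub_accept_le (z : E d × E d) :
    1 - accept U δ z ≤ |ham U (verlet U δ z) - ham U z| := by
  have h1 := Real.add_one_le_exp (-max (ham U (verlet U δ z) - ham U z) 0)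
  have h2 : max (ham U (verlet U δ z) - ham U z) 0 ≤ |ham U (verlet U δ z) - ham U z| :=
    max_le (le_abs_self _) (abs_nonneg _)
  rw [accept]; linarith

/-- The two moves are performed from the same point. They can differ only if the uniform variable
exceeds `α`, which has conditional probability `1 - α`. -/
theorem tvDist_adjusted_le (hU : Continuous U) (hG : Continuous (gradient U))
    (ω : Measure (E d × E d)) [IsProbabilityMeasure ω] :
    tvDist (ω.bind (kernelMV U δ)) (ω.map (verlet U δ)) ≤ 2 * ∫ z, (1 - accept U δ z) ∂ω := by
  set u : Measure ℝ := volume.restrict (Set.Icc (0 : ℝ) 1) with hu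
  have hA := measurable_adjustedMap (δ := δ) hU hG
  have hV := measurable_verlet (δ := δ) hG
  have hf : Measurable fun w : (E d × E d) × ℝ => (adjustedMap U δ w, verlet U δ w.1) :=
    hA.prodMk (hV.comp measurable_fst)
  have hc : IsCoupling (ω.bind (kernelMV U δ)) (ω.map (verlet U δ))
      ((ω.prod u).map fun w => (adjustedMap U δ w, verlet U δ w.1)) := by
    constructor
    · rw [Measure.map_map measurable_fst hf, kernelMV_eq hU hG, bind_map_id_prod_const _ _ hA]
      rfl
    · rw [Measure.map_map measurable_snd hf]
      have : (ω.prod u).map Prod.fst = ω := by rw [Measure.map_fst_prod]; simp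
      conv_rhs => rw [← this]
      rw [Measure.map_map hV measurable_fst]
      rfl
  have hms : MeasurableSet {q : (E d × E d) × (E d × E d) | q.1 ≠ q.2} :=
    (measurableSet_eq_fun measurable_fst measurable_snd).compl
  refine (tvDist_le_of_isCoupling hc).trans ?_
  gcongr
  rw [map_measureReal_apply hf hms]
  have hR : MeasurableSet {w : (E d × E d) × ℝ | w.2 ≤ accept U δ w.1}ᶜ :=
    (measurableSet_accepted hU hG).compl
  have hacc := measurable_accept (δ := δ) hU hG
  have h0 : ∀ z, 0 ≤ 1 - accept U δ z := fun z => sub_nonneg.2 (accept_le_one z)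
  have hle : (ω.prod u) {w : (E d × E d) × ℝ | w.2 ≤ accept U δ w.1}ᶜ =
      ∫⁻ z, ENNReal.ofReal (1 - accept U δ z) ∂ω := by
    rw [Measure.prod_apply hR]
    refine lintegral_congr fun z => ?_
    have hs : Prod.mk z ⁻¹' {w : (E d × E d) × ℝ | w.2 ≤ accept U δ w.1}ᶜ =
        Set.Ioi (accept U δ z) := by
      ext t; simp
    rw [hs, hu, Measure.restrict_apply measurableSet_Ioi]
    have : Set.Ioi (accept U δ z) ∩ Set.Icc 0 1 = Set.Ioc (accept U δ z) 1 := by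
      ext t
      have := Real.exp_pos (-max (ham U (verlet U δ z) - ham U z) 0)
      simp only [Set.mem_inter_iff, Set.mem_Ioi, Set.mem_Icc, Set.mem_Ioc]
      constructor
      · rintro ⟨h1, h2, h3⟩; exact ⟨h1, h3⟩
      · rintro ⟨h1, h2⟩; exact ⟨h1, (this.trans h1).le, h2⟩
    rw [this, Real.volume_Ioc]
  calc (ω.prod u).real ((fun w : (E d × E d) × ℝ => (adjustedMap U δ w, verlet U δ w.1)) ⁻¹'
        {q | q.1 ≠ q.2})
      ≤ (ω.prod u).real {w : (E d × E d) × ℝ | w.2 ≤ accept U δ w.1}ᶜ := by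
        refine measureReal_mono fun w hw => ?_
        intro hacc
        apply hw
        have hacc' : w.2 ≤ accept U δ w.1 := hacc
        simp [adjustedMap, hacc']
    _ = ∫ z, (1 - accept U δ z) ∂ω := by
        rw [integral_eq_lintegral_of_nonneg_ae (Filter.Eventually.of_forall h0)
          (by fun_prop), Measure.real, hle]

theorem bind_kernelM (ρ : Measure (E d × E d)) :
    ρ.bind (kernelM U δ γ) =
      ((ρ.bind (kernelO δ γ)).bind (kernelMV U δ)).bind (kernelO δ γ) := by
  rw [kernelM, ← Measure.comp_assoc, ← Measure.comp_assoc]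

/-- Telescoping through the intermediate law `ν P^n P_M`: the last `P_M` contracts the error already
made, and the new error is evaluated along the unadjusted chain, whose moments can be controlled.
The closing half-refreshment is common to both kernels and drops out by contraction. -/
theorem tvDist_lawAt_le (hU : Continuous U) (hG : Continuous (gradient U))
    (ν : Measure (E d × E d)) [IsProbabilityMeasure ν] (n : ℕ) :
    tvDist (lawAt (kernelM U δ γ) ν n) (lawAt (kernelP U δ γ) ν n) ≤
      ∑ k ∈ Finset.range n,
        2 * ∫ z, (1 - accept U δ z) ∂((lawAt (kernelP U δ γ) ν k).bind (kernelO δ γ)) := by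
  have := isMarkovKernel_kernelM (δ := δ) (γ := γ) hU hG
  have := isMarkovKernel_kernelP (δ := δ) (γ := γ) hG
  have := isMarkovKernel_kernelMV (δ := δ) hU hG
  have := isMarkovKernel_kernelO (d := d) (δ := δ) (γ := γ)
  have hV := measurable_verlet (δ := δ) hG
  induction n with
  | zero =>
    refine (tvDist_le_of_isCoupling (c := ν.map fun x => (x, x)) ⟨?_, ?_⟩).trans ?_
    · rw [Measure.map_map measurable_fst (by fun_prop)]; exact Measure.map_id
    · rw [Measure.map_map measurable_snd (by fun_prop)]; exact Measure.map_id
    · have hms : MeasurableSet {q : (E d × E d) × (E d × E d) | q.1 ≠ q.2} :=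
        (measurableSet_eq_fun measurable_fst measurable_snd).compl
      have hdiag : Measurable fun x : E d × E d => (x, x) := by fun_prop
      change 2 * (Measure.map (fun x => (x, x)) ν).real _ ≤ _
      rw [map_measureReal_apply hdiag hms]
      simp
  | succ n ih =>
    rw [Finset.sum_range_succ, lawAt_succ, lawAt_succ]
    set ρ := lawAt (kernelP U δ γ) ν n with hρ
    have : IsProbabilityMeasure ρ := isProbabilityMeasure_lawAt _ _ _
    have : IsProbabilityMeasure (lawAt (kernelM U δ γ) ν n) := isProbabilityMeasure_lawAt _ _ _
    have : IsProbabilityMeasure ((ρ.bind (kernelO δ γ)).map (verlet U δ)) :=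
      Measure.isProbabilityMeasure_map hV.aemeasurable
    have h1 := tvDist_triangle ((lawAt (kernelM U δ γ) ν n).bind (kernelM U δ γ))
      (ρ.bind (kernelM U δ γ)) (ρ.bind (kernelP U δ γ))
    have h2 := tvDist_bind_le (lawAt (kernelM U δ γ) ν n) ρ (kernelM U δ γ)
    have h3 : tvDist (ρ.bind (kernelM U δ γ)) (ρ.bind (kernelP U δ γ)) ≤
        2 * ∫ z, (1 - accept U δ z) ∂(ρ.bind (kernelO δ γ)) := by
      rw [bind_kernelM, bind_kernelP hG]
      exact (tvDist_bind_le _ _ _).trans (tvDist_adjusted_le hU hG _)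
    linarith

end Kernels

/-! ### Exponential moments under Gaussian noise. -/

section GaussianIntegrals

/-- Completing the square: the tilted density is a constant times the Gaussian density of variance
`v = 1/(1-2t)` and mean `v w`. -/
theorem lintegral_exp_quadratic_gaussianReal (w : ℝ) {t : ℝ} (ht : t < 1 / 2) :
    ∫⁻ x, ENNReal.ofReal (Real.exp (w * x + t * x ^ 2)) ∂(gaussianReal 0 1) =
      ENNReal.ofReal (Real.sqrt (1 / (1 - 2 * t)) * Real.exp (w ^ 2 / (2 * (1 - 2 * t)))) := by
  have h1 : 0 < 1 - 2 * t := by linarith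
  set v : NNReal := ⟨1 / (1 - 2 * t), by positivity⟩ with hv
  have hvr : (v : ℝ) = 1 / (1 - 2 * t) := rfl
  have hv0 : v ≠ 0 := by
    intro h
    have : (v : ℝ) = 0 := by rw [h]; rfl
    rw [hvr] at this
    have : 0 < 1 / (1 - 2 * t) := by positivity
    linarith
  rw [gaussianReal_of_var_ne_zero _ one_ne_zero,
    lintegral_withDensity_eq_lintegral_mul _ (measurable_gaussianPDF 0 1) (by fun_prop)]
  have key : ∀ x, (gaussianPDF 0 1 * fun x => ENNReal.ofReal (Real.exp (w * x + t * x ^ 2))) x =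
      ENNReal.ofReal (Real.sqrt (1 / (1 - 2 * t)) * Real.exp (w ^ 2 / (2 * (1 - 2 * t)))) *
        gaussianPDF (v * w) v x := by
    intro x
    rw [Pi.mul_apply, gaussianPDF, gaussianPDF, ← ENNReal.ofReal_mul (gaussianPDFReal_nonneg _ _ _),
      ← ENNReal.ofReal_mul (by positivity)]
    congr 1
    rw [gaussianPDFReal, gaussianPDFReal]
    have hs : Real.sqrt (1 / (1 - 2 * t)) * (Real.sqrt (2 * Real.pi * v))⁻¹ =
        (Real.sqrt (2 * Real.pi * (1 : NNReal)))⁻¹ := by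
      rw [hvr, Real.sqrt_mul (by positivity), NNReal.coe_one, mul_one, mul_inv]
      have : Real.sqrt (1 / (1 - 2 * t)) ≠ 0 := (Real.sqrt_pos.2 (by positivity)).ne'
      field_simp
    rw [← hs]
    have he : Real.exp (-(x - 0) ^ 2 / (2 * (1 : NNReal))) * Real.exp (w * x + t * x ^ 2) =
        Real.exp (w ^ 2 / (2 * (1 - 2 * t))) * Real.exp (-(x - v * w) ^ 2 / (2 * v)) := by
      rw [← Real.exp_add, ← Real.exp_add, hvr, NNReal.coe_one]
      congr 1
      field_simp
      ring
    linear_combination (Real.sqrt (1 / (1 - 2 * t)) * (Real.sqrt (2 * Real.pi * v))⁻¹) * he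
  simp_rw [key]
  rw [lintegral_const_mul _ (measurable_gaussianPDF _ _), lintegral_gaussianPDF_eq_one _ hv0,
    mul_one]

variable {F : Type*} [NormedAddCommGroup F] [InnerProductSpace ℝ F] [FiniteDimensional ℝ F]
  [MeasurableSpace F] [BorelSpace F]

theorem lintegral_exp_quadratic_stdGaussian_le (w : F) {t : ℝ} (ht : t < 1 / 2) :
    ∫⁻ g, ENNReal.ofReal (Real.exp (inner ℝ w g + t * ‖g‖ ^ 2)) ∂(stdGaussian F) ≤
      ENNReal.ofReal (Real.exp
        ((‖w‖ ^ 2 / 2 + t * Module.finrank ℝ F) / (1 - 2 * t))) := by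
  have h1 : 0 < 1 - 2 * t := by linarith
  obtain ⟨N, hN⟩ : ∃ N, N = Module.finrank ℝ F := ⟨_, rfl⟩
  rw [← hN]
  have b : OrthonormalBasis (Fin N) ℝ F := (stdOrthonormalBasis ℝ F).reindex (finCongr hN.symm)
  have hpt : ∀ x : Fin N → ℝ, ENNReal.ofReal (Real.exp (inner ℝ w (∑ i, x i • b i) +
      t * ‖∑ i, x i • b i‖ ^ 2)) =
      ∏ i, ENNReal.ofReal (Real.exp (inner ℝ w (b i) * x i + t * x i ^ 2)) := by
    intro x
    have hn : ‖∑ i, x i • b i‖ ^ 2 = ∑ i, x i ^ 2 := by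
      rw [← b.sum_sq_inner_right]
      refine Finset.sum_congr rfl fun i _ => ?_
      rw [b.orthonormal.inner_right_fintype]
    rw [← ENNReal.ofReal_prod_of_nonneg (fun i _ => (Real.exp_pos _).le), ← Real.exp_sum, hn,
      inner_sum, Finset.mul_sum, ← Finset.sum_add_distrib]
    congr 3
    ext i
    rw [real_inner_smul_right]
    ring
  rw [stdGaussian_eq_map_pi_orthonormalBasis b, lintegral_map (by fun_prop) (by fun_prop)]
  refine (le_of_eq (lintegral_congr hpt)).trans ?_
  have hind := iIndepFun_pi (μ := fun _ : Fin N => gaussianReal 0 1)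
    (X := fun i x => ENNReal.ofReal (Real.exp (inner ℝ w (b i) * x + t * x ^ 2)))
    (fun i => by fun_prop)
  rw [lintegral_prod_eq_prod_lintegral_of_indepFun _ _ hind (fun i => by fun_prop)]
  have h1d : ∀ i : Fin N, ∫⁻ x : Fin N → ℝ, ENNReal.ofReal
      (Real.exp (inner ℝ w (b i) * x i + t * x i ^ 2)) ∂(Measure.pi fun _ => gaussianReal 0 1) =
      ENNReal.ofReal (Real.sqrt (1 / (1 - 2 * t)) *
        Real.exp (inner ℝ w (b i) ^ 2 / (2 * (1 - 2 * t)))) := by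
    intro i
    rw [← lintegral_exp_quadratic_gaussianReal _ ht]
    conv_rhs => rw [← (measurePreserving_eval (fun _ : Fin N => gaussianReal 0 1) i).map_eq]
    rw [lintegral_map (by fun_prop) (by fun_prop)]
  simp_rw [h1d]
  rw [← ENNReal.ofReal_prod_of_nonneg (fun i _ => by positivity)]
  apply ENNReal.ofReal_le_ofReal
  -- Since `1/(1-2t) = 1 + 2t/(1-2t) ≤ exp(2t/(1-2t))`, the normalising factor of each coordinate
  -- becomes an exponential, and their product is linear in the dimension inside the exponent.
  have hs : Real.sqrt (1 / (1 - 2 * t)) ≤ Real.exp (t / (1 - 2 * t)) := by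
    rw [Real.sqrt_le_left (Real.exp_pos _).le, ← Real.exp_nat_mul]
    refine le_trans (le_of_eq ?_) (Real.add_one_le_exp _)
    push_cast
    field_simp
    ring
  calc ∏ i, Real.sqrt (1 / (1 - 2 * t)) *
        Real.exp (inner ℝ w (b i) ^ 2 / (2 * (1 - 2 * t)))
      ≤ ∏ i : Fin N, Real.exp (t / (1 - 2 * t)) *
        Real.exp (inner ℝ w (b i) ^ 2 / (2 * (1 - 2 * t))) := by
        gcongr
    _ = Real.exp ((‖w‖ ^ 2 / 2 + t * N) / (1 - 2 * t)) := by
        simp_rw [← Real.exp_add]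
        rw [← Real.exp_sum, Finset.sum_add_distrib,
          ← Finset.sum_div Finset.univ (fun i => inner ℝ w (b i) ^ 2), b.sum_sq_inner_left]
        congr 1
        simp
        field_simp
        ring

/-- One step of a Gaussian chain preserves a bound on the exponential moments of a contracted
functional. -/
theorem lintegral_exp_step_le {S S' : Type*} [MeasurableSpace S] [MeasurableSpace S']
    (μ : Measure S) [SFinite μ] {Φ : S × F → S'} (hΦ : Measurable Φ) {q : S → ℝ} {q' : S' → ℝ}
    (hq' : Measurable q') {b : S → ℝ} {ℓ : S → F} {A B ρ : ℝ} (hA : 0 ≤ A) (hB : 0 < B)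
    (hρ : 0 ≤ ρ)
    (hAB : 3 * A ≤ (1 - ρ) * B)
    (hΦq : ∀ s g, q' (Φ (s, g)) ≤ b s + 2 * inner ℝ (ℓ s) g + A * ‖g‖ ^ 2)
    (hℓ : ∀ s, ‖ℓ s‖ ^ 2 ≤ A * b s) (hb : ∀ s, b s ≤ ρ * q s)
    (hμ : ∀ l, 0 ≤ l → l * B ≤ 1 → ∫⁻ s, ENNReal.ofReal (Real.exp (l * q s)) ∂μ ≤
      ENNReal.ofReal (Real.exp (l * B * Module.finrank ℝ F))) :
    ∀ l, 0 ≤ l → l * B ≤ 1 →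
      ∫⁻ s, ENNReal.ofReal (Real.exp (l * q' s)) ∂((μ.prod (stdGaussian F)).map Φ) ≤
        ENNReal.ofReal (Real.exp (l * B * Module.finrank ℝ F)) := by
  intro l hl hlB
  set N : ℝ := (Module.finrank ℝ F : ℝ) with hN
  have hN0 : 0 ≤ N := Nat.cast_nonneg _
  have hlA : 3 * (l * A) ≤ 1 - ρ := by nlinarith
  have h2 : 0 < 1 - 2 * (l * A) := by nlinarith
  -- Integrating out the noise replaces `l` by `l v ρ` and adds `l v A N` to the exponent: since
  -- `‖ℓ‖² ≤ A b`, the linear term turns `l b` into at most `l b (1 + 2 l A v) = l v b`. The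
  -- induction closes because `v (A + ρB) ≤ B`, which follows from `3A ≤ (1-ρ)B` and `l B ≤ 1`.
  set v := 1 / (1 - 2 * (l * A)) with hv
  have hv0 : 0 < v := by positivity
  have hv1 : v * (1 - 2 * (l * A)) = 1 := one_div_mul_cancel h2.ne'
  have hvB : v * (A + ρ * B) ≤ B := by
    have : A + ρ * B ≤ B * (1 - 2 * (l * A)) := by nlinarith
    calc v * (A + ρ * B) ≤ v * (B * (1 - 2 * (l * A))) := by gcongr
      _ = B := by linear_combination B * hv1
  have hvρ : v * ρ ≤ 1 := by
    have : v * ρ * B ≤ 1 * B := by nlinarith [mul_nonneg hv0.le hA]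
    exact le_of_mul_le_mul_right this hB
  rw [lintegral_map (by fun_prop) hΦ, lintegral_prod _ (by fun_prop)]
  calc ∫⁻ s, ∫⁻ g, ENNReal.ofReal (Real.exp (l * q' (Φ (s, g)))) ∂(stdGaussian F) ∂μ
      ≤ ∫⁻ s, ENNReal.ofReal (Real.exp (l * v * A * N)) *
          ENNReal.ofReal (Real.exp ((l * v * ρ) * q s)) ∂μ := by
        refine lintegral_mono fun s => ?_
        have e1 : ∀ g, ENNReal.ofReal (Real.exp (l * q' (Φ (s, g)))) ≤
            ENNReal.ofReal (Real.exp (l * b s)) * ENNReal.ofReal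
              (Real.exp (inner ℝ ((2 * l) • ℓ s) g + (l * A) * ‖g‖ ^ 2)) := by
          intro g
          rw [← ENNReal.ofReal_mul (Real.exp_pos _).le, ← Real.exp_add]
          apply ENNReal.ofReal_le_ofReal
          apply Real.exp_le_exp.2
          rw [real_inner_smul_left]
          nlinarith [mul_le_mul_of_nonneg_left (hΦq s g) hl]
        refine (lintegral_mono e1).trans ?_
        rw [lintegral_const_mul' _ _ ENNReal.ofReal_ne_top]
        refine (mul_le_mul_right (lintegral_exp_quadratic_stdGaussian_le ((2 * l) • ℓ s)
          (by linarith)) _).trans ?_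
        rw [← ENNReal.ofReal_mul (Real.exp_pos _).le, ← ENNReal.ofReal_mul (Real.exp_pos _).le,
          ← Real.exp_add, ← Real.exp_add]
        apply ENNReal.ofReal_le_ofReal
        apply Real.exp_le_exp.2
        rw [norm_smul, mul_pow, Real.norm_eq_abs, sq_abs, div_eq_mul_one_div _ (1 - 2 * (l * A)),
          ← hv, ← hN]
        have i1 : v * (2 * l ^ 2) * ‖ℓ s‖ ^ 2 ≤ v * (2 * l ^ 2) * (A * b s) := by
          gcongr; exact hℓ s
        have i2 : l * v * b s ≤ l * v * (ρ * q s) := by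
          gcongr; exact hb s
        linear_combination i1 + i2 - l * b s * hv1
    _ = ENNReal.ofReal (Real.exp (l * v * A * N)) *
          ∫⁻ s, ENNReal.ofReal (Real.exp ((l * v * ρ) * q s)) ∂μ :=
        lintegral_const_mul' _ _ ENNReal.ofReal_ne_top
    _ ≤ ENNReal.ofReal (Real.exp (l * v * A * N)) *
          ENNReal.ofReal (Real.exp ((l * v * ρ) * B * N)) := by
        gcongr
        refine hμ _ (by positivity) ?_
        nlinarith [mul_nonneg hl hB.le]
    _ ≤ ENNReal.ofReal (Real.exp (l * B * N)) := by
        rw [← ENNReal.ofReal_mul (Real.exp_pos _).le, ← Real.exp_add]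
        apply ENNReal.ofReal_le_ofReal
        apply Real.exp_le_exp.2
        nlinarith [mul_le_mul_of_nonneg_left hvB (mul_nonneg hl hN0)]

/-- From `y ≤ exp(y - 1)` at `y = q/(BD)` with `D = N + 2r - 2`, one gets `y^r ≤ e^{-r} e^{ry}`. The
exponential moment then costs at most `e^r`, because `N ≤ D`, and its parameter is admissible
because `r ≤ D`. For `2r = ℓ + 1` this is the origin of `d + ℓ - 1`. -/
theorem lintegral_rpow_le_of_exp {S : Type*} [MeasurableSpace S] (μ : Measure S) {q : S → ℝ}
    (hq : ∀ s, 0 ≤ q s) {B N r : ℝ} (hB : 0 < B) (hN : 1 ≤ N) (hr : 1 ≤ r)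
    (hμ : ∀ l, 0 ≤ l → l * B ≤ 1 → ∫⁻ s, ENNReal.ofReal (Real.exp (l * q s)) ∂μ ≤
      ENNReal.ofReal (Real.exp (l * B * N))) :
    ∫⁻ s, ENNReal.ofReal (q s ^ r) ∂μ ≤ ENNReal.ofReal ((B * (N + 2 * r - 2)) ^ r) := by
  set D := N + 2 * r - 2 with hD
  have hD0 : 0 < D := by linarith
  have hBD : 0 < B * D := by positivity
  set l := r / (B * D) with hl
  have hl0 : 0 ≤ l := by positivity
  have hlB : l * B = r / D := by rw [hl]; field_simp
  have hpt : ∀ s, ENNReal.ofReal (q s ^ r) ≤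
      ENNReal.ofReal ((B * D) ^ r * Real.exp (-r)) * ENNReal.ofReal (Real.exp (l * q s)) := by
    intro s
    rw [← ENNReal.ofReal_mul (by positivity)]
    apply ENNReal.ofReal_le_ofReal
    have h1 : q s / (B * D) ≤ Real.exp (q s / (B * D) - 1) := by
      have := Real.add_one_le_exp (q s / (B * D) - 1)
      linarith
    have h0 : 0 ≤ q s / (B * D) := div_nonneg (hq s) hBD.le
    calc q s ^ r = (B * D) ^ r * (q s / (B * D)) ^ r := by
          rw [← Real.mul_rpow hBD.le h0]; congr 1; field_simp
      _ ≤ (B * D) ^ r * (Real.exp (q s / (B * D) - 1)) ^ r := by gcongr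
      _ = (B * D) ^ r * Real.exp (-r) * Real.exp (l * q s) := by
          rw [← Real.exp_mul, mul_assoc, ← Real.exp_add, hl]
          congr 2
          field_simp
          ring
  refine (lintegral_mono hpt).trans ?_
  rw [lintegral_const_mul' _ _ ENNReal.ofReal_ne_top]
  have hDr : r ≤ D := by linarith
  refine (mul_le_mul_right (hμ l hl0 (by rw [hlB]; exact (div_le_one hD0).2 hDr)) _).trans ?_
  rw [← ENNReal.ofReal_mul (by positivity)]
  apply ENNReal.ofReal_le_ofReal
  rw [mul_assoc, ← Real.exp_add]
  refine mul_le_of_le_one_right (by positivity) (Real.exp_le_one_iff.2 ?_)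
  rw [hlB]
  have : r / D * N ≤ r := by
    rw [div_mul_eq_mul_div, div_le_iff₀ hD0]
    nlinarith
  linarith

end GaussianIntegrals

/-! ### Contraction of the Verlet-and-damping map in the twisted norm. -/

section Contraction

variable {F : Type*} [NormedAddCommGroup F] [InnerProductSpace ℝ F]

/-- `G` is a strongly monotone, Lipschitz and cocoercive field vanishing at `xstar`. -/
structure IsConvexField (G : F → F) (m L : ℝ) (xstar : F) : Prop where
  lip : ∀ x y, ‖G x - G y‖ ≤ L * ‖x - y‖
  mono : ∀ x y, m * ‖x - y‖ ^ 2 ≤ inner ℝ (x - y) (G x - G y)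
  coco : ∀ x y, ‖G x - G y - m • (x - y)‖ ^ 2 ≤ L * inner ℝ (x - y) (G x - G y - m • (x - y))
  zero : G xstar = 0

/-- The range of parameters of the discretised dynamics: `ε = 1 - η²` and `δ = ε β`. -/
structure Regime (m L γ δ ε β : ℝ) : Prop where
  m_pos : 0 < m
  m_le : m ≤ L
  γ_pos : 0 < γ
  L_le : 4 * L ≤ γ ^ 2
  δ_le : 33 * (δ * γ ^ 3) ≤ m
  ε_pos : 0 < ε
  δ_eq : δ = ε * β
  ε_le : ε ≤ δ * γ
  β_le : β * γ ≤ 1.008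
  β_sub_le : (β - δ) * γ ≤ 1

namespace Regime

variable {m L γ δ ε β : ℝ}

theorem one_le (h : Regime m L γ δ ε β) : 1 ≤ β * γ := by
  have h1 := h.ε_le
  rw [h.δ_eq] at h1
  have := h.ε_pos
  by_contra hc
  push Not at hc
  nlinarith

theorem β_pos (h : Regime m L γ δ ε β) : 0 < β := by
  have h1 := h.one_le
  have := h.γ_pos
  by_contra hc
  push Not at hc
  nlinarith

theorem δ_pos (h : Regime m L γ δ ε β) : 0 < δ := by
  rw [h.δ_eq]; exact mul_pos h.ε_pos h.β_pos

theorem L_pos (h : Regime m L γ δ ε β) : 0 < L := h.m_pos.trans_le h.m_le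

theorem Lβ_le (h : Regime m L γ δ ε β) : L * β ^ 2 ≤ 0.26 := by
  have h1 := h.L_le
  have h2 := h.β_le
  have h3 := h.one_le
  have h4 : (β * γ) ^ 2 ≤ 1.008 ^ 2 := by gcongr
  nlinarith [mul_le_mul_of_nonneg_right h1 (sq_nonneg β)]

theorem ε_le_mβ (h : Regime m L γ δ ε β) : 33 * ε ≤ m * β ^ 2 := by
  have h1 := h.δ_le
  have h2 := h.ε_le
  have h3 := h.one_le
  have h4 : 1 ≤ (β * γ) ^ 2 := by nlinarith
  have hγ := h.γ_pos
  have h5 : 33 * (δ * γ) ≤ m * β ^ 2 := by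
    have : 33 * (δ * γ) * γ ^ 2 ≤ (m * β ^ 2) * γ ^ 2 := by
      nlinarith [mul_le_mul_of_nonneg_left h4 h.m_pos.le]
    exact le_of_mul_le_mul_right this (by positivity)
  linarith

theorem mβ_le (h : Regime m L γ δ ε β) : m * β ^ 2 ≤ L * β ^ 2 := by
  have := h.m_le
  gcongr

theorem ε_small (h : Regime m L γ δ ε β) : ε ≤ 0.008 := by
  have := h.ε_le_mβ; have := h.mβ_le; have := h.Lβ_le
  linarith

end Regime

/-- Up to the factor `-2`, the right-hand side is the derivative of `|x+u|² + |u|²` along `x' = u`,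
`u' = -u - g`. Write `g = h + μx`. Cocoercivity and `|h + Λu|² ≥ 0` give `-2⟨u,h⟩ ≤ ⟨x,h⟩ + Λ|u|²`,
so the indefinite term in `h` is absorbed. What is left of `|u|²` has coefficient `1 - Λ - 2μ ≥ 1 -
3·0.26 = 0.22`. -/
theorem dissipation {x u g : F} {μ Λ : ℝ} (hμ : 0 < μ) (hμΛ : μ ≤ Λ)
    (hΛ : Λ ≤ 0.26) (hh : ‖g - μ • x‖ ^ 2 ≤ Λ * inner ℝ x (g - μ • x)) :
    μ * (‖x + u‖ ^ 2 + ‖u‖ ^ 2) + 0.22 * ‖u‖ ^ 2 ≤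
      inner ℝ x g + 2 * inner ℝ u g + ‖u‖ ^ 2 := by
  set h : F := g - μ • x with hhdef
  have hgh : g = h + μ • x := by rw [hhdef]; module
  have hxg : inner ℝ x g = inner ℝ x h + μ * ‖x‖ ^ 2 := by
    rw [hgh, inner_add_right, real_inner_smul_right, real_inner_self_eq_norm_sq]
  have hug : inner ℝ u g = inner ℝ u h + μ * inner ℝ x u := by
    rw [hgh, inner_add_right, real_inner_smul_right, real_inner_comm x u]
  have hΛ0 : 0 < Λ := by linarith
  have huh : -(2 * inner ℝ u h) ≤ inner ℝ x h + Λ * ‖u‖ ^ 2 := by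
    have h0 : 0 ≤ ‖h + Λ • u‖ ^ 2 := by positivity
    rw [norm_add_sq_real, real_inner_smul_right, norm_smul, Real.norm_of_nonneg hΛ0.le,
      real_inner_comm] at h0
    have h1 : 0 ≤ Λ * (inner ℝ x h + 2 * inner ℝ u h + Λ * ‖u‖ ^ 2) := by linarith
    have := nonneg_of_mul_nonneg_right h1 hΛ0
    linarith
  rw [hxg, hug, norm_add_sq_real]
  have h1 : Λ * ‖u‖ ^ 2 ≤ 0.26 * ‖u‖ ^ 2 := by gcongr
  have h2 : μ * ‖u‖ ^ 2 ≤ 0.26 * ‖u‖ ^ 2 := by gcongr; linarith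
  linarith

theorem norm_add_smul_sq_le {P a : F} {ε k s : ℝ} (hε : 0 < ε) (hε8 : ε ≤ 0.008) (hk : 0 ≤ k)
    (hk1 : k ≤ 0.28) (hs : 0 ≤ s) (hP : ‖P‖ ≤ 1.01 * s) (ha : ‖a‖ ≤ ε * (k * s)) :
    ‖P + ε • a‖ ^ 2 ≤ ‖P‖ ^ 2 + ε ^ 2 * (2.03 * k * s ^ 2) := by
  rw [norm_add_sq_real, real_inner_smul_right, norm_smul, Real.norm_of_nonneg hε.le]
  have h1 : inner ℝ P a ≤ (1.01 * s) * (ε * (k * s)) :=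
    (real_inner_le_norm _ _).trans (by gcongr)
  have h2 : (ε * ‖a‖) ^ 2 ≤ (ε * (ε * (k * s))) ^ 2 := by gcongr
  have h3 : ε ^ 2 * k ≤ 0.01 := by
    have : ε ^ 2 * k ≤ 0.008 ^ 2 * 0.28 := by gcongr
    linarith
  have h4 : (ε * (ε * (k * s))) ^ 2 ≤ ε ^ 2 * (0.01 * k * s ^ 2) := by
    have : 0 ≤ ε ^ 2 * (k * s ^ 2) := by positivity
    calc (ε * (ε * (k * s))) ^ 2 = (ε ^ 2 * k) * (ε ^ 2 * (k * s ^ 2)) := by ring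
      _ ≤ 0.01 * (ε ^ 2 * (k * s ^ 2)) := by gcongr
      _ = _ := by ring
  have h5 := mul_le_mul_of_nonneg_left h1 hε.le
  linarith

/-- In the rescaled variables the transport `εu` and the damping `-εu` cancel in `x + u`. Up to
second-order corrections the step is therefore an explicit Euler step of length `ε` with the
averaged force `p = (g + g₁)/2`. Dissipation is used at both end points and averaged, the
displacement `x₁ - x` being of order `ε`. -/
theorem contraction_aux {x u g x₁ g₁ : F} {ε μ Λ : ℝ} (hε : 0 < ε) (hεμ : 33 * ε ≤ μ) (hμΛ : μ ≤ Λ)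
    (hΛ : Λ ≤ 0.26) (hx₁ : x₁ = x + ε • u - (ε ^ 2 / 2) • g)
    (hh : ‖g - μ • x‖ ^ 2 ≤ Λ * inner ℝ x (g - μ • x)) (hg : ‖g‖ ≤ Λ * ‖x‖)
    (hh₁ : ‖g₁ - μ • x₁‖ ^ 2 ≤ Λ * inner ℝ x₁ (g₁ - μ • x₁)) (hg₁ : ‖g₁‖ ≤ Λ * ‖x₁‖) :
    ‖x + u - (ε / 2) • g - (ε / 2 * (1 - ε)) • g₁‖ ^ 2 +
      ‖(1 - ε) • (u - (ε / 2) • (g + g₁))‖ ^ 2 ≤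
      (1 - 1.5 * μ * ε) * (‖x + u‖ ^ 2 + ‖u‖ ^ 2) := by
  have hε8 : ε ≤ 0.008 := by linarith
  have hμ0 : 0 < μ := by linarith
  obtain ⟨X, hX⟩ : ∃ X, X = ‖x‖ := ⟨_, rfl⟩
  obtain ⟨W, hW⟩ : ∃ W, W = ‖u‖ := ⟨_, rfl⟩
  have hX0 : 0 ≤ X := hX ▸ norm_nonneg _
  have hW0 : 0 ≤ W := hW ▸ norm_nonneg _
  obtain ⟨s, hs⟩ : ∃ s, s = X + W := ⟨_, rfl⟩
  have hs0 : 0 ≤ s := by rw [hs]; positivity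
  have hg' : ‖g‖ ≤ 0.26 * s := by
    refine hg.trans ?_
    rw [← hX]
    gcongr
    linarith
  have hd : ‖x₁ - x‖ ≤ ε * s := by
    have e : x₁ - x = ε • u - (ε ^ 2 / 2) • g := by rw [hx₁]; module
    have h1 := norm_sub_le (ε • u) ((ε ^ 2 / 2) • g)
    rw [norm_smul, norm_smul, Real.norm_of_nonneg hε.le, Real.norm_of_nonneg (by positivity),
      ← hW] at h1
    have h2 : ε ^ 2 / 2 * ‖g‖ ≤ ε * X := by
      have : ‖g‖ ≤ 0.26 * X := hg.trans (by rw [← hX]; gcongr)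
      calc ε ^ 2 / 2 * ‖g‖ = ε * (ε / 2 * ‖g‖) := by ring
        _ ≤ ε * (1 * X) := by
          refine mul_le_mul_of_nonneg_left ?_ hε.le
          calc ε / 2 * ‖g‖ ≤ (0.008 / 2) * (0.26 * X) := by gcongr
            _ ≤ 1 * X := by linarith
        _ = ε * X := by ring
    rw [e, hs, mul_add]
    linarith
  have hd8 : ‖x₁ - x‖ ≤ 0.008 * s := hd.trans (by gcongr)
  have hx1s : ‖x₁‖ ≤ 1.008 * s := by
    have := norm_add_le (x₁ - x) x
    rw [sub_add_cancel, ← hX] at this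
    linarith
  have hg₁' : ‖g₁‖ ≤ 0.27 * s := by
    refine hg₁.trans ?_
    calc Λ * ‖x₁‖ ≤ 0.26 * (1.008 * s) := by gcongr
      _ ≤ _ := by linarith
  obtain ⟨p, hp⟩ : ∃ p : F, p = (1 / 2 : ℝ) • (g + g₁) := ⟨_, rfl⟩
  have hp' : ‖p‖ ≤ 0.27 * s := by
    have := norm_add_le g g₁
    rw [hp, norm_smul, Real.norm_of_nonneg (by norm_num)]
    linarith
  have e1 : x + u - (ε / 2) • g - (ε / 2 * (1 - ε)) • g₁ =
      (x + u - ε • p) + ε • ((ε / 2) • g₁) := by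
    rw [hp]; module
  have e2 : (1 - ε) • (u - (ε / 2) • (g + g₁)) = (u - ε • (u + p)) + ε • (ε • p) := by
    rw [hp]; module
  have hP : ‖x + u - ε • p‖ ≤ 1.01 * s := by
    have h1 := norm_sub_le (x + u) (ε • p)
    have h2 := norm_add_le x u
    rw [norm_smul, Real.norm_of_nonneg hε.le] at h1
    have h3 : ε * ‖p‖ ≤ 0.008 * (0.27 * s) := by gcongr
    linarith
  have hR : ‖u - ε • (u + p)‖ ≤ 1.01 * s := by
    have h2 := norm_add_le ((1 - ε) • u) (-(ε • p))
    have e : u - ε • (u + p) = (1 - ε) • u + -(ε • p) := by module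
    rw [norm_neg, norm_smul, norm_smul, Real.norm_of_nonneg hε.le,
      Real.norm_of_nonneg (by linarith)] at h2
    have h3 : ε * ‖p‖ ≤ 0.008 * (0.27 * s) := by gcongr
    have h4 : (1 - ε) * ‖u‖ ≤ 1 * W := by rw [← hW]; gcongr; linarith
    rw [e]
    linarith
  have hPa := norm_add_smul_sq_le hε hε8 (k := 0.14) (by norm_num) (by norm_num) hs0 hP
    (a := (ε / 2) • g₁) (by
      rw [norm_smul, Real.norm_of_nonneg (by positivity)]
      calc ε / 2 * ‖g₁‖ ≤ ε / 2 * (0.27 * s) := by gcongr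
        _ ≤ ε * (0.14 * s) := by nlinarith [mul_nonneg hε.le hs0])
  have hRc := norm_add_smul_sq_le hε hε8 (k := 0.27) (by norm_num) (by norm_num) hs0 hR
    (a := ε • p) (by
      rw [norm_smul, Real.norm_of_nonneg hε.le]
      gcongr)
  have hmain : ‖x + u - ε • p‖ ^ 2 + ‖u - ε • (u + p)‖ ^ 2 =
      ‖x + u‖ ^ 2 + ‖u‖ ^ 2 - 2 * ε * (inner ℝ x p + 2 * inner ℝ u p + ‖u‖ ^ 2) +
        ε ^ 2 * (‖p‖ ^ 2 + ‖u + p‖ ^ 2) := by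
    rw [norm_sub_sq_real, norm_sub_sq_real u, norm_smul, norm_smul, Real.norm_of_nonneg hε.le,
      real_inner_smul_right, real_inner_smul_right, inner_add_left, inner_add_right,
      real_inner_self_eq_norm_sq]
    ring
  have hup : ‖p‖ ^ 2 + ‖u + p‖ ^ 2 ≤ 1.7 * s ^ 2 := by
    have h1 := norm_add_le u p
    have h2 : ‖u + p‖ ^ 2 ≤ (1.27 * s) ^ 2 := by
      gcongr; linarith
    have h3 : ‖p‖ ^ 2 ≤ (0.27 * s) ^ 2 := by gcongr
    linarith [sq_nonneg s]
  have hd0 := dissipation (u := u) hμ0 hμΛ hΛ hh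
  have hd1 := dissipation (u := u) hμ0 hμΛ hΛ hh₁
  have hcross : inner ℝ x₁ g₁ ≤ inner ℝ x g₁ + ε * (0.27 * s ^ 2) := by
    have h1 : inner ℝ (x₁ - x) g₁ ≤ (ε * s) * (0.27 * s) :=
      (real_inner_le_norm _ _).trans (by gcongr)
    rw [inner_sub_left] at h1
    linarith
  have hshift : μ * ‖x + u‖ ^ 2 ≤ μ * ‖x₁ + u‖ ^ 2 + ε * (0.53 * s ^ 2) := by
    have e : x + u = (x₁ + u) - (x₁ - x) := by abel
    have h0 : ‖x + u‖ ≤ s := by rw [hs, hX, hW]; exact norm_add_le _ _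
    have h1 : ‖x + u‖ - ‖x₁ - x‖ ≤ ‖x₁ + u‖ := by
      have := norm_sub_le (x₁ + u) (x₁ - x)
      rw [← e] at this
      linarith
    have h2 : ‖x + u‖ ^ 2 ≤ ‖x₁ + u‖ ^ 2 + 2 * (ε * s) * s := by
      have h3 : ‖x + u‖ ≤ ‖x₁ + u‖ + ε * s := by linarith
      by_cases h4 : ‖x + u‖ ≤ ‖x₁ + u‖
      · have : ‖x + u‖ ^ 2 ≤ ‖x₁ + u‖ ^ 2 := by gcongr
        have : 0 ≤ 2 * (ε * s) * s := by positivity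
        linarith
      · push Not at h4
        have h5 : (‖x + u‖ - ‖x₁ + u‖) * (‖x + u‖ + ‖x₁ + u‖) ≤ (ε * s) * (s + s) := by
          gcongr
          · linarith
          · linarith
        linarith
    calc μ * ‖x + u‖ ^ 2 ≤ μ * (‖x₁ + u‖ ^ 2 + 2 * (ε * s) * s) := by gcongr
      _ = μ * ‖x₁ + u‖ ^ 2 + μ * (2 * (ε * s) * s) := by ring
      _ ≤ μ * ‖x₁ + u‖ ^ 2 + 0.26 * (2 * (ε * s) * s) := by gcongr; linarith
      _ ≤ _ := by linarith [mul_nonneg hε.le (sq_nonneg s)]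
  have hxp : inner ℝ x p = 1 / 2 * (inner ℝ x g + inner ℝ x g₁) := by
    rw [hp, real_inner_smul_right, inner_add_right]
  have hupi : inner ℝ u p = 1 / 2 * (inner ℝ u g + inner ℝ u g₁) := by
    rw [hp, real_inner_smul_right, inner_add_right]
  have hdiss : μ * (‖x + u‖ ^ 2 + ‖u‖ ^ 2) + 0.22 * ‖u‖ ^ 2 - ε * (0.4 * s ^ 2) ≤
      inner ℝ x p + 2 * inner ℝ u p + ‖u‖ ^ 2 := by
    rw [hxp, hupi]
    linarith
  have hqX : X ^ 2 ≤ 2 * (‖x + u‖ ^ 2 + ‖u‖ ^ 2) := by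
    have h1 : X ≤ ‖x + u‖ + ‖u‖ := by
      have := norm_sub_le (x + u) u
      rwa [add_sub_cancel_right, ← hX] at this
    have : X ^ 2 ≤ (‖x + u‖ + ‖u‖) ^ 2 := by gcongr
    linarith [sq_nonneg (‖x + u‖ - ‖u‖)]
  have hs2 : s ^ 2 ≤ 2 * X ^ 2 + 2 * W ^ 2 := by
    rw [hs]; linarith [sq_nonneg (X - W)]
  -- The second-order errors add up to at most `1.7 + 2·0.4 + 2.03·(0.14 + 0.27) < 3.4`, times `ε²
  -- s²`. As `ε ≤ μ/33`, they consume `0.5 μ` of the rate `2μ`, leaving `1.5 μ`, and at most the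
  -- spare `2·0.22 |u|²`.
  have hfin : ε * (3.4 * s ^ 2) ≤ 0.5 * μ * (‖x + u‖ ^ 2 + ‖u‖ ^ 2) + 0.44 * ‖u‖ ^ 2 := by
    have h1 : ε * (3.4 * s ^ 2) ≤ μ / 33 * (3.4 * (2 * X ^ 2 + 2 * W ^ 2)) := by
      gcongr; linarith
    have h2 : μ * X ^ 2 ≤ μ * (2 * (‖x + u‖ ^ 2 + ‖u‖ ^ 2)) := by gcongr
    have h3 : μ * W ^ 2 ≤ 0.26 * W ^ 2 := by gcongr; linarith
    have h4 : 0 ≤ μ * X ^ 2 := by positivity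
    have h5 : 0 ≤ μ * (‖x + u‖ ^ 2 + ‖u‖ ^ 2) := by positivity
    rw [← hW] at h2 h5 ⊢
    linarith [sq_nonneg W]
  rw [e1, e2]
  have k1 := mul_le_mul_of_nonneg_left hfin hε.le
  have k2 := mul_le_mul_of_nonneg_left hdiss hε.le
  have k3 := mul_le_mul_of_nonneg_left hup (sq_nonneg ε)
  have k4 : 0 ≤ ε ^ 2 * s ^ 2 := by positivity
  linarith

/-- The quadratic functional `|x + β v|² + |β v|²`. -/
def twisted (β : ℝ) (z : F × F) : ℝ := ‖z.1 + β • z.2‖ ^ 2 + ‖β • z.2‖ ^ 2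

theorem twisted_nonneg (β : ℝ) (z : F × F) : 0 ≤ twisted β z := by
  unfold twisted; positivity

theorem norm_fst_sq_le_twisted (β : ℝ) (z : F × F) : ‖z.1‖ ^ 2 ≤ 2 * twisted β z := by
  have h1 : ‖z.1‖ ≤ ‖z.1 + β • z.2‖ + ‖β • z.2‖ := by
    have := norm_sub_le (z.1 + β • z.2) (β • z.2)
    rwa [add_sub_cancel_right] at this
  unfold twisted
  nlinarith [sq_nonneg (‖z.1 + β • z.2‖ - ‖β • z.2‖), norm_nonneg z.1]

/-- The deterministic part of one transition: a Verlet step, then the damping of the velocity. -/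
def drift (G : F → F) (δ a : ℝ) (z : F × F) : F × F :=
  ((verletField G δ z).1, a • (verletField G δ z).2)

variable {G : F → F} {m L γ δ ε β : ℝ} {xstar : F}

/-- Rescaling: with `x` the difference of positions, `u` that of velocities times `β`, and forces
times `β²`, the time step becomes `ε` and the constants `mβ²`, `Lβ²`. -/
theorem twisted_drift_sub_le (hG : IsConvexField G m L xstar) (h : Regime m L γ δ ε β)
    (z z' : F × F) :
    twisted β (drift G δ (1 - ε) z - drift G δ (1 - ε) z') ≤
      (1 - 1.5 * (m * β * δ)) * twisted β (z - z') := by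
  set x₁ := (verletField G δ z).1 with hx₁
  set x₁' := (verletField G δ z').1 with hx₁'
  have hβ := h.β_pos
  have hx1 : x₁ = z.1 + δ • z.2 - (δ ^ 2 / 2) • G z.1 := rfl
  have hx1' : x₁' = z'.1 + δ • z'.2 - (δ ^ 2 / 2) • G z'.1 := rfl
  have hx₁s : x₁ - x₁' = (z.1 - z'.1) + ε • β • (z.2 - z'.2) -
      (ε ^ 2 / 2) • β ^ 2 • (G z.1 - G z'.1) := by
    rw [hx1, hx1', h.δ_eq]; module
  have hcoco : ∀ x x', ‖β ^ 2 • (G x - G x') - (m * β ^ 2) • (x - x')‖ ^ 2 ≤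
      L * β ^ 2 * inner ℝ (x - x') (β ^ 2 • (G x - G x') - (m * β ^ 2) • (x - x')) := by
    intro x x'
    have := hG.coco x x'
    have e : β ^ 2 • (G x - G x') - (m * β ^ 2) • (x - x') =
        β ^ 2 • (G x - G x' - m • (x - x')) := by module
    rw [e, norm_smul, real_inner_smul_right, mul_pow, Real.norm_of_nonneg (by positivity)]
    calc (β ^ 2) ^ 2 * ‖G x - G x' - m • (x - x')‖ ^ 2
        ≤ (β ^ 2) ^ 2 * (L * inner ℝ (x - x') (G x - G x' - m • (x - x'))) := by gcongr
      _ = _ := by ring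
  have hlip : ∀ x x', ‖β ^ 2 • (G x - G x')‖ ≤ L * β ^ 2 * ‖x - x'‖ := by
    intro x x'
    have := hG.lip x x'
    rw [norm_smul, Real.norm_of_nonneg (by positivity)]
    calc β ^ 2 * ‖G x - G x'‖ ≤ β ^ 2 * (L * ‖x - x'‖) := by gcongr
      _ = _ := by ring
  have key := contraction_aux h.ε_pos h.ε_le_mβ h.mβ_le h.Lβ_le hx₁s (hcoco _ _) (hlip _ _)
    (hcoco _ _) (hlip _ _)
  have e1 : (drift G δ (1 - ε) z - drift G δ (1 - ε) z').1 +
      β • (drift G δ (1 - ε) z - drift G δ (1 - ε) z').2 =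
      (z.1 - z'.1) + β • (z.2 - z'.2) - (ε / 2) • (β ^ 2 • (G z.1 - G z'.1)) -
      (ε / 2 * (1 - ε)) • (β ^ 2 • (G x₁ - G x₁')) := by
    simp only [drift, verletField, Prod.fst_sub, Prod.snd_sub, ← hx1, ← hx1']
    rw [hx₁s, h.δ_eq]
    module
  have e2 : β • (drift G δ (1 - ε) z - drift G δ (1 - ε) z').2 =
      (1 - ε) • (β • (z.2 - z'.2) - (ε / 2) • (β ^ 2 • (G z.1 - G z'.1) +
        β ^ 2 • (G x₁ - G x₁'))) := by
    simp only [drift, verletField, Prod.snd_sub, ← hx1, ← hx1']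
    rw [h.δ_eq]
    module
  unfold twisted
  rw [e1, e2]
  refine key.trans (le_of_eq ?_)
  simp only [Prod.fst_sub, Prod.snd_sub]
  rw [h.δ_eq]
  ring

/-- The twisted norm sees velocities only through `βv ≈ v/γ`, and recovering `v` from it would cost
a factor `γ`. Velocities are therefore also followed by this direct recursion. -/
theorem norm_snd_drift_sub_le (hG : IsConvexField G m L xstar) (h : Regime m L γ δ ε β)
    (z z' : F × F) :
    ‖(drift G δ (1 - ε) z - drift G δ (1 - ε) z').2‖ ≤ (1 - ε) * (‖(z - z').2‖ +
      δ / 2 * (L * (‖(z - z').1‖ + ‖(drift G δ (1 - ε) z - drift G δ (1 - ε) z').1‖))) := by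
  set x₁ := (verletField G δ z).1 with hx₁
  set x₁' := (verletField G δ z').1 with hx₁'
  have hε := h.ε_small
  have hδ := h.δ_pos
  have e : (drift G δ (1 - ε) z - drift G δ (1 - ε) z').2 =
      (1 - ε) • ((z - z').2 - (δ / 2) • ((G z.1 - G z'.1) + (G x₁ - G x₁'))) := by
    have hx1 : x₁ = z.1 + δ • z.2 - (δ ^ 2 / 2) • G z.1 := rfl
    have hx1' : x₁' = z'.1 + δ • z'.2 - (δ ^ 2 / 2) • G z'.1 := rfl
    simp only [drift, verletField, Prod.snd_sub, ← hx1, ← hx1']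
    module
  have e' : (drift G δ (1 - ε) z - drift G δ (1 - ε) z').1 = x₁ - x₁' := rfl
  rw [e, e', norm_smul, Real.norm_of_nonneg (by linarith)]
  refine mul_le_mul_of_nonneg_left ?_ (by linarith)
  refine (norm_sub_le _ _).trans ?_
  rw [norm_smul, Real.norm_of_nonneg (by positivity), mul_add L]
  gcongr
  refine (norm_add_le _ _).trans ?_
  gcongr
  · exact hG.lip _ _
  · exact hG.lip _ _

theorem drift_fixed (hG : IsConvexField G m L xstar) (δ a : ℝ) :
    drift G δ a (xstar, 0) = (xstar, 0) := by
  simp [drift, verletField, hG.zero]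

end Contraction

/-- Put `u = δγ` and `ε = 1 - e^{-u}`. From `33 δγ³ ≤ m ≤ L ≤ γ²/4` comes `u ≤ 1/132`, and `1 + u ≤
e^u` gives `u ≤ ε(1 + u)`. Hence `βγ = u/ε ≤ 1 + u ≤ 1.008`, and `(β - δ)γ = u(1-ε)/ε ≤ 1`. -/
theorem regime_of_le {m L γ δ : ℝ} (hm : 0 < m) (hmL : m ≤ L) (hγ : 2 * Real.sqrt L ≤ γ)
    (hδ : 0 < δ) (hδm : δ ≤ m / (33 * γ ^ 3)) :
    Regime m L γ δ (1 - eta δ γ ^ 2) (δ / (1 - eta δ γ ^ 2)) := by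
  have hL : 0 < L := hm.trans_le hmL
  have hsL : 0 < Real.sqrt L := Real.sqrt_pos.2 hL
  have hγ0 : 0 < γ := by linarith
  have hL4 : 4 * L ≤ γ ^ 2 := by
    have : (2 * Real.sqrt L) ^ 2 ≤ γ ^ 2 := by gcongr
    rwa [mul_pow, Real.sq_sqrt hL.le, show (2 : ℝ) ^ 2 = 4 by norm_num] at this
  have hδ33 : 33 * (δ * γ ^ 3) ≤ m := by
    rw [le_div_iff₀ (by positivity)] at hδm
    linarith
  have he : eta δ γ ^ 2 = Real.exp (-(δ * γ)) := by
    rw [eta, ← Real.exp_nat_mul]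
    congr 1
    push_cast
    ring
  obtain ⟨u, hu⟩ : ∃ u, u = δ * γ := ⟨_, rfl⟩
  have hu0 : 0 < u := by rw [hu]; positivity
  have hu1 : u ≤ 1 / 132 := by
    have h1 : 33 * u * γ ^ 2 ≤ 1 / 4 * γ ^ 2 := by
      rw [hu]
      linarith
    have := le_of_mul_le_mul_right h1 (by positivity)
    linarith
  rw [he, ← hu]
  have h1 := Real.add_one_le_exp (-u)
  have h2 := Real.add_one_le_exp u
  have hpos := Real.exp_pos (-u)
  have hprod : Real.exp (-u) * Real.exp u = 1 := by rw [← Real.exp_add]; simp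
  have h3 : Real.exp (-u) < 1 := by rw [Real.exp_lt_one_iff]; linarith
  obtain ⟨ε, hε⟩ : ∃ ε, ε = 1 - Real.exp (-u) := ⟨_, rfl⟩
  have hexp : Real.exp (-u) = 1 - ε := by linarith
  rw [← hε]
  have hε0 : 0 < ε := by linarith
  have hkey : u ≤ ε * (1 + u) := by
    rw [hexp] at hprod hpos
    nlinarith
  refine ⟨hm, hmL, hγ0, hL4, hδ33, hε0, ?_, ?_, ?_, ?_⟩
  · field_simp
  · rw [← hu]; linarith
  · rw [div_mul_eq_mul_div, ← hu, div_le_iff₀ hε0]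
    nlinarith
  · have e : (δ / ε - δ) * γ = u * (1 - ε) / ε := by rw [hu]; field_simp
    rw [e, div_le_one hε0]
    nlinarith

/-! ### Bounds in mean and Minkowski's inequality. -/

section Mean

variable {S : Type*} [MeasurableSpace S]

/-- The mean of the positive part of `f` is at most `C`. -/
def MeanLE (μ : Measure S) (f : S → ℝ) (C : ℝ) : Prop :=
  ∫⁻ s, ENNReal.ofReal (f s) ∂μ ≤ ENNReal.ofReal C

variable {μ : Measure S} {f g : S → ℝ} {A B C : ℝ}

theorem MeanLE.mono_ae (h : MeanLE μ g C) (hfg : ∀ᵐ s ∂μ, f s ≤ g s) : MeanLE μ f C :=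
  (lintegral_mono_ae (hfg.mono fun _ hs => ENNReal.ofReal_le_ofReal hs)).trans h

theorem MeanLE.mono (h : MeanLE μ g C) (hfg : ∀ s, f s ≤ g s) : MeanLE μ f C :=
  h.mono_ae (Filter.Eventually.of_forall hfg)

theorem MeanLE.trans_le (h : MeanLE μ f C) (hCB : C ≤ B) : MeanLE μ f B :=
  le_trans h (ENNReal.ofReal_le_ofReal hCB)

theorem MeanLE.const_mul (h : MeanLE μ f C) {a : ℝ} (ha : 0 ≤ a) :
    MeanLE μ (fun s => a * f s) (a * C) := by
  unfold MeanLE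
  simp_rw [ENNReal.ofReal_mul ha]
  rw [lintegral_const_mul' _ _ ENNReal.ofReal_ne_top]
  exact mul_le_mul_right h _

theorem MeanLE.add (hf : MeanLE μ f A) (hg : MeanLE μ g B) (hfm : Measurable f) (hA : 0 ≤ A)
    (hB : 0 ≤ B) : MeanLE μ (fun s => f s + g s) (A + B) := by
  unfold MeanLE
  rw [ENNReal.ofReal_add hA hB]
  refine (lintegral_mono fun s => ENNReal.ofReal_add_le).trans ?_
  rw [lintegral_add_left (by fun_prop)]
  exact add_le_add hf hg

theorem meanLE_const [IsProbabilityMeasure μ] (a : ℝ) : MeanLE μ (fun _ => a) a := by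
  simp [MeanLE]

theorem meanLE_map_iff {S' : Type*} [MeasurableSpace S'] {Φ : S' → S} (hΦ : Measurable Φ)
    {μ : Measure S'} (hf : Measurable f) :
    MeanLE (μ.map Φ) f C ↔ MeanLE μ (fun s => f (Φ s)) C := by
  rw [MeanLE, MeanLE, lintegral_map (by fun_prop) hΦ]

theorem MeanLE.comp_fst {S' : Type*} [MeasurableSpace S'] {ν : Measure S'} [IsProbabilityMeasure ν]
    [SFinite μ] (h : MeanLE μ f C) (hf : Measurable f) :
    MeanLE (μ.prod ν) (fun s => f s.1) C := by
  rw [← meanLE_map_iff measurable_fst hf, Measure.map_fst_prod]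
  simpa using h

theorem rpow_add_le_weighted {a b θ p : ℝ} (ha : 0 ≤ a) (hb : 0 ≤ b) (hθ : 0 < θ) (hθ1 : θ < 1)
    (hp : 1 ≤ p) : (a + b) ^ p ≤ θ * (a / θ) ^ p + (1 - θ) * (b / (1 - θ)) ^ p := by
  have h1 : 0 < 1 - θ := by linarith
  have h := (convexOn_rpow hp).2 (x := a / θ) (y := b / (1 - θ)) (Set.mem_Ici.2 (by positivity))
    (Set.mem_Ici.2 (by positivity)) hθ.le h1.le (by ring)
  simp only [smul_eq_mul] at h
  rwa [mul_div_cancel₀ _ hθ.ne', mul_div_cancel₀ _ h1.ne'] at h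

/-- Minkowski's inequality in `L^p`, obtained from the convexity of `x ↦ x^p` with the optimal
weights `A/(A+B)` and `B/(A+B)`. -/
theorem MeanLE.rpow_add {p : ℝ} (hp : 1 ≤ p) (hfm : Measurable f) (hf0 : ∀ s, 0 ≤ f s)
    (hg0 : ∀ s, 0 ≤ g s) (hA : 0 < A) (hB : 0 < B) (hf : MeanLE μ (fun s => f s ^ p) (A ^ p))
    (hg : MeanLE μ (fun s => g s ^ p) (B ^ p)) :
    MeanLE μ (fun s => (f s + g s) ^ p) ((A + B) ^ p) := by
  set θ := A / (A + B) with hθ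
  have hAB : 0 < A + B := by positivity
  have hθ0 : 0 < θ := by positivity
  have h1θ : 1 - θ = B / (A + B) := by rw [hθ]; field_simp; ring
  have hθ1 : 0 < 1 - θ := by rw [h1θ]; positivity
  have e1 : A * θ⁻¹ = A + B := by rw [hθ]; field_simp
  have e2 : B * (1 - θ)⁻¹ = A + B := by rw [h1θ]; field_simp
  have hθp : 0 ≤ (θ⁻¹) ^ p := by positivity
  have hθp' : 0 ≤ ((1 - θ)⁻¹) ^ p := by positivity
  have h := ((hf.const_mul (mul_nonneg hθ0.le hθp)).add
    (hg.const_mul (mul_nonneg hθ1.le hθp')) (by fun_prop) (by positivity) (by positivity))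
  refine (h.mono fun s => ?_).trans_le (le_of_eq ?_)
  · refine (rpow_add_le_weighted (hf0 s) (hg0 s) hθ0 (by linarith) hp).trans (le_of_eq ?_)
    rw [div_eq_mul_inv, div_eq_mul_inv, Real.mul_rpow (hf0 s) (by positivity),
      Real.mul_rpow (hg0 s) (by positivity)]
    ring
  · have c1 : (A + B) ^ p = (θ⁻¹) ^ p * A ^ p := by
      rw [← Real.mul_rpow (by positivity) hA.le, mul_comm θ⁻¹, e1]
    have c2 : (A + B) ^ p = ((1 - θ)⁻¹) ^ p * B ^ p := by
      rw [← Real.mul_rpow (by positivity) hB.le, mul_comm (1 - θ)⁻¹, e2]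
    linear_combination (-θ) * c1 - (1 - θ) * c2

end Mean

/-! ### The Euclidean norm of phase space. -/

section PhaseNorm

variable {F : Type*} [NormedAddCommGroup F]

theorem phaseNorm_nonneg (z : F × F) : 0 ≤ phaseNorm z := Real.sqrt_nonneg _

theorem phaseNorm_sq (z : F × F) : phaseNorm z ^ 2 = ‖z.1‖ ^ 2 + ‖z.2‖ ^ 2 :=
  Real.sq_sqrt (by positivity)

theorem norm_fst_le_phaseNorm (z : F × F) : ‖z.1‖ ≤ phaseNorm z :=
  Real.le_sqrt_of_sq_le (by nlinarith [sq_nonneg ‖z.2‖])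

theorem norm_snd_le_phaseNorm (z : F × F) : ‖z.2‖ ≤ phaseNorm z :=
  Real.le_sqrt_of_sq_le (by nlinarith [sq_nonneg ‖z.1‖])

theorem phaseNorm_le (z : F × F) : phaseNorm z ≤ ‖z.1‖ + ‖z.2‖ := by
  rw [phaseNorm, Real.sqrt_le_left (by positivity)]
  nlinarith [norm_nonneg z.1, norm_nonneg z.2]

theorem phaseNorm_add_le (z w : F × F) : phaseNorm (z + w) ≤ phaseNorm z + phaseNorm w := by
  have key : ∀ z : F × F, phaseNorm z = ‖WithLp.toLp 2 z‖ := fun z => by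
    rw [WithLp.prod_norm_eq_of_L2]; rfl
  rw [key, key, key, WithLp.toLp_add]
  exact norm_add_le _ _

theorem continuous_phaseNorm : Continuous (phaseNorm : F × F → ℝ) := by
  unfold phaseNorm; fun_prop

end PhaseNorm

/-! ### The synchronously coupled chain. -/

section Coupled

variable {F : Type*} [NormedAddCommGroup F] [InnerProductSpace ℝ F] [FiniteDimensional ℝ F]
  [MeasurableSpace F] [BorelSpace F]

/-- State of the coupled chain: the initial point, the chain started there, the chain started at
the equilibrium point with the same noises, and the accumulated noise of the velocity. -/
abbrev Coupled (F : Type*) : Type _ := (F × F) × (F × F) × (F × F) × F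

/-- The initial coupled state. -/
def coupledInit (η σ : ℝ) (zstar : F × F) (w : (F × F) × F) : Coupled F :=
  (w.1, refreshMap η σ w, refreshMap η σ (zstar, w.2), σ • w.2)

/-- One transition of the coupled chain. -/
def coupledStep (G : F → F) (δ a s : ℝ) (w : Coupled F × F) : Coupled F :=
  (w.1.1, refreshMap a s (verletField G δ w.1.2.1, w.2),
    refreshMap a s (verletField G δ w.1.2.2.1, w.2), a • w.1.2.2.2 + s • w.2)

/-- The law of the coupled chain. -/
def coupledLaw (G : F → F) (δ η σ a s : ℝ) (zstar : F × F) (ν : Measure (F × F)) :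
    ℕ → Measure (Coupled F)
  | 0 => (ν.prod (stdGaussian F)).map (coupledInit η σ zstar)
  | k + 1 => ((coupledLaw G δ η σ a s zstar ν k).prod (stdGaussian F)).map (coupledStep G δ a s)

/-- The law, before the Verlet step, of the unadjusted chain. -/
def preVerletLaw (G : F → F) (δ η σ a s : ℝ) (ν : Measure (F × F)) : ℕ → Measure (F × F)
  | 0 => refresh η σ ν
  | k + 1 => refresh a s ((preVerletLaw G δ η σ a s ν k).map (verletField G δ))

theorem measurable_coupledInit (η σ : ℝ) (zstar : F × F) :
    Measurable (coupledInit η σ zstar) := by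
  unfold coupledInit refreshMap; fun_prop

theorem measurable_coupledStep {G : F → F} (hG : Continuous G) (δ a s : ℝ) :
    Measurable (coupledStep G δ a s) := by
  have h1 := measurable_verletField hG δ
  have h2 := measurable_refreshMap (F := F) a s
  unfold coupledStep; fun_prop

variable {G : F → F} {δ η σ a s : ℝ} {zstar : F × F} {ν : Measure (F × F)}
  [IsProbabilityMeasure ν]

theorem isProbabilityMeasure_coupledLaw (hG : Continuous G) (k : ℕ) :
    IsProbabilityMeasure (coupledLaw G δ η σ a s zstar ν k) := by
  induction k with
  | zero => exact Measure.isProbabilityMeasure_map (measurable_coupledInit _ _ _).aemeasurable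
  | succ k ih => exact Measure.isProbabilityMeasure_map (measurable_coupledStep hG _ _ _).aemeasurable

theorem map_coupledLaw_fst (hG : Continuous G) (k : ℕ) :
    (coupledLaw G δ η σ a s zstar ν k).map Prod.fst = ν := by
  induction k with
  | zero =>
    rw [coupledLaw, Measure.map_map measurable_fst (measurable_coupledInit _ _ _)]
    change (ν.prod (stdGaussian F)).map Prod.fst = ν
    rw [Measure.map_fst_prod]; simp
  | succ k ih =>
    have := isProbabilityMeasure_coupledLaw (δ := δ) (η := η) (σ := σ) (a := a) (s := s)
      (zstar := zstar) (ν := ν) hG k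
    rw [coupledLaw, Measure.map_map measurable_fst (measurable_coupledStep hG _ _ _)]
    have e : Prod.fst ∘ coupledStep G δ a s =
        (Prod.fst : Coupled F → F × F) ∘ (Prod.fst : Coupled F × F → Coupled F) := rfl
    rw [e, ← Measure.map_map measurable_fst measurable_fst, Measure.map_fst_prod]
    simpa using ih

theorem map_coupledLaw_chain (hG : Continuous G) (k : ℕ) :
    (coupledLaw G δ η σ a s zstar ν k).map (fun w => w.2.1) = preVerletLaw G δ η σ a s ν k := by
  induction k with
  | zero =>
    rw [coupledLaw, Measure.map_map (by fun_prop) (measurable_coupledInit _ _ _)]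
    rfl
  | succ k ih =>
    have := isProbabilityMeasure_coupledLaw (δ := δ) (η := η) (σ := σ) (a := a) (s := s)
      (zstar := zstar) (ν := ν) hG k
    have hV := measurable_verletField hG δ
    have hr := measurable_refreshMap (F := F) a s
    rw [coupledLaw, Measure.map_map (by fun_prop) (measurable_coupledStep hG _ _ _),
      preVerletLaw, ← ih, refresh, Measure.map_map hV (by fun_prop)]
    conv_rhs => rw [← Measure.map_id (μ := stdGaussian F)]
    rw [Measure.map_prod_map _ _ (hV.comp (by fun_prop)) measurable_id,
      Measure.map_map hr ((hV.comp (by fun_prop)).prodMap measurable_id)]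
    rfl

end Coupled

/-! ### Decay of the distance between the coupled chains. -/

section CoupledMoments

variable {F : Type*} [NormedAddCommGroup F] [InnerProductSpace ℝ F]

theorem IsConvexField.continuous {G : F → F} {m L : ℝ} {xstar : F}
    (hG : IsConvexField G m L xstar) (hL : 0 ≤ L) : Continuous G := by
  have : LipschitzWith ⟨L, hL⟩ G := LipschitzWith.of_dist_le_mul fun x y => by
    rw [dist_eq_norm, dist_eq_norm]; exact hG.lip x y
  exact this.continuous

theorem refreshMap_verletField (G : F → F) (δ a s : ℝ) (z : F × F) (g : F) :
    refreshMap a s (verletField G δ z, g) = drift G δ a z + (0, s • g) := by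
  simp [refreshMap, drift]

theorem twisted_add_smul (β s : ℝ) (u : F × F) (g : F) :
    twisted β (u + (0, s • g)) = twisted β u +
      2 * inner ℝ ((β * s) • ((u.1 + β • u.2) + β • u.2)) g + 2 * β ^ 2 * s ^ 2 * ‖g‖ ^ 2 := by
  have e1 : (u + (0, s • g)).1 + β • (u + (0, s • g)).2 = (u.1 + β • u.2) + (β * s) • g := by
    simp only [Prod.fst_add, Prod.snd_add, add_zero]; module
  have e2 : β • (u + (0, s • g)).2 = β • u.2 + (β * s) • g := by
    simp only [Prod.snd_add]; module
  unfold twisted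
  rw [e1, e2, norm_add_sq_real (u.1 + β • u.2), norm_add_sq_real (β • u.2),
    norm_smul (β * s), mul_pow, Real.norm_eq_abs, sq_abs]
  simp only [inner_add_left, real_inner_smul_left, real_inner_smul_right]
  ring

theorem norm_twist_sq_le (β s : ℝ) (u : F × F) :
    ‖(β * s) • ((u.1 + β • u.2) + β • u.2)‖ ^ 2 ≤ 2 * β ^ 2 * s ^ 2 * twisted β u := by
  rw [norm_smul, mul_pow, Real.norm_eq_abs, sq_abs]
  have h := norm_add_le (u.1 + β • u.2) (β • u.2)
  have h2 : ‖(u.1 + β • u.2) + β • u.2‖ ^ 2 ≤ 2 * twisted β u := by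
    unfold twisted
    have : ‖(u.1 + β • u.2) + β • u.2‖ ^ 2 ≤ (‖u.1 + β • u.2‖ + ‖β • u.2‖) ^ 2 := by gcongr
    nlinarith [sq_nonneg (‖u.1 + β • u.2‖ - ‖β • u.2‖)]
  calc (β * s) ^ 2 * ‖(u.1 + β • u.2) + β • u.2‖ ^ 2 ≤ (β * s) ^ 2 * (2 * twisted β u) := by gcongr
    _ = _ := by ring

theorem continuous_twisted (β : ℝ) : Continuous (twisted (F := F) β) := by
  unfold twisted; fun_prop

theorem sqrt_two_twisted_le {β : ℝ} (hβ : 0 ≤ β) (z : F × F) :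
    Real.sqrt (2 * twisted β z) ≤ 1.415 * (‖z.1‖ + 2 * (β * ‖z.2‖)) := by
  rw [Real.sqrt_le_left (by positivity)]
  have h1 : ‖z.1 + β • z.2‖ ≤ ‖z.1‖ + β * ‖z.2‖ := by
    refine (norm_add_le _ _).trans (le_of_eq ?_)
    rw [norm_smul, Real.norm_of_nonneg hβ]
  have h2 : ‖β • z.2‖ = β * ‖z.2‖ := by rw [norm_smul, Real.norm_of_nonneg hβ]
  have h3 : twisted β z ≤ (‖z.1‖ + β * ‖z.2‖ + β * ‖z.2‖) ^ 2 := by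
    unfold twisted
    rw [h2]
    have : ‖z.1 + β • z.2‖ ^ 2 ≤ (‖z.1‖ + β * ‖z.2‖) ^ 2 := by gcongr
    have : 0 ≤ (‖z.1‖ + β * ‖z.2‖) * (β * ‖z.2‖) := by positivity
    nlinarith
  nlinarith [sq_nonneg (‖z.1‖ + 2 * (β * ‖z.2‖))]

/-- The invariant of the synchronous coupling after `k` transitions, `r` being the contraction
factor. -/
def SyncBound (β κ r η : ℝ) (zstar : F × F) (k : ℕ) (w : Coupled F) : Prop :=
  twisted β (w.2.1 - w.2.2.1) ≤ (r ^ 2) ^ k * twisted β (refreshMap η 0 (w.1 - zstar, 0)) ∧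
  ‖(w.2.1 - w.2.2.1).2‖ ≤ r ^ k * (η * ‖(w.1 - zstar).2‖ +
    κ * Real.sqrt (2 * twisted β (refreshMap η 0 (w.1 - zstar, 0))))

/-- Common noises cancel in the difference of the two chains, which thus evolves by the
deterministic drift alone. Positions decay by the twisted contraction and feed the velocity
recursion, whose accumulated effect is the term in `1.65 L/γ`. -/
theorem SyncBound.step {G : F → F} {m L γ δ ε β r η s : ℝ} {xstar : F}
    (hG : IsConvexField G m L xstar) (h : Regime m L γ δ ε β) (hr0 : 0 ≤ r) (hr1 : r ≤ 1)
    (hr : r ^ 2 = 1 - 1.5 * (m * β * δ)) {zstar : F × F} {k : ℕ} {w : Coupled F} (hη : 0 ≤ η)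
    (hw : SyncBound β (1.65 * (L / γ)) r η zstar k w) (g : F) :
    SyncBound β (1.65 * (L / γ)) r η zstar (k + 1) (coupledStep G δ (1 - ε) s (w, g)) := by
  obtain ⟨h1, h2⟩ := hw
  set κ := 1.65 * (L / γ) with hκ
  set T := twisted β (refreshMap η 0 (w.1 - zstar, 0)) with hT
  have hT0 : 0 ≤ T := twisted_nonneg _ _
  set V := η * ‖(w.1 - zstar).2‖ with hV
  have hV0 : 0 ≤ V := by positivity
  set X := Real.sqrt (2 * T) with hX
  have hX0 : 0 ≤ X := Real.sqrt_nonneg _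
  have hX2 : X ^ 2 = 2 * T := Real.sq_sqrt (by positivity)
  have hL := h.L_pos
  have hγ := h.γ_pos
  have hε := h.ε_pos
  have hε8 := h.ε_small
  have hδ := h.δ_pos
  have hβ := h.β_pos
  have hκ0 : 0 ≤ κ := by positivity
  have ediff : (coupledStep G δ (1 - ε) s (w, g)).2.1 - (coupledStep G δ (1 - ε) s (w, g)).2.2.1 =
      drift G δ (1 - ε) w.2.1 - drift G δ (1 - ε) w.2.2.1 := by
    simp only [coupledStep, refreshMap_verletField]
    abel
  have key := twisted_drift_sub_le hG h w.2.1 w.2.2.1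
  rw [← hr] at key
  have hstep : twisted β (drift G δ (1 - ε) w.2.1 - drift G δ (1 - ε) w.2.2.1) ≤
      (r ^ 2) ^ (k + 1) * T := by
    refine key.trans ?_
    rw [pow_succ' (r ^ 2), mul_assoc]
    gcongr
  have hx : ∀ (z : F × F) (j : ℕ), twisted β z ≤ (r ^ 2) ^ j * T → ‖z.1‖ ≤ r ^ j * X := by
    intro z j hz
    have := norm_fst_sq_le_twisted β z
    refine le_of_sq_le_sq ?_ (by positivity)
    rw [mul_pow, hX2, ← pow_mul, mul_comm j 2, pow_mul]
    nlinarith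
  have hx0 := hx _ _ h1
  have hx1 := hx _ _ hstep
  refine ⟨by rw [ediff]; exact hstep, ?_⟩
  rw [ediff]
  refine (norm_snd_drift_sub_le hG h w.2.1 w.2.2.1).trans ?_
  have hrk : r ^ (k + 1) ≤ r ^ k := pow_le_pow_of_le_one hr0 hr1 (Nat.le_succ k)
  have hrk0 : 0 ≤ r ^ k := by positivity
  have hμ : m * β * δ ≤ 0.26 * ε := by
    have h3 := h.mβ_le.trans h.Lβ_le
    rw [h.δ_eq]
    nlinarith
  -- Here `0.39 = 1.5·0.26` and `r ≥ r²`. Below, `0.61 ≥ 1/1.65`. As `0.39 + 0.61 = 1`, the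
  -- recursion `(1-ε)(κ + δL) ≤ rκ` holds.
  have hrε : 1 - 0.39 * ε ≤ r := by nlinarith
  have hκδ : (1 - ε) * (δ * L) ≤ κ * (0.61 * ε) := by
    have h3 : (1 - ε) * δ = ε * (β - δ) := by rw [h.δ_eq]; ring
    have h4 : (β - δ) ≤ 1 / γ := by rw [le_div_iff₀ hγ]; exact h.β_sub_le
    calc (1 - ε) * (δ * L) = ε * (β - δ) * L := by rw [← h3]; ring
      _ ≤ ε * (1 / γ) * L := by gcongr
      _ ≤ κ * (0.61 * ε) := by
        rw [hκ]
        have : 0 ≤ ε * (L / γ) := by positivity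
        calc ε * (1 / γ) * L = ε * (L / γ) := by ring
          _ ≤ _ := by linarith
  calc (1 - ε) * (‖(w.2.1 - w.2.2.1).2‖ + δ / 2 * (L * (‖(w.2.1 - w.2.2.1).1‖ +
        ‖(drift G δ (1 - ε) w.2.1 - drift G δ (1 - ε) w.2.2.1).1‖)))
      ≤ (1 - ε) * (r ^ k * (V + κ * X) + δ / 2 * (L * (r ^ k * X + r ^ k * X))) := by
        have : 0 ≤ 1 - ε := by linarith
        gcongr
        exact hx1.trans (by gcongr)
    _ = r ^ k * ((1 - ε) * V + ((1 - ε) * κ + (1 - ε) * (δ * L)) * X) := by ring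
    _ ≤ r ^ k * (r * V + (r * κ) * X) := by
        gcongr
        · linarith
        · nlinarith
    _ = r ^ (k + 1) * (V + κ * X) := by ring

theorem sync_constant_le {t : ℝ} (ht0 : 0 < t) :
    (1.415 + 1.1674 * t) ^ 2 + (2.1768 + 1.4264 * t⁻¹) ^ 2 ≤
      (Real.sqrt 3 * max t t⁻¹ + 3) ^ 2 := by
  obtain ⟨c, hc⟩ : ∃ c, c = Real.sqrt 3 := ⟨_, rfl⟩
  have hc2 : c ^ 2 = 3 := by rw [hc]; exact Real.sq_sqrt (by norm_num)
  have hc1 : 1.73 ≤ c := by rw [hc]; exact Real.le_sqrt_of_sq_le (by norm_num)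
  rw [← hc]
  have h7 : ∀ M : ℝ, (c * M + 3) ^ 2 = 3 * M ^ 2 + 6 * (c * M) + 9 := fun M => by
    rw [add_sq, mul_pow, hc2]; ring
  rcases le_total 1 t with h1t | h1t
  · have hti : t⁻¹ ≤ 1 := inv_le_one_of_one_le₀ h1t
    rw [max_eq_left (hti.trans h1t), h7]
    have h5 : (2.1768 + 1.4264 * t⁻¹) ^ 2 ≤ (2.1768 + 1.4264 * 1) ^ 2 := by gcongr
    have h6 : 1.73 * t ≤ c * t := by gcongr
    have h8 : 1 * t ≤ t * t := by gcongr
    linarith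
  · have hti : 1 ≤ t⁻¹ := (one_le_inv₀ ht0).2 h1t
    rw [max_eq_right (h1t.trans hti), h7]
    have h5 : (1.415 + 1.1674 * t) ^ 2 ≤ (1.415 + 1.1674 * 1) ^ 2 := by gcongr
    have h6 : 1.73 * t⁻¹ ≤ c * t⁻¹ := by gcongr
    have h8 : 1 * t⁻¹ ≤ t⁻¹ * t⁻¹ := by gcongr
    linarith

/-- Here `t = √L`, and `A`, `B` are the initial distances in position and velocity. The coefficients
come from `0.825·1.415 ≤ 1.1674` and `1 + 0.825·1.4264 ≤ 2.1768`. Cauchy–Schwarz then leaves the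
numerical inequality `sync_constant_le`, which is what fixes the constant `K₁ + 3`. -/
theorem sync_numeric {t A B X : ℝ} (ht0 : 0 < t) (hA0 : 0 ≤ A) (hB0 : 0 ≤ B)
    (hXle : X ≤ 1.415 * A + 1.4264 * (B / t)) :
    X + (B + 0.825 * t * X) ≤ (Real.sqrt 3 * max t t⁻¹ + 3) * Real.sqrt (A ^ 2 + B ^ 2) := by
  have h3 : X + (B + 0.825 * t * X) ≤
      (1.415 + 1.1674 * t) * A + (2.1768 + 1.4264 * t⁻¹) * B := by
    have h4 : t * X ≤ t * (1.415 * A + 1.4264 * (B / t)) := by gcongr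
    have h5 : t * (1.415 * A + 1.4264 * (B / t)) = 1.415 * (t * A) + 1.4264 * B := by
      field_simp
    have h6 : B / t = t⁻¹ * B := by ring
    rw [h5] at h4
    rw [h6] at hXle
    have := mul_nonneg ht0.le hA0
    linarith
  refine h3.trans ?_
  have hcs : (1.415 + 1.1674 * t) * A + (2.1768 + 1.4264 * t⁻¹) * B ≤
      Real.sqrt ((1.415 + 1.1674 * t) ^ 2 + (2.1768 + 1.4264 * t⁻¹) ^ 2) *
        Real.sqrt (A ^ 2 + B ^ 2) := by
    rw [← Real.sqrt_mul (by positivity)]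
    apply Real.le_sqrt_of_sq_le
    linarith [sq_nonneg ((1.415 + 1.1674 * t) * B - (2.1768 + 1.4264 * t⁻¹) * A)]
  refine hcs.trans ?_
  gcongr
  rw [Real.sqrt_le_left (by positivity)]
  exact sync_constant_le ht0

/-- Numerical form of the synchronous coupling bound. -/
theorem SyncBound.phaseNorm_le {m L γ δ ε β r η : ℝ} (h : Regime m L γ δ ε β) (hr0 : 0 ≤ r)
    (hη : 0 ≤ η) (hη1 : η ≤ 1) {zstar : F × F} {k : ℕ} {w : Coupled F}
    (hw : SyncBound β (1.65 * (L / γ)) r η zstar k w) :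
    phaseNorm (w.2.1 - w.2.2.1) ≤ (K1 L + 3) * r ^ k * phaseNorm (w.1 - zstar) := by
  obtain ⟨h1, h2⟩ := hw
  set z := refreshMap η 0 (w.1 - zstar, 0) with hz
  have hz1 : z.1 = (w.1 - zstar).1 := rfl
  have hz2 : ‖z.2‖ ≤ ‖(w.1 - zstar).2‖ := by
    have : z.2 = η • (w.1 - zstar).2 := by rw [hz]; simp [refreshMap]
    rw [this, norm_smul, Real.norm_of_nonneg hη]
    exact mul_le_of_le_one_left (norm_nonneg _) hη1
  have hT0 : 0 ≤ twisted β z := twisted_nonneg _ _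
  set X := Real.sqrt (2 * twisted β z) with hX
  have hX0 : 0 ≤ X := Real.sqrt_nonneg _
  have hX2 : X ^ 2 = 2 * twisted β z := Real.sq_sqrt (by positivity)
  obtain ⟨A, hA⟩ : ∃ A, A = ‖(w.1 - zstar).1‖ := ⟨_, rfl⟩
  obtain ⟨B, hB⟩ : ∃ B, B = ‖(w.1 - zstar).2‖ := ⟨_, rfl⟩
  have hA0 : 0 ≤ A := hA ▸ norm_nonneg _
  have hB0 : 0 ≤ B := hB ▸ norm_nonneg _
  have hL := h.L_pos
  have hγ := h.γ_pos
  have hβ := h.β_pos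
  obtain ⟨t, ht⟩ : ∃ t, t = Real.sqrt L := ⟨_, rfl⟩
  have ht0 : 0 < t := ht ▸ Real.sqrt_pos.2 hL
  have htL : t ^ 2 = L := by rw [ht]; exact Real.sq_sqrt hL.le
  have h2t : 2 * t ≤ γ := by
    have := h.L_le
    refine le_of_sq_le_sq ?_ hγ.le
    nlinarith
  have hβt : 2 * (β * B) ≤ 1.008 * (B / t) := by
    have h3 : 2 * t * β ≤ 1.008 := by
      have := h.β_le
      nlinarith
    rw [mul_div_assoc', le_div_iff₀ ht0]
    nlinarith
  have hLγ : L / γ ≤ t / 2 := by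
    rw [div_le_iff₀ hγ]
    nlinarith
  have hXle : X ≤ 1.415 * A + 1.4264 * (B / t) := by
    have h3 := sqrt_two_twisted_le hβ.le z
    rw [hz1, ← hA, ← hX] at h3
    have h4 : β * ‖z.2‖ ≤ β * B := by rw [hB]; gcongr
    have h5 : 0 ≤ B / t := by positivity
    linarith
  have hx : ‖(w.2.1 - w.2.2.1).1‖ ≤ r ^ k * X := by
    have := norm_fst_sq_le_twisted β (w.2.1 - w.2.2.1)
    refine le_of_sq_le_sq ?_ (by positivity)
    rw [mul_pow, hX2, ← pow_mul, mul_comm k 2, pow_mul]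
    nlinarith
  have hrk0 : 0 ≤ r ^ k := by positivity
  have hv : ‖(w.2.1 - w.2.2.1).2‖ ≤ r ^ k * (B + 0.825 * t * X) := by
    refine h2.trans ?_
    rw [← hB]
    refine mul_le_mul_of_nonneg_left (add_le_add ?_ ?_) hrk0
    · exact mul_le_of_le_one_left hB0 hη1
    · have : 1.65 * (L / γ) ≤ 0.825 * t := by linarith
      exact mul_le_mul_of_nonneg_right this hX0
  have hP : phaseNorm (w.1 - zstar) = Real.sqrt (A ^ 2 + B ^ 2) := by rw [hA, hB]; rfl
  have hmain : X + (B + 0.825 * t * X) ≤ (K1 L + 3) * Real.sqrt (A ^ 2 + B ^ 2) := by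
    rw [K1, ← ht]
    exact sync_numeric ht0 hA0 hB0 hXle
  calc phaseNorm (w.2.1 - w.2.2.1) ≤ ‖(w.2.1 - w.2.2.1).1‖ + ‖(w.2.1 - w.2.2.1).2‖ :=
        OBABO.phaseNorm_le _
    _ ≤ r ^ k * X + r ^ k * (B + 0.825 * t * X) := add_le_add hx hv
    _ = r ^ k * (X + (B + 0.825 * t * X)) := by ring
    _ ≤ r ^ k * ((K1 L + 3) * Real.sqrt (A ^ 2 + B ^ 2)) := by gcongr
    _ = _ := by rw [hP]; ring

end CoupledMoments

/-! ### Moments of the chain started at the equilibrium point. -/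

section CoupledMean

variable {F : Type*} [NormedAddCommGroup F] [InnerProductSpace ℝ F] [FiniteDimensional ℝ F]
  [MeasurableSpace F] [BorelSpace F]
  {G : F → F} {m L γ δ ε β η σ s : ℝ} {xstar : F} {ν : Measure (F × F)} [IsProbabilityMeasure ν]

theorem ae_syncBound {r : ℝ} (hG : IsConvexField G m L xstar) (h : Regime m L γ δ ε β)
    (hr0 : 0 ≤ r) (hr1 : r ≤ 1) (hr : r ^ 2 = 1 - 1.5 * (m * β * δ)) (hη : 0 ≤ η) (k : ℕ) :
    ∀ᵐ w ∂(coupledLaw G δ η σ (1 - ε) s (xstar, 0) ν k),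
      SyncBound β (1.65 * (L / γ)) r η (xstar, 0) k w := by
  have hcG := hG.continuous h.L_pos.le
  have hLγ : 0 ≤ L / γ := div_nonneg h.L_pos.le h.γ_pos.le
  have hmeas : ∀ k, MeasurableSet
      {w : Coupled F | SyncBound β (1.65 * (L / γ)) r η (xstar, 0) k w} := by
    intro k
    have h1 := (continuous_twisted (F := F) β).measurable
    have h2 := measurable_refreshMap (F := F) η 0
    have h3 : MeasurableSet {w : Coupled F | twisted β (w.2.1 - w.2.2.1) ≤
        (r ^ 2) ^ k * twisted β (refreshMap η 0 (w.1 - (xstar, 0), 0))} :=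
      measurableSet_le (by fun_prop) (by fun_prop)
    have h4 : MeasurableSet {w : Coupled F | ‖(w.2.1 - w.2.2.1).2‖ ≤
        r ^ k * (η * ‖(w.1 - (xstar, 0)).2‖ + 1.65 * (L / γ) *
          Real.sqrt (2 * twisted β (refreshMap η 0 (w.1 - (xstar, 0), 0))))} :=
      measurableSet_le (by fun_prop) (by fun_prop)
    exact h3.inter h4
  induction k with
  | zero =>
    rw [coupledLaw, ae_map_iff (measurable_coupledInit _ _ _).aemeasurable (hmeas 0)]
    refine Filter.Eventually.of_forall fun w => ?_
    have e : (coupledInit η σ (xstar, 0) w).2.1 - (coupledInit η σ (xstar, 0) w).2.2.1 =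
        refreshMap η 0 (w.1 - (xstar, 0), 0) := by
      simp [coupledInit, refreshMap]
    refine ⟨?_, ?_⟩
    · rw [e, pow_zero, one_mul]; exact le_rfl
    · rw [e, pow_zero, one_mul]
      have e2 : (refreshMap η 0 (w.1 - (xstar, 0), 0)).2 = η • (w.1 - (xstar, 0)).2 := by
        simp [refreshMap]
      rw [e2, norm_smul, Real.norm_of_nonneg hη]
      have : 0 ≤ 1.65 * (L / γ) * Real.sqrt (2 * twisted β (refreshMap η 0 (w.1 - (xstar, 0), 0))) :=
        by positivity
      exact le_add_of_nonneg_right this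
  | succ k ih =>
    have := isProbabilityMeasure_coupledLaw (δ := δ) (η := η) (σ := σ) (a := 1 - ε) (s := s)
      (zstar := (xstar, 0)) (ν := ν) hcG k
    rw [coupledLaw, ae_map_iff (measurable_coupledStep hcG _ _ _).aemeasurable (hmeas (k + 1))]
    filter_upwards [Measure.quasiMeasurePreserving_fst.ae ih] with w hw
    exact hw.step hG h hr0 hr1 hr hη w.2

/-- The value `8/m` is dictated by the condition `3A ≤ (1-ρ)B`: the noise gives `A = 2β²s² ≤ 4β²ε`,
and the contraction gives `1 - ρ = 1.5 mβδ = 1.5 mβ²ε`. -/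
theorem lintegral_exp_twisted_le (hG : IsConvexField G m L xstar) (h : Regime m L γ δ ε β)
    (hs : s ^ 2 = 1 - (1 - ε) ^ 2) (hσ : σ ^ 2 = ε) (k : ℕ) :
    ∀ l, 0 ≤ l → l * (8 / m) ≤ 1 →
      ∫⁻ w, ENNReal.ofReal (Real.exp (l * twisted β (w.2.2.1 - (xstar, 0))))
        ∂(coupledLaw G δ η σ (1 - ε) s (xstar, 0) ν k) ≤
      ENNReal.ofReal (Real.exp (l * (8 / m) * Module.finrank ℝ F)) := by
  have hcG := hG.continuous h.L_pos.le
  have hm := h.m_pos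
  have hβ := h.β_pos
  have hε := h.ε_pos
  have hε8 := h.ε_small
  have hδ := h.δ_pos
  have hct := (continuous_twisted (F := F) β).measurable
  have hμ : m * β * δ ≤ 0.26 * ε := by
    have h3 := h.mβ_le.trans h.Lβ_le
    rw [h.δ_eq]
    nlinarith
  have hq : Measurable fun w : Coupled F => twisted β (w.2.2.1 - (xstar, 0)) := by fun_prop
  have h8 : ∀ x : ℝ, m * x * (8 / m) = 8 * x := fun x => by field_simp
  induction k with
  | zero =>
    refine lintegral_exp_step_le ν (measurable_coupledInit _ _ _) (q := fun _ => 0) (b := fun _ => 0)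
      (ℓ := fun _ => 0) (A := 2 * β ^ 2 * σ ^ 2) (ρ := 0) hq (by positivity) (by positivity) le_rfl
      ?_ ?_ (by simp) (by simp) ?_
    · rw [hσ, sub_zero, one_mul, le_div_iff₀ hm]
      have := h.mβ_le.trans h.Lβ_le
      nlinarith
    · intro z g
      have e : (coupledInit η σ (xstar, 0) (z, g)).2.2.1 - (xstar, 0) = 0 + (0, σ • g) := by
        simp [coupledInit, refreshMap]
      rw [e, twisted_add_smul]
      simp [twisted]
    · intro l hl _
      simp only [mul_zero, Real.exp_zero, ENNReal.ofReal_one, lintegral_const, measure_univ, mul_one]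
      rw [← ENNReal.ofReal_one]
      exact ENNReal.ofReal_le_ofReal (Real.one_le_exp (by positivity))
  | succ k ih =>
    have := isProbabilityMeasure_coupledLaw (δ := δ) (η := η) (σ := σ) (a := 1 - ε) (s := s)
      (zstar := (xstar, 0)) (ν := ν) hcG k
    refine lintegral_exp_step_le _ (measurable_coupledStep hcG _ _ _)
      (b := fun w => twisted β (drift G δ (1 - ε) w.2.2.1 - drift G δ (1 - ε) (xstar, 0)))
      (ℓ := fun w => (β * s) • (((drift G δ (1 - ε) w.2.2.1 - drift G δ (1 - ε) (xstar, 0)).1 +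
        β • (drift G δ (1 - ε) w.2.2.1 - drift G δ (1 - ε) (xstar, 0)).2) +
        β • (drift G δ (1 - ε) w.2.2.1 - drift G δ (1 - ε) (xstar, 0)).2))
      (A := 2 * β ^ 2 * s ^ 2) (ρ := 1 - 1.5 * (m * β * δ)) hq (by positivity) (by positivity)
      ?_ ?_ ?_ ?_ ?_ ih
    · linarith
    · have e : (1 - (1 - 1.5 * (m * β * δ))) * (8 / m) = 12 * (β * δ) := by
        linear_combination 1.5 * h8 (β * δ)
      rw [e, h.δ_eq, hs]
      have : 0 ≤ β ^ 2 * ε ^ 2 := by positivity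
      linarith
    · intro w g
      have e : (coupledStep G δ (1 - ε) s (w, g)).2.2.1 - (xstar, 0) =
          (drift G δ (1 - ε) w.2.2.1 - drift G δ (1 - ε) (xstar, 0)) + (0, s • g) := by
        simp only [coupledStep, refreshMap_verletField]
        rw [drift_fixed hG]
        abel
      simp only [e]
      rw [twisted_add_smul]
    · intro w
      exact norm_twist_sq_le _ _ _
    · intro w
      exact twisted_drift_sub_le hG h _ _

/-- The accumulated noise is autoregressive: with `ρ = (1-ε)²` and `A = s² = 1 - ρ`, the condition
`3A ≤ (1-ρ)B` is an equality for `B = 3`. -/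
theorem lintegral_exp_noise_le (hcG : Continuous G) (hε1 : ε ≤ 1)
    (hs : s ^ 2 = 1 - (1 - ε) ^ 2) (hσ : σ ^ 2 = ε) {zstar : F × F} (k : ℕ) :
    ∀ l, 0 ≤ l → l * 3 ≤ 1 →
      ∫⁻ w, ENNReal.ofReal (Real.exp (l * ‖w.2.2.2‖ ^ 2))
        ∂(coupledLaw G δ η σ (1 - ε) s zstar ν k) ≤
      ENNReal.ofReal (Real.exp (l * 3 * Module.finrank ℝ F)) := by
  have hq : Measurable fun w : Coupled F => ‖w.2.2.2‖ ^ 2 := by fun_prop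
  have hnn : ∀ g : F, ‖s • g‖ ^ 2 = s ^ 2 * ‖g‖ ^ 2 := fun g => by
    rw [norm_smul, mul_pow, Real.norm_eq_abs, sq_abs]
  induction k with
  | zero =>
    refine lintegral_exp_step_le ν (measurable_coupledInit _ _ _) (q := fun _ => 0) (b := fun _ => 0)
      (ℓ := fun _ => 0) (A := σ ^ 2) (ρ := 0) hq (by positivity) (by positivity) le_rfl
      ?_ ?_ (by simp) (by simp) ?_
    · rw [hσ]; linarith
    · intro z g
      simp only [coupledInit]
      rw [norm_smul, mul_pow, Real.norm_eq_abs, sq_abs]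
      simp
    · intro l hl _
      simp only [mul_zero, Real.exp_zero, ENNReal.ofReal_one, lintegral_const, measure_univ, mul_one]
      rw [← ENNReal.ofReal_one]
      exact ENNReal.ofReal_le_ofReal (Real.one_le_exp (by positivity))
  | succ k ih =>
    have := isProbabilityMeasure_coupledLaw (δ := δ) (η := η) (σ := σ) (a := 1 - ε) (s := s)
      (zstar := zstar) (ν := ν) hcG k
    refine lintegral_exp_step_le _ (measurable_coupledStep hcG _ _ _)
      (b := fun w => (1 - ε) ^ 2 * ‖w.2.2.2‖ ^ 2)
      (ℓ := fun w => (s * (1 - ε)) • w.2.2.2)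
      (A := s ^ 2) (ρ := (1 - ε) ^ 2) hq (by positivity) (by norm_num) (by positivity)
      ?_ ?_ ?_ (fun w => le_rfl) ih
    · rw [hs]; linarith
    · intro w g
      simp only [coupledStep]
      rw [norm_add_sq_real, hnn, norm_smul, mul_pow, Real.norm_eq_abs, sq_abs]
      simp only [real_inner_smul_left, real_inner_smul_right]
      exact le_of_eq (by ring)
    · intro w
      rw [norm_smul, mul_pow, Real.norm_eq_abs, sq_abs]
      exact le_of_eq (by ring)

theorem rpow_eq_sq_rpow_half {x : ℝ} (hx : 0 ≤ x) (p : ℝ) : x ^ p = (x ^ 2) ^ (p / 2) := by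
  rw [← Real.rpow_natCast, ← Real.rpow_mul hx]
  congr 1
  push_cast; ring

theorem meanLE_rpow_of_exp {S : Type*} [MeasurableSpace S] {μ : Measure S} {f q : S → ℝ}
    {B C N p : ℝ} (hf : ∀ s, 0 ≤ f s) (hq : ∀ s, 0 ≤ q s) (hB : 0 < B) (hC : 0 ≤ C) (hN : 1 ≤ N)
    (hp : 2 ≤ p) (hfq : ∀ s, f s ^ 2 ≤ C * q s)
    (hμ : ∀ l, 0 ≤ l → l * B ≤ 1 → ∫⁻ s, ENNReal.ofReal (Real.exp (l * q s)) ∂μ ≤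
      ENNReal.ofReal (Real.exp (l * B * N))) :
    MeanLE μ (fun s => f s ^ p) ((Real.sqrt (C * B) * Real.sqrt (N + p - 2)) ^ p) := by
  have hD : 0 < N + p - 2 := by linarith
  have h1 : MeanLE μ (fun s => q s ^ (p / 2)) ((B * (N + 2 * (p / 2) - 2)) ^ (p / 2)) :=
    lintegral_rpow_le_of_exp μ hq hB hN (by linarith) hμ
  rw [mul_div_cancel₀ p two_ne_zero] at h1
  refine ((h1.const_mul (a := C ^ (p / 2)) (by positivity)).mono fun s => ?_).trans_le
    (le_of_eq ?_)
  · rw [← Real.mul_rpow hC (hq s), rpow_eq_sq_rpow_half (hf s)]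
    exact Real.rpow_le_rpow (by positivity) (hfq s) (by linarith)
  · rw [← Real.mul_rpow hC (by positivity),
      rpow_eq_sq_rpow_half (x := Real.sqrt (C * B) * Real.sqrt (N + p - 2)) (by positivity),
      mul_pow, Real.sq_sqrt (by positivity), Real.sq_sqrt hD.le, mul_assoc]

theorem meanLE_equilibrium_position {p : ℝ} (hp : 2 ≤ p) (hF : 1 ≤ Module.finrank ℝ F)
    (hG : IsConvexField G m L xstar) (h : Regime m L γ δ ε β)
    (hs : s ^ 2 = 1 - (1 - ε) ^ 2) (hσ : σ ^ 2 = ε) (k : ℕ) :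
    MeanLE (coupledLaw G δ η σ (1 - ε) s (xstar, 0) ν k)
      (fun w => ‖(w.2.2.1 - (xstar, 0)).1‖ ^ p)
      ((4 / Real.sqrt m * Real.sqrt (Module.finrank ℝ F + p - 2)) ^ p) := by
  have hm := h.m_pos
  have e : Real.sqrt (2 * (8 / m)) = 4 / Real.sqrt m := by
    rw [show 2 * (8 / m) = 4 ^ 2 / m by ring, Real.sqrt_div (by norm_num),
      Real.sqrt_sq (by norm_num)]
  have h1 := meanLE_rpow_of_exp (f := fun w : Coupled F => ‖(w.2.2.1 - (xstar, 0)).1‖)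
    (q := fun w : Coupled F => twisted β (w.2.2.1 - (xstar, 0))) (C := 2) (p := p)
    (fun w => norm_nonneg _) (fun w => twisted_nonneg _ _) (by positivity) (by norm_num)
    (by exact_mod_cast hF) hp (fun w => norm_fst_sq_le_twisted _ _)
    (lintegral_exp_twisted_le (η := η) (ν := ν) hG h hs hσ k)
  rwa [e] at h1

theorem meanLE_noise {p : ℝ} (hp : 2 ≤ p) (hF : 1 ≤ Module.finrank ℝ F)
    (hcG : Continuous G) (hε1 : ε ≤ 1)
    (hs : s ^ 2 = 1 - (1 - ε) ^ 2) (hσ : σ ^ 2 = ε) {zstar : F × F} (k : ℕ) :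
    MeanLE (coupledLaw G δ η σ (1 - ε) s zstar ν k) (fun w => ‖w.2.2.2‖ ^ p)
      ((Real.sqrt 3 * Real.sqrt (Module.finrank ℝ F + p - 2)) ^ p) := by
  have h1 := meanLE_rpow_of_exp (f := fun w : Coupled F => ‖w.2.2.2‖)
    (q := fun w : Coupled F => ‖w.2.2.2‖ ^ 2) (C := 1) (p := p)
    (fun w => norm_nonneg _) (fun w => by positivity) (by norm_num) (by norm_num)
    (by exact_mod_cast hF) hp (fun w => by rw [one_mul])
    (lintegral_exp_noise_le (δ := δ) (η := η) (ν := ν) (zstar := zstar) hcG hε1 hs hσ k)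
  rwa [one_mul] at h1

theorem rpow_convex_combination_le {r x y ε κ p : ℝ} (hr : 0 ≤ r) (hx : 0 ≤ x) (hy : 0 ≤ y)
    (hε : 0 ≤ ε) (hε1 : ε ≤ 1) (hκ : 0 ≤ κ) (hp : 1 ≤ p) :
    ((1 - ε) * r + ε * (κ * ((x + y) / 2))) ^ p ≤
      (1 - ε) * r ^ p + (ε / 2 * κ ^ p * x ^ p + ε / 2 * κ ^ p * y ^ p) := by
  have h1 := (convexOn_rpow hp).2 (x := r) (y := κ * ((x + y) / 2)) (Set.mem_Ici.2 hr)
    (Set.mem_Ici.2 (by positivity)) (sub_nonneg.2 hε1) hε (by ring)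
  have h2 := (convexOn_rpow hp).2 (x := x) (y := y) (Set.mem_Ici.2 hx)
    (Set.mem_Ici.2 hy) (show (0 : ℝ) ≤ 1 / 2 by norm_num) (show (0 : ℝ) ≤ 1 / 2 by norm_num)
    (by norm_num)
  simp only [smul_eq_mul] at h1 h2
  have e : (κ * ((x + y) / 2)) ^ p = κ ^ p * (1 / 2 * x + 1 / 2 * y) ^ p := by
    rw [← Real.mul_rpow hκ (by positivity)]; congr 1; ring
  rw [e] at h1
  have hκp : 0 ≤ ε * κ ^ p := by positivity
  have h3 := mul_le_mul_of_nonneg_left h2 hκp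
  linarith

/-- Subtracting the accumulated noise leaves `(1-ε)(v - n)` plus a force term with prefactor `(1-ε)δ
= ε(β-δ)`. Each step is thus bounded by a convex combination with weight `ε` on `L(β-δ)` times the
mean distance of two successive positions to `x⋆`. As `L(β-δ) ≤ L/γ`, the `p`-th moment bound
propagates in time without growing. -/
theorem meanLE_equilibrium_velocity_sub_noise {p X : ℝ} (hp : 1 ≤ p) (hX : 0 ≤ X)
    (hG : IsConvexField G m L xstar) (h : Regime m L γ δ ε β)
    (hpos : ∀ k, MeanLE (coupledLaw G δ η σ (1 - ε) s (xstar, 0) ν k)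
      (fun w => ‖(w.2.2.1 - (xstar, 0)).1‖ ^ p) (X ^ p)) (k : ℕ) :
    MeanLE (coupledLaw G δ η σ (1 - ε) s (xstar, 0) ν k)
      (fun w => ‖w.2.2.1.2 - w.2.2.2‖ ^ p) ((L / γ * X) ^ p) := by
  have hcG := hG.continuous h.L_pos.le
  have hL := h.L_pos
  have hγ := h.γ_pos
  have hε := h.ε_pos
  have hε8 := h.ε_small
  have hp0 : 0 < p := by linarith
  induction k with
  | zero =>
    have hm : Measurable fun w : Coupled F => ‖w.2.2.1.2 - w.2.2.2‖ ^ p := by fun_prop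
    rw [coupledLaw, meanLE_map_iff (measurable_coupledInit _ _ _) hm]
    have h0 : MeanLE (ν.prod (stdGaussian F)) (fun _ => (0 : ℝ)) 0 := meanLE_const 0
    refine (h0.mono fun w => ?_).trans_le (by positivity)
    simp [coupledInit, refreshMap, Real.zero_rpow hp0.ne']
  | succ k ih =>
    have := isProbabilityMeasure_coupledLaw (δ := δ) (η := η) (σ := σ) (a := 1 - ε) (s := s)
      (zstar := (xstar, 0)) (ν := ν) hcG k
    have hm : Measurable fun w : Coupled F => ‖w.2.2.1.2 - w.2.2.2‖ ^ p := by fun_prop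
    have hmx : Measurable fun w : Coupled F => ‖(w.2.2.1 - (xstar, 0)).1‖ ^ p := by fun_prop
    have hst := measurable_coupledStep hcG δ (1 - ε) s
    set κ := L * (β - δ) with hκ
    have hβδ : 0 ≤ β - δ := by
      rw [h.δ_eq]
      have := h.β_pos
      nlinarith
    have hκ0 : 0 ≤ κ := by positivity
    have hκle : κ ≤ L / γ := by
      rw [hκ, le_div_iff₀ hγ, mul_assoc]
      exact mul_le_of_le_one_right hL.le h.β_sub_le
    have hx1 := hpos (k + 1)
    rw [coupledLaw, meanLE_map_iff hst hmx] at hx1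
    rw [coupledLaw, meanLE_map_iff hst hm]
    have hκp : 0 ≤ ε / 2 * κ ^ p := by positivity
    have hs1 := (ih.comp_fst (ν := stdGaussian F) hm).const_mul (sub_nonneg.2 (by linarith : ε ≤ 1))
    have hs2 := ((hpos k).comp_fst (ν := stdGaussian F) hmx).const_mul hκp
    have hs3 := hx1.const_mul hκp
    have hLX : 0 ≤ (L / γ * X) ^ p := by positivity
    have h1ε : 0 ≤ 1 - ε := by linarith
    have hsum := hs1.add (hs2.add hs3 (by fun_prop) (by positivity) (by positivity)) (by fun_prop)
      (by positivity) (by positivity)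
    refine (hsum.mono fun w => ?_).trans_le ?_
    · refine le_trans ?_ (rpow_convex_combination_le (norm_nonneg _) (norm_nonneg _) (norm_nonneg _)
        hε.le (by linarith) hκ0 hp)
      refine Real.rpow_le_rpow (norm_nonneg _) ?_ hp0.le
      obtain ⟨⟨z, w, w', n⟩, g⟩ := w
      simp only [coupledStep, refreshMap_verletField]
      have ex : (drift G δ (1 - ε) w' + (0, s • g) - (xstar, 0)).1 =
          (drift G δ (1 - ε) w' - drift G δ (1 - ε) (xstar, 0)).1 := by
        rw [drift_fixed hG]; simp
      rw [ex]
      have hGx : ∀ x, ‖G x‖ ≤ L * ‖x - xstar‖ := fun x => by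
        have := hG.lip x xstar
        rwa [hG.zero, sub_zero] at this
      have ex' : (drift G δ (1 - ε) w' - drift G δ (1 - ε) (xstar, 0)).1 =
          (verletField G δ w').1 - xstar := by rw [drift_fixed hG]; rfl
      have ev : (drift G δ (1 - ε) w' + (0, s • g)).2 - ((1 - ε) • n + s • g) =
          (1 - ε) • (w'.2 - n) - ((1 - ε) * (δ / 2)) • (G w'.1 + G (verletField G δ w').1) := by
        simp only [drift, verletField, Prod.snd_add]
        module
      rw [ev, ex']
      refine (norm_sub_le _ _).trans ?_
      have hδ := h.δ_pos
      rw [norm_smul, norm_smul, Real.norm_of_nonneg h1ε, Real.norm_of_nonneg (by positivity)]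
      have e3 : (1 - ε) * (δ / 2) = ε * (β - δ) / 2 := by rw [h.δ_eq]; ring
      have h4 : ‖G w'.1 + G (verletField G δ w').1‖ ≤
          L * ‖w'.1 - xstar‖ + L * ‖(verletField G δ w').1 - xstar‖ :=
        (norm_add_le _ _).trans (add_le_add (hGx _) (hGx _))
      rw [e3]
      have h5 : 0 ≤ ε * (β - δ) / 2 := by positivity
      have h6 := mul_le_mul_of_nonneg_left h4 h5
      rw [hκ]
      simp only [Prod.fst_sub]
      linarith
    · have hκX : κ ^ p * X ^ p ≤ (L / γ * X) ^ p := by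
        rw [← Real.mul_rpow hκ0 hX]
        exact Real.rpow_le_rpow (by positivity) (by gcongr) hp0.le
      have := mul_le_mul_of_nonneg_left hκX hε.le
      linarith

/-- The constant bounding the moments of the chain started at the equilibrium point. -/
def equilibriumConst (m L γ : ℝ) : ℝ := Real.sqrt 3 + (1 + L / γ) * (4 / Real.sqrt m)

/-- Minkowski with three pieces: position, velocity minus noise, noise. Treating the noise apart
avoids the loss of a factor `1/β ≈ γ` in reading the velocity off the twisted norm. -/
theorem meanLE_equilibrium {p : ℝ} (hp : 2 ≤ p) (hF : 1 ≤ Module.finrank ℝ F)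
    (hG : IsConvexField G m L xstar) (h : Regime m L γ δ ε β)
    (hs : s ^ 2 = 1 - (1 - ε) ^ 2) (hσ : σ ^ 2 = ε) (k : ℕ) :
    MeanLE (coupledLaw G δ η σ (1 - ε) s (xstar, 0) ν k)
      (fun w => phaseNorm (w.2.2.1 - (xstar, 0)) ^ p)
      ((equilibriumConst m L γ * Real.sqrt (Module.finrank ℝ F + p - 2)) ^ p) := by
  have hm := h.m_pos
  have hL := h.L_pos
  have hγ := h.γ_pos
  have hF' : (1 : ℝ) ≤ Module.finrank ℝ F := by exact_mod_cast hF
  have hD : 0 < (Module.finrank ℝ F : ℝ) + p - 2 := by linarith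
  have hsD := Real.sqrt_pos.2 hD
  have hsm := Real.sqrt_pos.2 hm
  have h1 := fun k => meanLE_equilibrium_position (η := η) (ν := ν) hp hF hG h hs hσ k
  have h2 := meanLE_equilibrium_velocity_sub_noise (by linarith) (by positivity) hG h h1 k
  have h3 := meanLE_noise (δ := δ) (η := η) (ν := ν) (zstar := (xstar, 0)) hp hF
    (hG.continuous hL.le) (by linarith [h.ε_small]) hs hσ k
  have h12 := MeanLE.rpow_add (by linarith) (by fun_prop) (fun w => norm_nonneg _)
    (fun w => norm_nonneg _) (by positivity) (by positivity) (h1 k) h2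
  have h123 := MeanLE.rpow_add (by linarith) (by fun_prop)
    (fun w => add_nonneg (norm_nonneg _) (norm_nonneg _))
    (fun w => norm_nonneg _) (by positivity) (by positivity) h12 h3
  refine (h123.mono fun w => ?_).trans_le (le_of_eq ?_)
  · refine Real.rpow_le_rpow (phaseNorm_nonneg _) ?_ (by linarith)
    refine (phaseNorm_le _).trans ?_
    have : ‖(w.2.2.1 - (xstar, 0)).2‖ ≤ ‖w.2.2.1.2 - w.2.2.2‖ + ‖w.2.2.2‖ := by
      have := norm_add_le (w.2.2.1.2 - w.2.2.2) w.2.2.2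
      simpa using this
    linarith
  · congr 1
    rw [equilibriumConst]
    ring

end CoupledMean

/-! ### Moments of the unadjusted chain from a general initial law. -/

section ChainMoments

variable {F : Type*} [NormedAddCommGroup F] [InnerProductSpace ℝ F] [FiniteDimensional ℝ F]
  [MeasurableSpace F] [BorelSpace F]
  {G : F → F} {m L γ δ ε β η σ s : ℝ} {xstar : F} {ν : Measure (F × F)} [IsProbabilityMeasure ν]

/-- The contraction rate, in squared distance, of one transition of the unadjusted chain. -/
def rate (m β δ : ℝ) : ℝ := 1 - 1.5 * (m * β * δ)

theorem Regime.mβδ_le (h : Regime m L γ δ ε β) : m * β * δ ≤ 0.003 := by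
  have h3 := h.mβ_le.trans h.Lβ_le
  have h4 := h.ε_small
  have h5 := h.ε_pos
  rw [h.δ_eq]
  nlinarith

theorem Regime.rate_pos (h : Regime m L γ δ ε β) : 0 < rate m β δ := by
  rw [rate]
  linarith [h.mβδ_le]

theorem Regime.rate_lt_one (h : Regime m L γ δ ε β) : rate m β δ < 1 := by
  have := mul_pos (mul_pos h.m_pos h.β_pos) h.δ_pos
  rw [rate]; linarith

theorem isProbabilityMeasure_preVerletLaw (hG : Continuous G) {a : ℝ} (k : ℕ) :
    IsProbabilityMeasure (preVerletLaw G δ η σ a s ν k) := by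
  have := isProbabilityMeasure_coupledLaw (δ := δ) (η := η) (σ := σ) (a := a) (s := s)
    (zstar := 0) (ν := ν) hG k
  rw [← map_coupledLaw_chain (zstar := 0) hG k]
  exact Measure.isProbabilityMeasure_map (by fun_prop)

/-- In the hypothesis on `f`, `a` stands for the decaying distance between the coupled copies and
`b` for the size of the copy started at equilibrium. Separate exponents let a quadratic `f` use the
equilibrium moment of order 2 while only the initial moment of order `p` is known. -/
theorem meanLE_preVerletLaw {p p' M c₀ c₁ c₂ : ℝ} (hp : 2 ≤ p) (hp' : 2 ≤ p')
    (hF : 1 ≤ Module.finrank ℝ F) (hG : IsConvexField G m L xstar) (h : Regime m L γ δ ε β)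
    (hs : s ^ 2 = 1 - (1 - ε) ^ 2) (hσ : σ ^ 2 = ε) (hη : 0 ≤ η) (hη1 : η ≤ 1)
    (hM0 : 0 ≤ M) (hM : MeanLE ν (fun z => phaseNorm (z - (xstar, 0)) ^ p) M)
    {f : F × F → ℝ} (hf : Measurable f) (hc₀ : 0 ≤ c₀) (hc₁ : 0 ≤ c₁) (hc₂ : 0 ≤ c₂)
    (hfle : ∀ w a b, 0 ≤ a → 0 ≤ b → phaseNorm (w - (xstar, 0)) ≤ a + b →
      f w ≤ c₀ + c₁ * a ^ p + c₂ * b ^ p') (k : ℕ) :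
    MeanLE (preVerletLaw G δ η σ (1 - ε) s ν k) f
      (c₀ + c₁ * ((K1 L + 3) ^ p * rate m β δ ^ k * M) +
        c₂ * (equilibriumConst m L γ * Real.sqrt (Module.finrank ℝ F + p' - 2)) ^ p') := by
  have hcG := hG.continuous h.L_pos.le
  have := isProbabilityMeasure_coupledLaw (δ := δ) (η := η) (σ := σ) (a := 1 - ε) (s := s)
    (zstar := (xstar, 0)) (ν := ν) hcG k
  have hm := h.m_pos
  have hL := h.L_pos
  have hγ := h.γ_pos
  have hq := h.rate_pos
  have hq1 := h.rate_lt_one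
  have hK : 0 ≤ K1 L := by unfold K1; positivity
  have hN : 0 ≤ equilibriumConst m L γ := by unfold equilibriumConst; positivity
  set r := Real.sqrt (rate m β δ) with hr
  have hr0 : 0 ≤ r := Real.sqrt_nonneg _
  have hr2 : r ^ 2 = rate m β δ := Real.sq_sqrt hq.le
  have hr1 : r ≤ 1 := by rw [hr, Real.sqrt_le_left one_pos.le]; linarith
  have hcP := (continuous_phaseNorm (F := F)).measurable
  rw [← map_coupledLaw_chain (zstar := (xstar, 0)) hcG k,
    meanLE_map_iff (by fun_prop) hf]
  have hM' : MeanLE (coupledLaw G δ η σ (1 - ε) s (xstar, 0) ν k)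
      (fun w => phaseNorm (w.1 - (xstar, 0)) ^ p) M := by
    have := map_coupledLaw_fst (δ := δ) (η := η) (σ := σ) (a := 1 - ε) (s := s)
      (zstar := (xstar, 0)) (ν := ν) hcG k
    rw [← this, meanLE_map_iff measurable_fst (by fun_prop)] at hM
    exact hM
  have hE := meanLE_equilibrium (η := η) (ν := ν) hp' hF hG h hs hσ k
  have hc1' : 0 ≤ c₁ * ((K1 L + 3) ^ p * rate m β δ ^ k) := by positivity
  have hsum := ((meanLE_const (μ := coupledLaw G δ η σ (1 - ε) s (xstar, 0) ν k) c₀).add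
    (hM'.const_mul hc1') measurable_const hc₀ (by positivity)).add (hE.const_mul hc₂)
    (by fun_prop) (by positivity) (by positivity)
  refine (hsum.mono_ae ?_).trans_le (le_of_eq (by ring))
  filter_upwards [ae_syncBound (σ := σ) (s := s) (ν := ν) hG h hr0 hr1 hr2 hη k] with w hw
  have h1 := hw.phaseNorm_le h hr0 hη hη1
  have h2 : phaseNorm (w.2.1 - (xstar, 0)) ≤ (K1 L + 3) * r ^ k * phaseNorm (w.1 - (xstar, 0)) +
      phaseNorm (w.2.2.1 - (xstar, 0)) := by
    have := phaseNorm_add_le (w.2.1 - w.2.2.1) (w.2.2.1 - (xstar, 0))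
    rw [sub_add_sub_cancel] at this
    linarith
  have hP := phaseNorm_nonneg (w.1 - (xstar, 0))
  refine (hfle _ _ _ (by positivity) (phaseNorm_nonneg _) h2).trans ?_
  have h3 : ((K1 L + 3) * r ^ k * phaseNorm (w.1 - (xstar, 0))) ^ p ≤
      (K1 L + 3) ^ p * rate m β δ ^ k * phaseNorm (w.1 - (xstar, 0)) ^ p := by
    rw [Real.mul_rpow (by positivity) hP, Real.mul_rpow (by positivity) (by positivity)]
    gcongr
    -- As `r ≤ 1` and `p ≥ 2`, `r^{kp} ≤ r^{2k}`, the `k`-th power of the rate.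
    rw [← hr2, ← pow_mul, mul_comm 2 k, pow_mul, ← Real.rpow_natCast _ 2]
    exact Real.rpow_le_rpow_of_exponent_ge' (by positivity) (pow_le_one₀ hr0 hr1) (by norm_num)
      (by exact_mod_cast hp)
  have h4 := mul_le_mul_of_nonneg_left h3 hc₁
  linarith

/-- The geometric series is at most `1/(1.5 mβδ)`. Since `βγ ≥ 1`, multiplying by `δ` gives at most
`γ/(1.5 m)`, which is `2/9` of `1/κ = 3γ/m`. -/
theorem delta_mul_sum_rate_le (h : Regime m L γ δ ε β) (n : ℕ) :
    δ * ∑ k ∈ Finset.range n, rate m β δ ^ k ≤ 2 / 9 * (1 / kappa m γ) := by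
  have hm := h.m_pos
  have hγ := h.γ_pos
  have hβ := h.β_pos
  have hδ := h.δ_pos
  have h1 : (1 - rate m β δ) * ∑ k ∈ Finset.range n, rate m β δ ^ k ≤ 1 := by
    rw [mul_comm, geom_sum_mul_neg]
    linarith [pow_pos h.rate_pos n]
  have e : 1 - rate m β δ = 1.5 * (m * β) * δ := by rw [rate]; ring
  rw [e, mul_assoc] at h1
  have h2 : δ * ∑ k ∈ Finset.range n, rate m β δ ^ k ≤ 1 / (1.5 * (m * β)) := by
    rw [le_div_iff₀ (by positivity)]; linarith
  refine h2.trans ?_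
  rw [kappa, one_div_div, div_le_iff₀ (by positivity)]
  have e2 : 2 / 9 * (3 * γ / m) * (1.5 * (m * β)) = β * γ := by field_simp; norm_num
  rw [e2]
  exact h.one_le

end ChainMoments

/-- Regrouping `(OVO)^k O` as `O (V O²)^k`: the energy error is needed just before each Verlet move,
and the merged refreshment `O²` has damping `η² = 1 - ε`, the one for which the contraction is
proved. -/
theorem bind_kernelO_lawAt {d : ℕ} {U : E d → ℝ} {δ γ : ℝ} (hG : Continuous (gradient U))
    (h1 : eta δ γ ≤ 1) (ν : Measure (E d × E d)) [IsProbabilityMeasure ν] (k : ℕ) :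
    (lawAt (kernelP U δ γ) ν k).bind (kernelO δ γ) =
      preVerletLaw (gradient U) δ (eta δ γ) (Real.sqrt (1 - eta δ γ ^ 2)) (eta δ γ ^ 2)
        (Real.sqrt (1 - (eta δ γ ^ 2) ^ 2)) ν k := by
  have := isMarkovKernel_kernelP (δ := δ) (γ := γ) hG
  have := isMarkovKernel_kernelO (d := d) (δ := δ) (γ := γ)
  have h0 : 0 ≤ eta δ γ := (Real.exp_pos _).le
  have hη : eta δ γ ^ 2 ≤ 1 := pow_le_one₀ h0 h1
  have hη2 : (eta δ γ ^ 2) ^ 2 ≤ 1 := pow_le_one₀ (by positivity) hη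
  induction k with
  | zero => exact bind_kernelO ν
  | succ k ih =>
    have := isProbabilityMeasure_lawAt (kernelP U δ γ) ν k
    have hV := measurable_verlet (δ := δ) hG
    rw [lawAt_succ, bind_kernelP hG, ih, preVerletLaw]
    have := isProbabilityMeasure_preVerletLaw (ν := ν) (δ := δ) (η := eta δ γ)
      (σ := Real.sqrt (1 - eta δ γ ^ 2)) (a := eta δ γ ^ 2)
      (s := Real.sqrt (1 - (eta δ γ ^ 2) ^ 2)) hG k
    have := Measure.isProbabilityMeasure_map (f := verlet U δ)
      (μ := preVerletLaw (gradient U) δ (eta δ γ) (Real.sqrt (1 - eta δ γ ^ 2)) (eta δ γ ^ 2)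
        (Real.sqrt (1 - (eta δ γ ^ 2) ^ 2)) ν k) hV.aemeasurable
    rw [bind_kernelO, bind_kernelO, refresh_refresh]
    · rfl
    · rw [mul_pow, Real.sq_sqrt (by linarith), Real.sq_sqrt (by linarith)]
      ring

theorem integral_le_of_meanLE {S : Type*} [MeasurableSpace S] {μ : Measure S} {f g : S → ℝ}
    {C : ℝ} (hC : 0 ≤ C) (hg0 : ∀ s, 0 ≤ g s) (hgf : ∀ s, g s ≤ f s) (hf : MeanLE μ f C) :
    ∫ s, g s ∂μ ≤ C := by
  by_cases hg : AEStronglyMeasurable g μ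
  · rw [integral_eq_lintegral_of_nonneg_ae (Filter.Eventually.of_forall hg0) hg]
    exact ENNReal.toReal_le_of_le_ofReal hC (hf.mono hgf)
  · rw [integral_undef fun hi => hg hi.aestronglyMeasurable]
    exact hC

/-- The total variation error of the unadjusted chain is controlled by the mean energy errors. -/
theorem tvDist_lawAt_le_of_meanLE {d : ℕ} {U : E d → ℝ} {δ γ : ℝ} (hU : Continuous U)
    (hG : Continuous (gradient U)) (h1 : eta δ γ ≤ 1) (ν : Measure (E d × E d))
    [IsProbabilityMeasure ν] {C : ℕ → ℝ} (hC0 : ∀ k, 0 ≤ C k)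
    (hC : ∀ k, MeanLE (preVerletLaw (gradient U) δ (eta δ γ) (Real.sqrt (1 - eta δ γ ^ 2))
      (eta δ γ ^ 2) (Real.sqrt (1 - (eta δ γ ^ 2) ^ 2)) ν k)
      (fun z => 2 * |ham U (verlet U δ z) - ham U z|) (C k)) (n : ℕ) :
    tvDist (lawAt (kernelM U δ γ) ν n) (lawAt (kernelP U δ γ) ν n) ≤
      ∑ k ∈ Finset.range n, C k := by
  refine (tvDist_lawAt_le hU hG ν n).trans (Finset.sum_le_sum fun k _ => ?_)
  rw [bind_kernelO_lawAt hG h1, ← integral_const_mul]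
  refine integral_le_of_meanLE (hC0 k) (fun z => ?_) (fun z => ?_) (hC k)
  · have := accept_le_one (U := U) (δ := δ) z
    linarith
  · have := one_sub_accept_le (U := U) (δ := δ) z
    linarith

/-! ### Comparison of the equilibrium constant with `K₁` and the moment factor. -/

section Constants

variable {m L γ δ ε β : ℝ}

theorem K1_ge (hL : 0 < L) : 1.73 ≤ K1 L ∧ 1.73 * Real.sqrt L ≤ K1 L := by
  have h3 : (1.73 : ℝ) ≤ Real.sqrt 3 := Real.le_sqrt_of_sq_le (by norm_num)
  have ht := Real.sqrt_pos.2 hL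
  rw [K1]
  have h1 : (1 : ℝ) ≤ max (Real.sqrt L) (Real.sqrt L)⁻¹ := by
    rcases le_total 1 (Real.sqrt L) with h | h
    · exact h.trans (le_max_left _ _)
    · exact ((one_le_inv₀ ht).2 h).trans (le_max_right _ _)
  have h2 := le_max_left (Real.sqrt L) (Real.sqrt L)⁻¹
  constructor
  · calc (1.73 : ℝ) = 1.73 * 1 := by ring
      _ ≤ _ := by gcongr
  · gcongr

theorem momentFactor_ge (h : Regime m L γ δ ε β) :
    1 + 1 / Real.sqrt m ≤ momentFactor L m γ δ := by
  have := h.m_pos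
  have := h.δ_pos
  have := h.γ_pos
  have hL := h.L_pos
  have := K1_ge hL
  have h1 : 0 ≤ K1 L := by linarith [this.1]
  rw [momentFactor]
  have : 0 ≤ 2 * δ * K1 L * K3 L m δ / kappa m γ := by
    unfold K3 kappa; positivity
  linarith

theorem two_mul_sqrt_le (h : Regime m L γ δ ε β) : 2 * Real.sqrt L ≤ γ := by
  have h1 := h.L_le
  have hs := Real.sq_sqrt h.L_pos.le
  refine le_of_sq_le_sq ?_ h.γ_pos.le
  nlinarith

theorem equilibriumConst_le_aux (h : Regime m L γ δ ε β) :
    equilibriumConst m L γ ≤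
      1.7321 + 4 * (1 / Real.sqrt m) + 2 * Real.sqrt L * (1 / Real.sqrt m) := by
  have hm := Real.sqrt_pos.2 h.m_pos
  have h3 : Real.sqrt 3 ≤ 1.7321 := by rw [Real.sqrt_le_left (by norm_num)]; norm_num
  have hLγ : L / γ ≤ Real.sqrt L / 2 := by
    rw [div_le_iff₀ h.γ_pos]
    have := two_mul_sqrt_le h
    have hs := Real.mul_self_sqrt h.L_pos.le
    nlinarith [Real.sqrt_nonneg L]
  have h4 : L / γ * (1 / Real.sqrt m) ≤ Real.sqrt L / 2 * (1 / Real.sqrt m) := by gcongr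
  have e : equilibriumConst m L γ =
      Real.sqrt 3 + 4 * (1 / Real.sqrt m) + 4 * (L / γ * (1 / Real.sqrt m)) := by
    rw [equilibriumConst]; ring
  rw [e]; linarith

theorem equilibriumConst_nonneg (h : Regime m L γ δ ε β) : 0 ≤ equilibriumConst m L γ := by
  have := h.m_pos
  have := h.L_pos
  have := h.γ_pos
  unfold equilibriumConst; positivity

/-- The factor `4/3` matches the `4/√m` on the left with the `3/√m` in `(K₁ + 3)(1 + 1/√m)`. The
other terms have room to spare. -/
theorem equilibriumConst_le (h : Regime m L γ δ ε β) :
    equilibriumConst m L γ ≤ 4 / 3 * ((K1 L + 3) * momentFactor L m γ δ) := by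
  obtain ⟨hK1, hK2⟩ := K1_ge h.L_pos
  have hA := momentFactor_ge h
  have hN := equilibriumConst_le_aux h
  have hm := Real.sqrt_pos.2 h.m_pos
  have hw : 0 < 1 / Real.sqrt m := by positivity
  have h1 : (K1 L + 3) * (1 + 1 / Real.sqrt m) ≤ (K1 L + 3) * momentFactor L m γ δ := by gcongr
  have h2 : 1.73 * Real.sqrt L * (1 / Real.sqrt m) ≤ K1 L * (1 / Real.sqrt m) := by gcongr
  have h3 : 0 ≤ Real.sqrt L * (1 / Real.sqrt m) := by positivity
  linarith

theorem equilibriumConst_sq_le (h : Regime m L γ δ ε β) :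
    9 / 7 * equilibriumConst m L γ ^ 2 ≤
      ((K1 L + 3) * momentFactor L m γ δ) ^ 2 * (1 + 1 / kappa m γ) := by
  obtain ⟨hK1, hK2⟩ := K1_ge h.L_pos
  have hA := momentFactor_ge h
  have hN0 := equilibriumConst_nonneg h
  have hm := h.m_pos
  have hγ := h.γ_pos
  obtain ⟨w, hw⟩ : ∃ w, w = 1 / Real.sqrt m := ⟨_, rfl⟩
  obtain ⟨t, ht⟩ : ∃ t, t = Real.sqrt L := ⟨_, rfl⟩
  have hsm := Real.sqrt_pos.2 hm
  have hw0 : 0 < w := by rw [hw]; positivity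
  have ht0 : 0 < t := ht ▸ Real.sqrt_pos.2 h.L_pos
  have hw2 : w ^ 2 = 1 / m := by rw [hw, div_pow, Real.sq_sqrt hm.le, one_pow]
  have hκ : 6 * (t * w ^ 2) ≤ 1 / kappa m γ := by
    have h2 := two_mul_sqrt_le h
    rw [kappa, one_div_div, hw2, ht,
      show 6 * (Real.sqrt L * (1 / m)) = 3 * (2 * Real.sqrt L) / m by ring]
    gcongr
  set Y := (K1 L + 3) * momentFactor L m γ δ with hY
  have hYle : (K1 L + 3) * (1 + w) ≤ Y := by rw [hw, hY]; gcongr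
  have hY0 : 0 < Y := lt_of_lt_of_le (by positivity) hYle
  have hκ0 : 0 ≤ t * w ^ 2 := by positivity
  -- If `1/κ ≥ 9/7`, the crude factor `4/3` suffices, as `(9/7)(16/9) = 16/7 = 1 + 9/7`. Otherwise
  -- `tw ≥ 1` forces `w ≤ 0.2143`. The equilibrium constant is then small enough to gain a factor
  -- `1.1339 ≥ √(9/7)` without the help of `1/κ`.
  by_cases hc : 9 / 7 ≤ 6 * (t * w ^ 2)
  · have h1 : equilibriumConst m L γ ^ 2 ≤ (4 / 3 * Y) ^ 2 := by
      have := equilibriumConst_le h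
      gcongr
    have h2 : Y ^ 2 * (16 / 7) ≤ Y ^ 2 * (1 + 1 / kappa m γ) := by gcongr; linarith
    linarith
  · push Not at hc
    have htw : 1 ≤ t * w := by
      rw [ht, hw, mul_one_div, one_le_div hsm]
      exact Real.sqrt_le_sqrt h.m_le
    have hw1 : w ≤ 0.2143 := by nlinarith
    have hN := equilibriumConst_le_aux h
    rw [← hw, ← ht] at hN
    rw [← ht] at hK2
    have h1 : 1.1339 * equilibriumConst m L γ ≤ Y := by
      refine le_trans ?_ hYle
      have h2 : 1.73 * t * w ≤ K1 L * w := by gcongr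
      have h3 : t * w ≤ t * 0.2143 := by gcongr
      linarith
    have h2 : (1.1339 * equilibriumConst m L γ) ^ 2 ≤ Y ^ 2 := by gcongr
    have h3 : Y ^ 2 * 1 ≤ Y ^ 2 * (1 + 1 / kappa m γ) := by gcongr; linarith
    have h4 := sq_nonneg (equilibriumConst m L γ)
    nlinarith

end Constants

/-! ### Summed energy errors: Lipschitz gradient. -/

section EnergySums

variable {F : Type*} [NormedAddCommGroup F] [InnerProductSpace ℝ F] [FiniteDimensional ℝ F]
  [MeasurableSpace F] [BorelSpace F]
  {G : F → F} {m L γ δ ε β η σ s : ℝ} {xstar : F} {ν : Measure (F × F)} [IsProbabilityMeasure ν]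

/-- The quadratic part of the energy error of a Verlet step, up to the factor `2 δ² L`. -/
def quadraticErr (L δ : ℝ) : ℝ :=
  δ * L / 8 + (1 + δ / 4 + δ ^ 2 * L / 4) * (1 + δ ^ 2 * (L ^ 2 / 4))

theorem energy_sum_quadratic {M : ℝ} {f : F × F → ℝ} (hF : 1 ≤ Module.finrank ℝ F)
    (hG : IsConvexField G m L xstar) (h : Regime m L γ δ ε β)
    (hs : s ^ 2 = 1 - (1 - ε) ^ 2) (hσ : σ ^ 2 = ε) (hη : 0 ≤ η) (hη1 : η ≤ 1)
    (hM0 : 0 ≤ M) (hM : MeanLE ν (fun z => phaseNorm (z - (xstar, 0)) ^ (2 : ℝ)) M)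
    (hf : Measurable f)
    (hfle : ∀ w, f w ≤ δ ^ 2 * (2 * L * quadraticErr L δ) * phaseNorm (w - (xstar, 0)) ^ 2) :
    ∃ C : ℕ → ℝ, (∀ k, 0 ≤ C k ∧ MeanLE (preVerletLaw G δ η σ (1 - ε) s ν k) f (C k)) ∧
      ∀ n, ∑ k ∈ Finset.range n, C k ≤
        δ * K9 L m γ δ * (M + δ * n * Module.finrank ℝ F) := by
  have hL := h.L_pos
  have hδ := h.δ_pos
  have hγ := h.γ_pos
  have hm := h.m_pos
  have hq := h.rate_pos
  have hb0 : 0 ≤ quadraticErr L δ := by unfold quadraticErr; positivity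
  obtain ⟨b, hb⟩ : ∃ b, b = 2 * L * quadraticErr L δ := ⟨_, rfl⟩
  have hb0 : 0 ≤ b := by rw [hb]; positivity
  obtain ⟨N, hN⟩ : ∃ N, N = equilibriumConst m L γ := ⟨_, rfl⟩
  obtain ⟨D, hD⟩ : ∃ D : ℝ, D = Module.finrank ℝ F := ⟨_, rfl⟩
  have hD0 : 0 ≤ D := by rw [hD]; positivity
  obtain ⟨K, hK⟩ : ∃ K, K = K1 L + 3 := ⟨_, rfl⟩
  obtain ⟨A, hA⟩ : ∃ A, A = momentFactor L m γ δ := ⟨_, rfl⟩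
  have hA1 : 1 ≤ A := by
    have := momentFactor_ge h
    have h2 : 0 ≤ 1 / Real.sqrt m := by positivity
    rw [hA]; linarith
  obtain ⟨c, hc⟩ : ∃ c, c = 1 / kappa m γ := ⟨_, rfl⟩
  have hc0 : 0 ≤ c := by rw [hc, kappa]; positivity
  have hN2 : 9 / 7 * N ^ 2 ≤ (K * A) ^ 2 * (1 + c) := by
    rw [hN, hK, hA, hc]; exact equilibriumConst_sq_le h
  have key := fun k => meanLE_preVerletLaw (p := 2) (p' := 2) (c₀ := 0)
    (c₁ := δ ^ 2 * b * (9 / 2)) (c₂ := δ ^ 2 * b * (9 / 7)) le_rfl le_rfl hF hG h hs hσ hη hη1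
    hM0 hM hf le_rfl (by positivity) (by positivity) (fun w a b' ha hb' hab => by
      refine (hfle w).trans ?_
      rw [← hb]
      have h1 : phaseNorm (w - (xstar, 0)) ^ 2 ≤ (a + b') ^ 2 := by
        have := phaseNorm_nonneg (w - (xstar, 0)); gcongr
      -- The weights satisfy `2/9 + 7/9 = 1`. The factor `9/2` cancels the `2/9` of the summed rate,
      -- and `9/7` is the one allowed by `equilibriumConst_sq_le`.
      have h2 : (a + b') ^ 2 ≤ 9 / 2 * a ^ 2 + 9 / 7 * b' ^ 2 := by
        nlinarith [sq_nonneg (7 * a - 2 * b')]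
      have h3 := mul_le_mul_of_nonneg_left (h1.trans h2) (mul_nonneg (sq_nonneg δ) hb0)
      rw [Real.rpow_two, Real.rpow_two]
      linarith) k
  refine ⟨_, fun k => ⟨?_, key k⟩, fun n => ?_⟩
  · have := (K1_ge hL).1
    have := equilibriumConst_nonneg h
    positivity
  · simp only [← hN, ← hD, ← hK, Real.rpow_two, add_sub_cancel_right, zero_add]
    rw [mul_pow, Real.sq_sqrt hD0, Finset.sum_add_distrib, Finset.sum_const, Finset.card_range,
      nsmul_eq_mul]
    have e1 : ∑ k ∈ Finset.range n, δ ^ 2 * b * (9 / 2) * (K ^ 2 * rate m β δ ^ k * M) =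
        δ * b * (9 / 2) * K ^ 2 * M * (δ * ∑ k ∈ Finset.range n, rate m β δ ^ k) := by
      rw [Finset.mul_sum, Finset.mul_sum]
      exact Finset.sum_congr rfl fun k _ => by ring
    have h1 := delta_mul_sum_rate_le h n
    rw [← hc] at h1
    have e9 : K9 L m γ δ = b * ((K * A) ^ 2 * (1 + c)) := by
      rw [hb, hK, hA, hc, K9, quadraticErr]; ring
    rw [e1, e9]
    have h2 : δ * b * (9 / 2) * K ^ 2 * M * (δ * ∑ k ∈ Finset.range n, rate m β δ ^ k) ≤
        δ * b * (9 / 2) * K ^ 2 * M * (2 / 9 * c) := by gcongr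
    have hK0 : 0 ≤ K := by linarith [(K1_ge hL).1]
    have h3 : (δ * b * M) * (K ^ 2 * c) ≤ (δ * b * M) * ((K * A) ^ 2 * (1 + c)) := by
      gcongr
      · exact le_mul_of_one_le_right hK0 hA1
      · linarith
    have h4 : (n * δ ^ 2 * b * D) * (9 / 7 * N ^ 2) ≤
        (n * δ ^ 2 * b * D) * ((K * A) ^ 2 * (1 + c)) := by gcongr
    linarith

end EnergySums

/-! ### Summed energy errors: polynomially Lipschitz Hessian. -/

section EnergySumsPol

variable {F : Type*} [NormedAddCommGroup F] [InnerProductSpace ℝ F] [FiniteDimensional ℝ F]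
  [MeasurableSpace F] [BorelSpace F]
  {G : F → F} {m L γ δ ε β η σ s : ℝ} {xstar : F} {ν : Measure (F × F)} [IsProbabilityMeasure ν]

/-- The quadratic part of the energy error of a Verlet step under a Hessian condition, up to the
factor `δ³`. -/
def gradientErr (L δ : ℝ) : ℝ := L ^ 2 / 4 * (1 + δ * L + δ * (1 + δ ^ 2 * L ^ 2 / 4))

/-- The trapezoidal part of the energy error of a Verlet step under a Hessian condition, up to the
factor `δ³`. -/
def trapezoidErr (L δ ℓ Lℓ : ℝ) : ℝ :=
  Lℓ / 12 * ((1 + L * δ / 2) ^ 3 * (1 + δ + δ ^ 2 * L / 2) ^ (ℓ - 2))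

/-- The algebra behind `K₁₀`, to be read with `S = 2^{p/2}`, `x = (K₁ + 3)` times the moment factor,
`J = x^p`, `c = 1/κ`, `t = δn`, `N` the equilibrium constant, `X₁`, `X₂` the gradient and
trapezoidal coefficients, and `Y₁`, `Y₂` the two terms of the last bracket of `K₁₀`. With `p = ℓ +
1`, `2^ℓ = S²/2`. -/
theorem energy_coefficients_le {X₁ X₂ Y₁ Y₂ S J x c M t d E N Np Kp : ℝ} (hX₁ : X₁ ≤ 2 * Y₁)
    (hY₁ : 0 ≤ Y₁) (hX₂ : 0 ≤ X₂) (hSX : 3 * S * X₂ = Y₂) (hS : 8 / 3 ≤ S) (hS2 : 8 ≤ S ^ 2)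
    (hx : 4.73 ≤ x) (hJ : x ^ 3 ≤ J) (hc : 0 ≤ c) (hM : 0 ≤ M) (ht : 0 ≤ t) (hE : 1 ≤ E)
    (hdE : d ≤ E) (hd : 0 ≤ d) (hN : 9 * N ^ 2 ≤ 16 * x ^ 2) (hNp : Np ≤ S * J)
    (hKp : Kp ≤ J) (hKp0 : 0 ≤ Kp) :
    (2 * X₁ + S ^ 2 * X₂) * (Kp * M * (2 / 9 * c)) +
      t * (2 * X₁ * (1 + N ^ 2 * d) + X₂ * (1 + S ^ 2 * (Np * E))) ≤
    (1 + S ^ 2 / 2 * J * (c + 1)) * (Y₁ + Y₂) * (M + t * E) := by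
  have hx3 : 0 < x ^ 3 := by positivity
  have hJ0 : 0 < J := by linarith
  have hS0 : 0 < S := by linarith
  have hY₂ : 0 ≤ Y₂ := by rw [← hSX]; positivity
  have hSX' : S ^ 2 * X₂ = S * Y₂ / 3 := by rw [← hSX]; ring
  have hX₂Y : X₂ ≤ Y₂ := by rw [← hSX]; nlinarith
  have hScale : S ≤ S ^ 2 := by nlinarith
  have h1 : (2 * X₁ + S ^ 2 * X₂) * (Kp * M * (2 / 9 * c)) ≤
      S ^ 2 / 2 * J * c * (Y₁ + Y₂) * M := by
    have h2 : 2 * X₁ + S ^ 2 * X₂ ≤ S ^ 2 * (Y₁ + Y₂) := by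
      rw [hSX']
      nlinarith [mul_le_mul_of_nonneg_right hS2 hY₁, mul_le_mul_of_nonneg_right hScale hY₂,
        mul_nonneg hS0.le hY₂]
    calc (2 * X₁ + S ^ 2 * X₂) * (Kp * M * (2 / 9 * c))
        ≤ S ^ 2 * (Y₁ + Y₂) * (J * M * (2 / 9 * c)) := by gcongr
      _ ≤ S ^ 2 * (Y₁ + Y₂) * (J * M * (1 / 2 * c)) := by
        have : 0 ≤ S ^ 2 * (Y₁ + Y₂) * (J * M * c) := by positivity
        linarith
      _ = _ := by ring
  have h2 : 2 * X₁ * (1 + N ^ 2 * d) ≤ (1 + S ^ 2 / 2 * J) * Y₁ * E := by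
    have e1 : N ^ 2 * d ≤ 16 / 9 * x ^ 2 * E := by gcongr; linarith
    have e2 : 4 + 64 / 9 * x ^ 2 ≤ S ^ 2 / 2 * J := by
      have e3 : 4 * x ^ 3 ≤ S ^ 2 / 2 * J := by gcongr; linarith
      have e4 : 4.73 * x ^ 2 ≤ x ^ 3 := by rw [pow_succ' x 2]; gcongr
      have e5 : (4.73 : ℝ) ^ 2 ≤ x ^ 2 := by gcongr
      linarith
    have e6 : 4 * (1 + N ^ 2 * d) ≤ (1 + S ^ 2 / 2 * J) * E := by
      have := mul_le_mul_of_nonneg_right e2 (zero_le_one.trans hE)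
      linarith
    have e7 : 0 ≤ N ^ 2 * d := by positivity
    calc 2 * X₁ * (1 + N ^ 2 * d) ≤ 2 * (2 * Y₁) * (1 + N ^ 2 * d) := by gcongr
      _ = Y₁ * (4 * (1 + N ^ 2 * d)) := by ring
      _ ≤ Y₁ * ((1 + S ^ 2 / 2 * J) * E) := by gcongr
      _ = _ := by ring
  have h3 : X₂ * (1 + S ^ 2 * (Np * E)) ≤ (1 + S ^ 2 / 2 * J) * Y₂ * E := by
    have e1 : X₂ * (S ^ 2 * (Np * E)) ≤ X₂ * (S ^ 2 * (S * J * E)) := by gcongr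
    have e2 : X₂ * (S ^ 2 * (S * J * E)) = S ^ 2 / 3 * J * Y₂ * E := by rw [← hSX]; ring
    have e3 : 0 ≤ S ^ 2 * J * Y₂ * E := by positivity
    have e4 : Y₂ * 1 ≤ Y₂ * E := by gcongr
    linarith
  have h4 := mul_le_mul_of_nonneg_left (add_le_add h2 h3) ht
  have h5 : 0 ≤ (1 + S ^ 2 / 2 * J) * (Y₁ + Y₂) * M := by positivity
  have h6 : 0 ≤ S ^ 2 / 2 * J * c * (Y₁ + Y₂) * (t * E) := by positivity
  linarith

theorem gradientErr_le (h : Regime m L γ δ ε β) :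
    gradientErr L δ ≤ 2 * ((L + 2 * L ^ 2) / 4 * (1 + δ ^ 2 * (L ^ 2 / 4))) := by
  have hL := h.L_pos
  have hδ := h.δ_pos
  have hγ := h.γ_pos
  have h4 : δ * γ ≤ 0.01 := by
    have h5 : 33 * (δ * γ) * γ ^ 2 ≤ 1 / 4 * γ ^ 2 := by
      have := h.δ_le
      have := h.m_le
      have := h.L_le
      linarith
    have := le_of_mul_le_mul_right h5 (by positivity)
    linarith
  have hδL : δ * L ≤ 2 + 2 * L := by
    have h2 := h.L_le
    rcases le_total γ 1 with hγ1 | hγ1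
    · have : δ * (4 * L) ≤ δ * γ ^ 2 := by gcongr
      have : δ * γ * γ ≤ 0.01 * 1 := by gcongr
      linarith
    · have h5 : δ * 1 ≤ δ * γ := by gcongr
      have : δ * L ≤ 2 * L := by gcongr; linarith
      linarith
  obtain ⟨B, hB⟩ : ∃ B, B = 1 + δ ^ 2 * L ^ 2 / 4 := ⟨_, rfl⟩
  have hB0 : 0 ≤ B := by rw [hB]; positivity
  have h1 : 1 + δ * L ≤ 2 * B := by rw [hB]; linarith [sq_nonneg (δ * L - 1)]
  have e : 1 + δ ^ 2 * (L ^ 2 / 4) = B := by rw [hB]; ring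
  rw [gradientErr, e, ← hB]
  have h5 : L ^ 2 * (1 + δ * L) ≤ L ^ 2 * (2 * B) := by gcongr
  have h6 : L * B * (δ * L) ≤ L * B * (2 + 2 * L) := by gcongr
  linarith

theorem sq_le_two_mul {a b p : ℝ} (ha : 0 ≤ a) (hp : 2 ≤ p) :
    (a + b) ^ 2 ≤ 2 * (1 + a ^ p + b ^ 2) := by
  have h2 : a ^ 2 ≤ 1 + a ^ p := by
    rcases le_total a 1 with h | h
    · have : a ^ 2 ≤ 1 := pow_le_one₀ ha h
      linarith [Real.rpow_nonneg ha p]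
    · rw [← Real.rpow_two]
      linarith [Real.rpow_le_rpow_of_exponent_le h hp]
  linarith [sq_nonneg (a - b)]

theorem cube_add_rpow_le {x a b p : ℝ} (hx : 0 ≤ x) (ha : 0 ≤ a) (hb : 0 ≤ b) (hxab : x ≤ a + b)
    (hp : 3 ≤ p) : x ^ 3 + x ^ p ≤ 1 + 2 ^ p * a ^ p + 2 ^ p * b ^ p := by
  have h1 : x ^ 3 ≤ 1 + x ^ p := by
    rcases le_total x 1 with h | h
    · have : x ^ 3 ≤ 1 := pow_le_one₀ hx h
      linarith [Real.rpow_nonneg hx p]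
    · rw [← Real.rpow_natCast]
      linarith [Real.rpow_le_rpow_of_exponent_le h (by exact_mod_cast hp : ((3 : ℕ) : ℝ) ≤ p)]
  have h2 : x ^ p ≤ (a + b) ^ p := Real.rpow_le_rpow hx hxab (by linarith)
  have h3 := rpow_add_le_weighted ha hb one_half_pos one_half_lt_one (by linarith : (1 : ℝ) ≤ p)
  rw [show (1 : ℝ) - 1 / 2 = 1 / 2 by norm_num, div_div_eq_mul_div, div_div_eq_mul_div, div_one,
    div_one, mul_comm a, mul_comm b, Real.mul_rpow two_pos.le ha,
    Real.mul_rpow two_pos.le hb] at h3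
  linarith

/-- The quadratic part and the part of degrees 3 and `p` are treated apart. At equilibrium the
former needs only the second moment, of order `D`, and the latter the `p`-th, of order `E`. Lower
powers of the initial distance are absorbed into `1` plus its `p`-th power. -/
theorem meanLE_energy_pol {M p X₁ X₂ D E : ℝ} {f : F × F → ℝ} (hp : 3 ≤ p) (hX₁ : 0 ≤ X₁)
    (hX₂ : 0 ≤ X₂) (hF : 1 ≤ Module.finrank ℝ F) (hD : D = Module.finrank ℝ F)
    (hE : E = (D + p - 2) ^ (p / 2))
    (hG : IsConvexField G m L xstar) (h : Regime m L γ δ ε β)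
    (hs : s ^ 2 = 1 - (1 - ε) ^ 2) (hσ : σ ^ 2 = ε) (hη : 0 ≤ η) (hη1 : η ≤ 1)
    (hM0 : 0 ≤ M) (hM : MeanLE ν (fun z => phaseNorm (z - (xstar, 0)) ^ p) M)
    (hfle : ∀ w, f w ≤ δ ^ 3 * (X₁ * phaseNorm (w - (xstar, 0)) ^ 2 +
      X₂ * (phaseNorm (w - (xstar, 0)) ^ 3 + phaseNorm (w - (xstar, 0)) ^ p))) (k : ℕ) :
    MeanLE (preVerletLaw G δ η σ (1 - ε) s ν k) f
      (δ ^ 3 * (2 * X₁ * (1 + equilibriumConst m L γ ^ 2 * D) +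
          X₂ * (1 + 2 ^ p * (equilibriumConst m L γ ^ p * E))) +
        δ ^ 3 * ((2 * X₁ + 2 ^ p * X₂) * ((K1 L + 3) ^ p * M)) * rate m β δ ^ k) := by
  have hδ := h.δ_pos
  have hq := h.rate_pos
  have hK := (K1_ge h.L_pos).1
  have hN0 := equilibriumConst_nonneg h
  have hD1 : 1 ≤ D := by rw [hD]; exact_mod_cast hF
  have hDp : 0 < D + p - 2 := by linarith
  have hcP := (continuous_phaseNorm (F := F)).measurable
  have hf₁ : Measurable fun w : F × F => δ ^ 3 * (X₁ * phaseNorm (w - (xstar, 0)) ^ 2) := by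
    fun_prop
  have hf₂ : Measurable fun w : F × F => δ ^ 3 * (X₂ * (phaseNorm (w - (xstar, 0)) ^ 3 +
    phaseNorm (w - (xstar, 0)) ^ p)) := by fun_prop
  have key₁ := meanLE_preVerletLaw (p := p) (p' := 2) (c₀ := δ ^ 3 * (2 * X₁))
    (c₁ := δ ^ 3 * (2 * X₁)) (c₂ := δ ^ 3 * (2 * X₁)) (by linarith) le_rfl hF hG h hs hσ hη hη1
    hM0 hM hf₁ (by positivity) (by positivity) (by positivity) (fun w a b ha hb hab => by
      have h1 : phaseNorm (w - (xstar, 0)) ^ 2 ≤ (a + b) ^ 2 := by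
        have := phaseNorm_nonneg (w - (xstar, 0)); gcongr
      have h3 := sq_le_two_mul (b := b) ha (by linarith : 2 ≤ p)
      have h4 := mul_le_mul_of_nonneg_left (h1.trans h3) (mul_nonneg (pow_nonneg hδ.le 3) hX₁)
      rw [Real.rpow_two]
      linarith) k
  have key₂ := meanLE_preVerletLaw (p := p) (p' := p) (c₀ := δ ^ 3 * X₂)
    (c₁ := δ ^ 3 * X₂ * 2 ^ p) (c₂ := δ ^ 3 * X₂ * 2 ^ p) (by linarith) (by linarith) hF hG h hs hσ
    hη hη1 hM0 hM hf₂ (by positivity) (by positivity) (by positivity) (fun w a b ha hb hab => by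
      have h4 := cube_add_rpow_le (phaseNorm_nonneg _) ha hb hab hp
      have h5 := mul_le_mul_of_nonneg_left h4 (mul_nonneg (pow_nonneg hδ.le 3) hX₂)
      linarith) k
  have hrD : Real.sqrt (D + p - 2) ^ p = E := by
    rw [rpow_eq_sq_rpow_half (Real.sqrt_nonneg _), Real.sq_sqrt hDp.le, hE]
  rw [← hD, Real.rpow_two (equilibriumConst m L γ * _), add_sub_cancel_right, mul_pow,
    Real.sq_sqrt (by linarith)] at key₁
  rw [← hD, Real.mul_rpow hN0 (Real.sqrt_nonneg _), hrD] at key₂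
  have hE0 : 0 ≤ E := by rw [hE]; positivity
  refine ((key₁.add key₂ hf₁ (by positivity) (by positivity)).mono fun w =>
    (hfle w).trans (le_of_eq ?_)).trans_le (le_of_eq ?_)
  · ring
  · ring

theorem energy_coefficients_pol_le {M p ℓ Lℓ D E R t : ℝ} (hℓ : 2 ≤ ℓ) (hLℓ : 0 ≤ Lℓ)
    (h : Regime m L γ δ ε β) (hp : p = ℓ + 1) (hD : 1 ≤ D) (hE : E = (D + p - 2) ^ (p / 2))
    (hM : 0 ≤ M) (hR : R ≤ 2 / 9 * (1 / kappa m γ)) (ht : 0 ≤ t) :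
    (2 * gradientErr L δ + 2 ^ p * trapezoidErr L δ ℓ Lℓ) * ((K1 L + 3) ^ p * M * R) +
      t * (2 * gradientErr L δ * (1 + equilibriumConst m L γ ^ 2 * D) +
        trapezoidErr L δ ℓ Lℓ * (1 + 2 ^ p * (equilibriumConst m L γ ^ p * E))) ≤
    K10 L m γ δ ℓ Lℓ * (M + t * E) := by
  have hL := h.L_pos
  have hδ := h.δ_pos
  have hγ := h.γ_pos
  have hm := h.m_pos
  have hp3 : 3 ≤ p := by linarith
  have hN0 := equilibriumConst_nonneg h
  have hNx := equilibriumConst_le h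
  have hX₁Y := gradientErr_le h
  obtain ⟨X₁, hX₁⟩ : ∃ X, X = gradientErr L δ := ⟨_, rfl⟩
  have hX₁0 : 0 ≤ X₁ := by rw [hX₁, gradientErr]; positivity
  obtain ⟨X₂, hX₂⟩ : ∃ X, X = trapezoidErr L δ ℓ Lℓ := ⟨_, rfl⟩
  have hX₂0 : 0 ≤ X₂ := by rw [hX₂, trapezoidErr]; positivity
  obtain ⟨N, hN⟩ : ∃ N, N = equilibriumConst m L γ := ⟨_, rfl⟩
  obtain ⟨K, hK⟩ : ∃ K, K = K1 L + 3 := ⟨_, rfl⟩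
  have hK0 : 4.73 ≤ K := by linarith [(K1_ge hL).1]
  obtain ⟨A, hA⟩ : ∃ A, A = momentFactor L m γ δ := ⟨_, rfl⟩
  have hA1 : 1 ≤ A := by
    have := momentFactor_ge h
    have h2 : 0 ≤ 1 / Real.sqrt m := by positivity
    rw [hA]; linarith
  obtain ⟨c, hc⟩ : ∃ c, c = 1 / kappa m γ := ⟨_, rfl⟩
  have hc0 : 0 ≤ c := by rw [hc, kappa]; positivity
  obtain ⟨S, hS⟩ : ∃ S : ℝ, S = 2 ^ (p / 2) := ⟨_, rfl⟩
  have hS0 : 0 < S := by rw [hS]; positivity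
  have hSsq : (2 : ℝ) ^ p = S ^ 2 := by
    rw [hS, ← Real.rpow_natCast, ← Real.rpow_mul (by norm_num)]
    congr 1
    push_cast; ring
  have hS2 : 8 ≤ S ^ 2 := by
    rw [← hSsq]
    calc (8 : ℝ) = 2 ^ (3 : ℝ) := by norm_num
      _ ≤ 2 ^ p := Real.rpow_le_rpow_of_exponent_le (by norm_num) hp3
  have hS83 : 8 / 3 ≤ S := by nlinarith
  obtain ⟨Y₁, hY₁⟩ : ∃ Y, Y = (L + 2 * L ^ 2) / 4 * (1 + δ ^ 2 * (L ^ 2 / 4)) := ⟨_, rfl⟩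
  have hY₁0 : 0 ≤ Y₁ := by rw [hY₁]; positivity
  obtain ⟨Y₂, hY₂⟩ : ∃ Y, Y = (2 : ℝ) ^ ((ℓ - 3) / 2) * Lℓ * (1 + L * δ / 2) ^ 3 *
    (1 + δ + δ ^ 2 * L / 2) ^ (ℓ - 2) := ⟨_, rfl⟩
  obtain ⟨x, hx⟩ : ∃ x, x = K * A := ⟨_, rfl⟩
  have hx1 : 4.73 ≤ x := by rw [hx]; nlinarith
  have hJ : K ^ p * A ^ p = x ^ p := by rw [hx, Real.mul_rpow (by linarith) (by linarith)]
  have hDE : D + p - 2 ≤ E := by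
    rw [hE]
    calc D + p - 2 = (D + p - 2) ^ (1 : ℝ) := (Real.rpow_one _).symm
      _ ≤ _ := Real.rpow_le_rpow_of_exponent_le (by linarith) (by linarith)
  have hSX : 3 * S * X₂ = Y₂ := by
    have e : (2 : ℝ) ^ ((ℓ - 3) / 2) = S / 4 := by
      rw [hS, show (ℓ - 3) / 2 = p / 2 - 2 by rw [hp]; ring, Real.rpow_sub (by norm_num)]
      norm_num
    rw [hY₂, e, hX₂, trapezoidErr]; ring
  have hK10 : K10 L m γ δ ℓ Lℓ = (1 + S ^ 2 / 2 * x ^ p * (c + 1)) * (Y₁ + Y₂) := by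
    have e : (2 : ℝ) ^ ℓ = S ^ 2 / 2 := by
      rw [← hSsq, hp, Real.rpow_add (by norm_num)]; norm_num
    rw [K10, e, ← hp, ← hK, ← hA, ← hc, ← hY₁, ← hY₂, ← hJ]; ring
  rw [hK10, hSsq, ← hN, ← hK, ← hX₁, ← hX₂]
  rw [← hN, ← hK, ← hA, ← hx] at hNx
  rw [← hN] at hN0
  rw [← hX₁, ← hY₁] at hX₁Y
  rw [← hc] at hR
  have hx0 : 0 ≤ x := by linarith
  have hJ3 : x ^ 3 ≤ x ^ p := by
    rw [← Real.rpow_natCast]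
    exact Real.rpow_le_rpow_of_exponent_le (by linarith) (by exact_mod_cast hp3)
  have hN2 : 9 * N ^ 2 ≤ 16 * x ^ 2 := by
    have : N ^ 2 ≤ (4 / 3 * x) ^ 2 := by gcongr
    linarith
  have hNp : N ^ p ≤ S * x ^ p := by
    have h1 : N ^ p ≤ (4 / 3 * x) ^ p := Real.rpow_le_rpow hN0 hNx (by linarith)
    -- Because `(4/3)² = 16/9 ≤ 2`.
    have h2 : (4 / 3 : ℝ) ^ p ≤ S := by
      rw [rpow_eq_sq_rpow_half (by norm_num), hS]
      exact Real.rpow_le_rpow (by norm_num) (by norm_num) (by linarith)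
    rw [Real.mul_rpow (by norm_num) hx0] at h1
    exact h1.trans (by gcongr)
  have hKp0 : 0 ≤ K ^ p := by positivity
  have hKp : K ^ p ≤ x ^ p := by
    rw [← hJ]
    exact le_mul_of_one_le_right hKp0 (Real.one_le_rpow hA1 (by linarith))
  have main := energy_coefficients_le (t := t) (d := D) (E := E) hX₁Y hY₁0 hX₂0 hSX
    hS83 hS2 hx1 hJ3 hc0 hM ht (by linarith) (by linarith) (by linarith) hN2 hNp hKp hKp0
  refine le_trans ?_ main
  gcongr

theorem energy_sum_pol {M ℓ Lℓ : ℝ} {f : F × F → ℝ} (hℓ : 2 ≤ ℓ) (hLℓ : 0 ≤ Lℓ)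
    (hF : 1 ≤ Module.finrank ℝ F)
    (hG : IsConvexField G m L xstar) (h : Regime m L γ δ ε β)
    (hs : s ^ 2 = 1 - (1 - ε) ^ 2) (hσ : σ ^ 2 = ε) (hη : 0 ≤ η) (hη1 : η ≤ 1)
    (hM0 : 0 ≤ M) (hM : MeanLE ν (fun z => phaseNorm (z - (xstar, 0)) ^ (ℓ + 1)) M)
    (hfle : ∀ w, f w ≤ δ ^ 3 * (gradientErr L δ * phaseNorm (w - (xstar, 0)) ^ 2 +
      trapezoidErr L δ ℓ Lℓ * (phaseNorm (w - (xstar, 0)) ^ 3 +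
        phaseNorm (w - (xstar, 0)) ^ (ℓ + 1)))) :
    ∃ C : ℕ → ℝ, (∀ k, 0 ≤ C k ∧ MeanLE (preVerletLaw G δ η σ (1 - ε) s ν k) f (C k)) ∧
      ∀ n, ∑ k ∈ Finset.range n, C k ≤ δ ^ 2 * K10 L m γ δ ℓ Lℓ *
        (M + δ * n * ((Module.finrank ℝ F : ℝ) + ℓ - 1) ^ ((ℓ + 1) / 2)) := by
  have hL := h.L_pos
  have hδ := h.δ_pos
  have hq := h.rate_pos
  have hK := (K1_ge hL).1
  have hN0 := equilibriumConst_nonneg h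
  have hX₁ : 0 ≤ gradientErr L δ := by rw [gradientErr]; positivity
  have hX₂ : 0 ≤ trapezoidErr L δ ℓ Lℓ := by rw [trapezoidErr]; positivity
  have hD : (1 : ℝ) ≤ Module.finrank ℝ F := by exact_mod_cast hF
  have hD2 : 0 ≤ (Module.finrank ℝ F : ℝ) + (ℓ + 1) - 2 := by linarith
  refine ⟨_, fun k => ⟨?_, meanLE_energy_pol (by linarith) hX₁ hX₂ hF rfl rfl hG h hs hσ hη hη1
    hM0 hM hfle k⟩, fun n => ?_⟩
  · positivity
  have main := energy_coefficients_pol_le hℓ hLℓ h rfl hD rfl hM0 (delta_mul_sum_rate_le h n)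
    (mul_nonneg hδ.le n.cast_nonneg)
  rw [show (Module.finrank ℝ F : ℝ) + ℓ - 1 = Module.finrank ℝ F + (ℓ + 1) - 2 by ring,
    mul_assoc (δ ^ 2)]
  refine le_trans (le_of_eq ?_) (mul_le_mul_of_nonneg_left main (sq_nonneg δ))
  rw [Finset.sum_add_distrib, Finset.sum_const, Finset.card_range, nsmul_eq_mul, ← Finset.mul_sum]
  ring

end EnergySumsPol

/-! ### Calculus: the trapezoidal rule and cocoercivity of gradients. -/

theorem sub_le_sub_of_hasDerivAt_le {f g f' g' : ℝ → ℝ} {b : ℝ} (hb : 0 ≤ b)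
    (hf : ∀ t, HasDerivAt f (f' t) t) (hg : ∀ t, HasDerivAt g (g' t) t)
    (h : ∀ t, 0 ≤ t → t ≤ b → f' t ≤ g' t) : f b - f 0 ≤ g b - g 0 := by
  have hd : ∀ t, HasDerivAt (fun t => g t - f t) (g' t - f' t) t := fun t => (hg t).sub (hf t)
  have hmono : MonotoneOn (fun t => g t - f t) (Set.Icc 0 b) := by
    refine monotoneOn_of_deriv_nonneg (convex_Icc 0 b)
      (fun t _ => (hd t).continuousAt.continuousWithinAt)
      (fun t _ => (hd t).differentiableAt.differentiableWithinAt) fun t ht => ?_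
    rw [interior_Icc] at ht
    rw [(hd t).deriv]
    exact sub_nonneg.2 (h t ht.1.le ht.2.le)
  have := hmono (Set.left_mem_Icc.2 hb) (Set.right_mem_Icc.2 hb) hb
  simp only at this
  linarith

theorem abs_sub_le_of_hasDerivAt_le {f g f' g' : ℝ → ℝ} {b : ℝ} (hb : 0 ≤ b)
    (hf : ∀ t, HasDerivAt f (f' t) t) (hg : ∀ t, HasDerivAt g (g' t) t)
    (h : ∀ t, 0 ≤ t → t ≤ b → |f' t| ≤ g' t) : |f b - f 0| ≤ g b - g 0 := by
  rw [abs_le]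
  constructor
  · have := sub_le_sub_of_hasDerivAt_le hb (fun t => (hf t).neg) hg
      fun t h1 h2 => (neg_le_abs _).trans (h t h1 h2)
    simp only [Pi.neg_apply] at this
    linarith
  · exact sub_le_sub_of_hasDerivAt_le hb hf hg fun t h1 h2 => (le_abs_self _).trans (h t h1 h2)

/-- The error of the trapezoidal rule for a function with a Lipschitz second derivative. -/
theorem abs_trapezoid_le {φ φ' φ'' : ℝ → ℝ} {K : ℝ} (h1 : ∀ t, HasDerivAt φ (φ' t) t)
    (h2 : ∀ t, HasDerivAt φ' (φ'' t) t)
    (hK : ∀ s t, 0 ≤ s → s ≤ t → t ≤ 1 → |φ'' s - φ'' t| ≤ K * (t - s)) :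
    |φ 1 - φ 0 - (φ' 0 + φ' 1) / 2| ≤ K / 12 := by
  have step : ∀ t, 0 ≤ t → t ≤ 1 → |φ' t - φ' 0 - t * φ'' t| ≤ K * t ^ 2 / 2 := by
    intro t ht0 ht1
    have hf : ∀ s, HasDerivAt (fun s => φ' s - s * φ'' t) (φ'' s - 1 * φ'' t) s := fun s =>
      (h2 s).sub ((hasDerivAt_id s).mul_const _)
    have hg : ∀ s, HasDerivAt (fun s => K * (t * s - s ^ 2 / 2)) (K * (t - s)) s := fun s =>
      ((((hasDerivAt_id' s).const_mul t).sub
        (((hasDerivAt_id' s).pow 2).div_const 2)).const_mul K).congr_deriv (by norm_num)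
    have := abs_sub_le_of_hasDerivAt_le ht0 hf hg fun s hs0 hst => by
      rw [one_mul]; exact hK s t hs0 hst ht1
    simp only [zero_mul, sub_zero] at this
    rw [show φ' t - φ' 0 - t * φ'' t = φ' t - t * φ'' t - φ' 0 by ring]
    refine this.trans (le_of_eq (by ring))
  -- The trapezoidal error on `[0, t]` has derivative half the quantity bounded in `step`, hence at
  -- most `K t²/4`, which integrates to `K/12`.
  have hf : ∀ t, HasDerivAt (fun t => φ t - t * ((φ' 0 + φ' t) / 2))
      (φ' t - (1 * ((φ' 0 + φ' t) / 2) + t * (φ'' t / 2))) t := fun t =>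
    (h1 t).sub ((hasDerivAt_id t).mul (((h2 t).const_add _).div_const 2))
  have hg : ∀ t, HasDerivAt (fun t => K * t ^ 3 / 12) (K * t ^ 2 / 4) t := fun t =>
    ((((hasDerivAt_id' t).pow 3).const_mul K).div_const 12).congr_deriv (by norm_num; ring)
  have := abs_sub_le_of_hasDerivAt_le zero_le_one hf hg fun t ht0 ht1 => by
    have := step t ht0 ht1
    rw [show φ' t - (1 * ((φ' 0 + φ' t) / 2) + t * (φ'' t / 2)) =
      (φ' t - φ' 0 - t * φ'' t) / 2 by ring, abs_div, abs_two]
    linarith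
  simp only [zero_mul, one_mul, sub_zero, one_pow, mul_one] at this
  rw [show φ 1 - φ 0 - (φ' 0 + φ' 1) / 2 = φ 1 - (φ' 0 + φ' 1) / 2 - φ 0 by ring]
  refine this.trans (le_of_eq (by ring))

/-- The Baillon-Haddad inequality. -/
theorem norm_sub_sq_le_mul_inner {F : Type*} [NormedAddCommGroup F] [InnerProductSpace ℝ F]
    {L : ℝ} {h : F → ℝ} {H : F → F} (hL : 0 < L)
    (hconv : ∀ x y, h x + inner ℝ (H x) (y - x) ≤ h y)
    (hsmooth : ∀ x y, h y ≤ h x + inner ℝ (H x) (y - x) + L / 2 * ‖y - x‖ ^ 2) (x y : F) :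
    ‖H x - H y‖ ^ 2 ≤ L * inner ℝ (x - y) (H x - H y) := by
  have key : ∀ x y, h x + inner ℝ (H x) (y - x) + 1 / (2 * L) * ‖H y - H x‖ ^ 2 ≤ h y := by
    intro x y
    set D := H y - H x with hD
    -- Convexity from `x` and smoothness from `y` are compared at the point that minimises the upper
    -- model at `y` minus the tangent at `x`. Exchanging `x` and `y` and adding gives the result.
    have h1 := hconv x (y - (1 / L) • D)
    have h2 := hsmooth y (y - (1 / L) • D)
    rw [sub_sub_cancel_left, inner_neg_right, real_inner_smul_right, norm_neg, norm_smul,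
      Real.norm_of_nonneg (by positivity), mul_pow] at h2
    rw [sub_right_comm, inner_sub_right _ (y - x), real_inner_smul_right] at h1
    have h3 : inner ℝ (H y) D - inner ℝ (H x) D = ‖D‖ ^ 2 := by
      rw [← inner_sub_left, ← hD, real_inner_self_eq_norm_sq]
    have e : L / 2 * ((1 / L) ^ 2 * ‖D‖ ^ 2) = 1 / (2 * L) * ‖D‖ ^ 2 := by field_simp
    have e2 : 1 / L * inner ℝ (H y) D - 1 / L * inner ℝ (H x) D = 2 * (1 / (2 * L) * ‖D‖ ^ 2) := by
      rw [← mul_sub, h3]; field_simp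
    rw [e] at h2
    linarith
  have h1 := key x y
  have h2 := key y x
  rw [norm_sub_rev] at h1
  have h3 : inner ℝ (H x) (y - x) + inner ℝ (H y) (x - y) = -inner ℝ (x - y) (H x - H y) := by
    simp only [inner_sub_right, inner_sub_left, real_inner_comm]
    ring
  have h4 : 1 / L * ‖H x - H y‖ ^ 2 ≤ inner ℝ (x - y) (H x - H y) := by
    have e : 1 / L * ‖H x - H y‖ ^ 2 = 2 * (1 / (2 * L) * ‖H x - H y‖ ^ 2) := by field_simp
    linarith
  have h5 := mul_le_mul_of_nonneg_left h4 hL.le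
  rwa [← mul_assoc, mul_one_div_cancel hL.ne', one_mul] at h5

/-! ### Strongly convex potentials: cocoercivity, minimiser, Taylor estimates. -/

section Gradient

variable {F : Type*} [NormedAddCommGroup F] [InnerProductSpace ℝ F] [CompleteSpace F]
  {V : F → ℝ} {m L : ℝ}

theorem hasDerivAt_comp_line (hV : Differentiable ℝ V) (x Δ : F) (t : ℝ) :
    HasDerivAt (fun t : ℝ => V (x + t • Δ)) (inner ℝ (gradient V (x + t • Δ)) Δ) t := by
  have h1 : HasDerivAt (fun t : ℝ => x + t • Δ) Δ t := by
    simpa using ((hasDerivAt_id t).smul_const Δ).const_add x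
  exact (hV (x + t • Δ)).hasGradientAt.hasFDerivAt.comp_hasDerivAt t h1

theorem abs_sub_sub_inner_gradient_le (hV : Differentiable ℝ V)
    (hL : ∀ x y, ‖gradient V x - gradient V y‖ ≤ L * ‖x - y‖) (x y : F) :
    |V y - V x - inner ℝ (gradient V x) (y - x)| ≤ L / 2 * ‖y - x‖ ^ 2 := by
  set Δ := y - x with hΔ
  have hf : ∀ t : ℝ, HasDerivAt (fun t : ℝ => V (x + t • Δ) - t * inner ℝ (gradient V x) Δ)
      (inner ℝ (gradient V (x + t • Δ)) Δ - 1 * inner ℝ (gradient V x) Δ) t := fun t =>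
    (hasDerivAt_comp_line hV x Δ t).sub ((hasDerivAt_id t).mul_const _)
  have hg : ∀ t : ℝ, HasDerivAt (fun t : ℝ => L * ‖Δ‖ ^ 2 * t ^ 2 / 2) (L * ‖Δ‖ ^ 2 * t) t :=
    fun t => ((((hasDerivAt_id' t).pow 2).const_mul (L * ‖Δ‖ ^ 2)).div_const 2).congr_deriv
      (by norm_num; ring)
  have := abs_sub_le_of_hasDerivAt_le zero_le_one hf hg fun t ht0 _ => by
    rw [one_mul, ← inner_sub_left]
    refine (abs_real_inner_le_norm _ _).trans ?_
    have h1 := hL (x + t • Δ) x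
    rw [add_sub_cancel_left, norm_smul, Real.norm_of_nonneg ht0] at h1
    have := mul_le_mul_of_nonneg_right h1 (norm_nonneg Δ)
    linarith
  simp only [zero_smul, one_smul, add_zero, zero_mul, one_mul, sub_zero] at this
  rw [hΔ, add_sub_cancel, ← hΔ] at this
  rw [show V y - V x - inner ℝ (gradient V x) Δ = V y - inner ℝ (gradient V x) Δ - V x by ring]
  refine this.trans (le_of_eq (by ring))

theorem add_inner_gradient_le (hV : Differentiable ℝ V)
    (hm : ∀ x y, m * ‖x - y‖ ^ 2 ≤ inner ℝ (x - y) (gradient V x - gradient V y)) (x y : F) :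
    V x + inner ℝ (gradient V x) (y - x) + m / 2 * ‖y - x‖ ^ 2 ≤ V y := by
  set Δ := y - x with hΔ
  have hf : ∀ t : ℝ, HasDerivAt (fun t : ℝ => V (x + t • Δ) - t * inner ℝ (gradient V x) Δ)
      (inner ℝ (gradient V (x + t • Δ)) Δ - 1 * inner ℝ (gradient V x) Δ) t := fun t =>
    (hasDerivAt_comp_line hV x Δ t).sub ((hasDerivAt_id t).mul_const _)
  have hg : ∀ t : ℝ, HasDerivAt (fun t : ℝ => m * ‖Δ‖ ^ 2 * t ^ 2 / 2) (m * ‖Δ‖ ^ 2 * t) t :=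
    fun t => ((((hasDerivAt_id' t).pow 2).const_mul (m * ‖Δ‖ ^ 2)).div_const 2).congr_deriv
      (by norm_num; ring)
  have := sub_le_sub_of_hasDerivAt_le zero_le_one hg hf fun t ht0 _ => by
    rw [one_mul, ← inner_sub_left]
    rcases ht0.eq_or_lt with rfl | ht
    · simp
    have h1 := hm (x + t • Δ) x
    rw [add_sub_cancel_left, norm_smul, Real.norm_of_nonneg ht0, real_inner_smul_left,
      real_inner_comm] at h1
    refine le_of_mul_le_mul_left ?_ ht
    linarith
  simp only [zero_smul, one_smul, add_zero, zero_mul, one_mul, sub_zero] at this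
  rw [hΔ, add_sub_cancel, ← hΔ] at this
  linarith

/-- The Baillon–Haddad inequality is applied to `V - m|x|²/2`, which is convex by strong convexity
and satisfies the upper quadratic bound with the same `L`, the subtracted term having a good sign.
-/
theorem isConvexField_gradient (hV : Differentiable ℝ V) (hm0 : 0 < m) (hL0 : 0 < L)
    (hL : ∀ x y, ‖gradient V x - gradient V y‖ ≤ L * ‖x - y‖)
    (hm : ∀ x y, m * ‖x - y‖ ^ 2 ≤ inner ℝ (x - y) (gradient V x - gradient V y)) {xstar : F}
    (h0 : gradient V xstar = 0) : IsConvexField (gradient V) m L xstar := by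
  refine ⟨hL, hm, fun x y => ?_, h0⟩
  have e1 : ∀ x y : F, m / 2 * ‖y‖ ^ 2 =
      m / 2 * ‖x‖ ^ 2 + inner ℝ (m • x) (y - x) + m / 2 * ‖y - x‖ ^ 2 := fun x y => by
    rw [norm_sub_sq_real, inner_sub_right, real_inner_smul_left, real_inner_smul_left,
      real_inner_self_eq_norm_sq, real_inner_comm]
    ring
  have := norm_sub_sq_le_mul_inner (h := fun x => V x - m / 2 * ‖x‖ ^ 2)
    (H := fun x => gradient V x - m • x) hL0 (fun x y => by
      have h1 := add_inner_gradient_le hV hm x y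
      have h2 := e1 x y
      rw [inner_sub_left]
      linarith) (fun x y => by
      have h1 := (abs_le.1 (abs_sub_sub_inner_gradient_le hV hL x y)).2
      have h2 := e1 x y
      have h3 : 0 ≤ m / 2 * ‖y - x‖ ^ 2 := by positivity
      rw [inner_sub_left]
      linarith) x y
  rwa [show gradient V x - m • x - (gradient V y - m • y) = gradient V x - gradient V y - m • (x - y)
    by module] at this

theorem exists_gradient_eq_zero [FiniteDimensional ℝ F] (hV : Differentiable ℝ V) (hm0 : 0 < m)
    (hm : ∀ x y, m * ‖x - y‖ ^ 2 ≤ inner ℝ (x - y) (gradient V x - gradient V y)) :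
    ∃ x, gradient V x = 0 := by
  have hlim : Filter.Tendsto V (Filter.cocompact F) Filter.atTop := by
    have h1 : Filter.Tendsto (fun r : ℝ => V 0 + r * (m / 2 * r - ‖gradient V 0‖))
        Filter.atTop Filter.atTop := by
      refine Filter.tendsto_atTop_add_const_left _ _ (Filter.tendsto_id.atTop_mul_atTop₀ ?_)
      exact Filter.tendsto_atTop_add_const_right _ _
        (Filter.tendsto_id.const_mul_atTop (by positivity))
    refine Filter.tendsto_atTop_mono (fun y => ?_) (h1.comp (tendsto_norm_cocompact_atTop (E := F)))
    have h2 := add_inner_gradient_le hV hm 0 y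
    have h3 := neg_le_of_abs_le (abs_real_inner_le_norm (gradient V 0) y)
    rw [sub_zero] at h2
    simp only [Function.comp]
    linarith
  obtain ⟨x, hx⟩ := hV.continuous.exists_forall_le hlim
  refine ⟨x, ?_⟩
  have h1 : IsLocalMin V x := Filter.Eventually.of_forall hx
  rw [gradient, h1.fderiv_eq_zero, map_zero]

theorem lt_of_gradient_eq_zero (hV : Differentiable ℝ V) (hm0 : 0 < m)
    (hm : ∀ x y, m * ‖x - y‖ ^ 2 ≤ inner ℝ (x - y) (gradient V x - gradient V y)) {x y : F}
    (hx : gradient V x = 0) (hxy : y ≠ x) : V x < V y := by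
  have h1 := add_inner_gradient_le hV hm x y
  rw [hx, inner_zero_left, add_zero] at h1
  have h2 : 0 < ‖y - x‖ := norm_pos_iff.2 (sub_ne_zero.2 hxy)
  have : 0 < m / 2 * ‖y - x‖ ^ 2 := by positivity
  linarith

theorem contDiff_gradient (hV : ContDiff ℝ 2 V) : ContDiff ℝ 1 (gradient V) := by
  have h1 : ContDiff ℝ 1 (fderiv ℝ V) := hV.fderiv_right (by norm_num)
  exact (InnerProductSpace.toDual ℝ F).symm.toContinuousLinearEquiv.contDiff.comp h1

/-- The error of the trapezoidal rule on a segment, from a bound on the variation of the Hessian. -/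
theorem abs_trapezoid_gradient_le (hV : ContDiff ℝ 2 V) {ℓ Lℓ ρ : ℝ} {xstar x y : F}
    (hℓ : 2 ≤ ℓ) (hLℓ : 0 ≤ Lℓ)
    (hH : ∀ x y, ‖fderiv ℝ (gradient V) y - fderiv ℝ (gradient V) x‖ ≤
      Lℓ * ‖x - y‖ * (2 + ‖x - xstar‖ ^ (ℓ - 2) + ‖y - xstar‖ ^ (ℓ - 2)) / 4)
    (hx : ‖x - xstar‖ ≤ ρ) (hy : ‖y - xstar‖ ≤ ρ) :
    |V y - V x - inner ℝ (gradient V x + gradient V y) (y - x) / 2| ≤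
      Lℓ / 24 * (‖y - x‖ ^ 3 * (1 + ρ ^ (ℓ - 2))) := by
  have hVd : Differentiable ℝ V := hV.differentiable (by norm_num)
  have hGd : Differentiable ℝ (gradient V) := (contDiff_gradient hV).differentiable (by norm_num)
  set Δ := y - x with hΔ
  have h1 := hasDerivAt_comp_line hVd x Δ
  have h2 : ∀ t : ℝ, HasDerivAt (fun t : ℝ => inner ℝ (gradient V (x + t • Δ)) Δ)
      (inner ℝ (fderiv ℝ (gradient V) (x + t • Δ) Δ) Δ) t := fun t => by
    have h3 : HasDerivAt (fun t : ℝ => x + t • Δ) Δ t := by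
      simpa using ((hasDerivAt_id t).smul_const Δ).const_add x
    have h4 := (hGd (x + t • Δ)).hasFDerivAt.comp_hasDerivAt t h3
    simpa using h4.inner ℝ (hasDerivAt_const t Δ)
  have hball : ∀ t : ℝ, 0 ≤ t → t ≤ 1 → ‖x + t • Δ - xstar‖ ≤ ρ := fun t ht0 ht1 => by
    have e : x + t • Δ - xstar = (1 - t) • (x - xstar) + t • (y - xstar) := by rw [hΔ]; module
    rw [e]
    refine (norm_add_le _ _).trans ?_
    rw [norm_smul, norm_smul, Real.norm_of_nonneg ht0, Real.norm_of_nonneg (sub_nonneg.2 ht1)]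
    have h5 := mul_le_mul_of_nonneg_left hx (sub_nonneg.2 ht1)
    have h6 := mul_le_mul_of_nonneg_left hy ht0
    linarith
  have main := abs_trapezoid_le (K := Lℓ / 2 * (‖Δ‖ ^ 3 * (1 + ρ ^ (ℓ - 2)))) h1 h2
    fun s t hs hst ht => by
      rw [← inner_sub_left, ← sub_apply]
      refine (abs_real_inner_le_norm _ _).trans ?_
      have h5 := hH (x + t • Δ) (x + s • Δ)
      have h6 : ‖x + t • Δ - (x + s • Δ)‖ = (t - s) * ‖Δ‖ := by
        rw [show x + t • Δ - (x + s • Δ) = (t - s) • Δ by module, norm_smul,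
          Real.norm_of_nonneg (sub_nonneg.2 hst)]
      rw [h6] at h5
      have h7 : ‖x + t • Δ - xstar‖ ^ (ℓ - 2) ≤ ρ ^ (ℓ - 2) :=
        Real.rpow_le_rpow (norm_nonneg _) (hball t (hs.trans hst) ht) (by linarith)
      have h8 : ‖x + s • Δ - xstar‖ ^ (ℓ - 2) ≤ ρ ^ (ℓ - 2) :=
        Real.rpow_le_rpow (norm_nonneg _) (hball s hs (hst.trans ht)) (by linarith)
      have hts : 0 ≤ Lℓ * ((t - s) * ‖Δ‖) := by
        have := sub_nonneg.2 hst
        positivity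
      have h9 : ‖fderiv ℝ (gradient V) (x + s • Δ) - fderiv ℝ (gradient V) (x + t • Δ)‖ ≤
          Lℓ * ((t - s) * ‖Δ‖) * (2 + ρ ^ (ℓ - 2) + ρ ^ (ℓ - 2)) / 4 := by
        refine h5.trans ?_
        gcongr
      calc _ ≤ (Lℓ * ((t - s) * ‖Δ‖) * (2 + ρ ^ (ℓ - 2) + ρ ^ (ℓ - 2)) / 4 * ‖Δ‖) * ‖Δ‖ := by
            gcongr
            exact (ContinuousLinearMap.le_opNorm _ _).trans (by gcongr)
        _ = _ := by ring
  simp only [zero_smul, one_smul, add_zero] at main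
  rw [hΔ, add_sub_cancel, ← hΔ] at main
  rw [inner_add_left]
  exact main.trans (le_of_eq (by ring))

end Gradient

/-- The gain of kinetic energy is minus the trapezoidal approximation of the gain of potential
energy, up to a difference of squared forces. This cancellation is the reason why the energy error
is small, and it is exact for any field. -/
theorem norm_sq_snd_verletField_sub {F : Type*} [NormedAddCommGroup F]
    [InnerProductSpace ℝ F] (G : F → F) (δ : ℝ) (z : F × F) :
    (‖(verletField G δ z).2‖ ^ 2 - ‖z.2‖ ^ 2) / 2 =
      δ ^ 2 / 8 * (‖G (verletField G δ z).1‖ ^ 2 - ‖G z.1‖ ^ 2) -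
        inner ℝ (G z.1 + G (verletField G δ z).1) ((verletField G δ z).1 - z.1) / 2 := by
  obtain ⟨x₁, hx₁⟩ : ∃ x₁, x₁ = (verletField G δ z).1 := ⟨_, rfl⟩
  have e1 : (verletField G δ z).2 = z.2 - (δ / 2) • (G z.1 + G x₁) := by rw [hx₁]; rfl
  have e2 : x₁ - z.1 = δ • z.2 - (δ ^ 2 / 2) • G z.1 := by
    rw [hx₁]; simp only [verletField]; abel
  rw [← hx₁, e1, e2, norm_sub_sq_real, norm_smul, mul_pow, Real.norm_eq_abs, sq_abs,
    norm_add_sq_real]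
  simp only [inner_add_left, inner_add_right, inner_sub_right, real_inner_smul_right,
    real_inner_self_eq_norm_sq, real_inner_comm (G z.1), real_inner_comm (G x₁) z.2]
  ring

/-! ### Energy error of one Verlet step. -/

section VerletEnergy

variable {F : Type*} [NormedAddCommGroup F] [InnerProductSpace ℝ F] [CompleteSpace F]
  {V : F → ℝ} {m L δ : ℝ} {xstar : F}

/-- The energy gained by a Verlet step for the potential `V`. -/
def energyErr (V : F → ℝ) (δ : ℝ) (z : F × F) : ℝ :=
  V (verletField (gradient V) δ z).1 + ‖(verletField (gradient V) δ z).2‖ ^ 2 / 2 -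
    (V z.1 + ‖z.2‖ ^ 2 / 2)

theorem norm_gradient_le (hG : IsConvexField (gradient V) m L xstar) (x : F) :
    ‖gradient V x‖ ≤ L * ‖x - xstar‖ := by
  have := hG.lip x xstar
  rwa [hG.zero, sub_zero] at this

theorem norm_verletField_fst_sub_le (hG : IsConvexField (gradient V) m L xstar) (hδ : 0 ≤ δ)
    (z : F × F) :
    ‖(verletField (gradient V) δ z).1 - z.1‖ ≤ δ * (‖z.2‖ + δ * L / 2 * ‖z.1 - xstar‖) := by
  have e2 : (verletField (gradient V) δ z).1 - z.1 = δ • z.2 - (δ ^ 2 / 2) • gradient V z.1 := by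
    simp only [verletField]; abel
  rw [e2]
  refine (norm_sub_le _ _).trans ?_
  rw [norm_smul, norm_smul, Real.norm_of_nonneg hδ, Real.norm_of_nonneg (by positivity)]
  have := mul_le_mul_of_nonneg_left (norm_gradient_le hG z.1) (by positivity : 0 ≤ δ ^ 2 / 2)
  linarith

theorem abs_norm_gradient_sq_sub_le (hG : IsConvexField (gradient V) m L xstar) (hL : 0 ≤ L)
    (x y : F) :
    |‖gradient V y‖ ^ 2 - ‖gradient V x‖ ^ 2| ≤
      L ^ 2 * (2 * (‖y - x‖ * ‖x - xstar‖) + ‖y - x‖ ^ 2) := by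
  have h1 := norm_gradient_le hG x
  have h2 := hG.lip y x
  have h3 := abs_norm_sub_norm_le (gradient V y) (gradient V x)
  rw [sq_sub_sq, abs_mul, abs_of_nonneg (by positivity : 0 ≤ ‖gradient V y‖ + ‖gradient V x‖)]
  have h4 : ‖gradient V y‖ + ‖gradient V x‖ ≤ L * (2 * ‖x - xstar‖ + ‖y - x‖) := by
    have := (le_abs_self _).trans h3
    linarith
  calc _ ≤ (L * (2 * ‖x - xstar‖ + ‖y - x‖)) * (L * ‖y - x‖) := by
        gcongr
        exact h3.trans h2
    _ = _ := by ring

theorem two_mul_abs_energyErr_le (hG : IsConvexField (gradient V) m L xstar) (hL : 0 ≤ L)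
    {z : F × F} {B : ℝ}
    (hB : |V (verletField (gradient V) δ z).1 - V z.1 -
      inner ℝ (gradient V z.1 + gradient V (verletField (gradient V) δ z).1)
        ((verletField (gradient V) δ z).1 - z.1) / 2| ≤ B) :
    2 * |energyErr V δ z| ≤ 2 * B + δ ^ 2 * L ^ 2 / 4 *
      (2 * (‖(verletField (gradient V) δ z).1 - z.1‖ * ‖z.1 - xstar‖) +
        ‖(verletField (gradient V) δ z).1 - z.1‖ ^ 2) := by
  have h1 := norm_sq_snd_verletField_sub (gradient V) δ z
  have h2 := abs_norm_gradient_sq_sub_le hG hL z.1 (verletField (gradient V) δ z).1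
  have e : energyErr V δ z = (V (verletField (gradient V) δ z).1 - V z.1 -
      inner ℝ (gradient V z.1 + gradient V (verletField (gradient V) δ z).1)
        ((verletField (gradient V) δ z).1 - z.1) / 2) + δ ^ 2 / 8 *
      (‖gradient V (verletField (gradient V) δ z).1‖ ^ 2 - ‖gradient V z.1‖ ^ 2) := by
    rw [energyErr]; linarith
  rw [e]
  have h3 := abs_add_le (V (verletField (gradient V) δ z).1 - V z.1 -
      inner ℝ (gradient V z.1 + gradient V (verletField (gradient V) δ z).1)
        ((verletField (gradient V) δ z).1 - z.1) / 2) (δ ^ 2 / 8 *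
      (‖gradient V (verletField (gradient V) δ z).1‖ ^ 2 - ‖gradient V z.1‖ ^ 2))
  rw [abs_mul, abs_of_nonneg (by positivity : 0 ≤ δ ^ 2 / 8)] at h3
  have h4 := mul_le_mul_of_nonneg_left h2 (by positivity : 0 ≤ δ ^ 2 / 8)
  linarith

theorem displacement_bounds {a b N D δ L : ℝ} (ha : 0 ≤ a) (hδ : 0 ≤ δ) (hL : 0 ≤ L)
    (hN : N ^ 2 = a ^ 2 + b ^ 2) (hD0 : 0 ≤ D) (hD : D ≤ δ * (b + δ * L / 2 * a)) :
    D ^ 2 ≤ δ ^ 2 * (1 + δ ^ 2 * L ^ 2 / 4) * N ^ 2 ∧ 2 * (D * a) ≤ δ * (1 + δ * L) * N ^ 2 := by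
  constructor
  · have h1 : D ^ 2 ≤ (δ * (b + δ * L / 2 * a)) ^ 2 := by gcongr
    have h2 : (b + δ * L / 2 * a) ^ 2 ≤ (1 + δ ^ 2 * L ^ 2 / 4) * N ^ 2 := by
      rw [hN]
      linarith [sq_nonneg (a - δ * L / 2 * b)]
    have h3 := mul_le_mul_of_nonneg_left h2 (sq_nonneg δ)
    linarith
  · have h1 := mul_le_mul_of_nonneg_right hD ha
    have h2 : 2 * (b * a) + δ * L * a ^ 2 ≤ (1 + δ * L) * N ^ 2 := by
      have : 0 ≤ δ * L * b ^ 2 := by positivity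
      rw [hN]
      linarith [sq_nonneg (a - b)]
    have h3 := mul_le_mul_of_nonneg_left h2 hδ
    linarith

theorem two_mul_abs_energyErr_le_quadratic (hV : Differentiable ℝ V)
    (hG : IsConvexField (gradient V) m L xstar) (hL : 0 ≤ L) (hδ : 0 ≤ δ) (z : F × F) :
    2 * |energyErr V δ z| ≤
      δ ^ 2 * (2 * L * quadraticErr L δ) * phaseNorm (z - (xstar, 0)) ^ 2 := by
  set x₁ := (verletField (gradient V) δ z).1 with hx₁
  -- The trapezoidal error is the average of the first-order Taylor errors based at the two end
  -- points.
  have hR : |V x₁ - V z.1 - inner ℝ (gradient V z.1 + gradient V x₁) (x₁ - z.1) / 2| ≤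
      L / 2 * ‖x₁ - z.1‖ ^ 2 := by
    have h1 := abs_le.1 (abs_sub_sub_inner_gradient_le hV hG.lip z.1 x₁)
    have h2 := abs_le.1 (abs_sub_sub_inner_gradient_le hV hG.lip x₁ z.1)
    rw [norm_sub_rev z.1 x₁, ← neg_sub x₁ z.1, inner_neg_right] at h2
    rw [inner_add_left, abs_le]
    constructor <;> linarith [h1.1, h1.2, h2.1, h2.2]
  have h3 := two_mul_abs_energyErr_le hG hL hR
  obtain ⟨h4, h5⟩ := displacement_bounds (norm_nonneg (z.1 - xstar)) hδ hL (b := ‖z.2‖)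
    (N := phaseNorm (z - (xstar, 0))) (by rw [phaseNorm_sq]; simp) (norm_nonneg (x₁ - z.1))
    (norm_verletField_fst_sub_le hG hδ z)
  rw [← hx₁] at h3
  refine h3.trans ?_
  set N2 := phaseNorm (z - (xstar, 0)) ^ 2 with hN2
  have hN0 : 0 ≤ N2 := sq_nonneg _
  have h6 := mul_le_mul_of_nonneg_left h4 hL
  have h7 := mul_le_mul_of_nonneg_left (add_le_add h5 h4)
    (by positivity : 0 ≤ δ ^ 2 * L ^ 2 / 4)
  have h8 : 0 ≤ δ ^ 2 * L * N2 := by positivity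
  have h9 : 0 ≤ δ ^ 2 * L * N2 * δ := by positivity
  have h10 : 0 ≤ δ ^ 2 * L * N2 * (δ ^ 2 * L ^ 2) := by positivity
  have h11 : 0 ≤ δ ^ 2 * L * N2 * (δ ^ 2 * L ^ 2 * δ) := by positivity
  have h12 : 0 ≤ δ ^ 2 * L * N2 * (δ ^ 2 * L) := by positivity
  have h13 : 0 ≤ δ ^ 2 * L * N2 * (δ ^ 2 * L ^ 2 * (δ ^ 2 * L)) := by positivity
  rw [quadraticErr]
  linarith

/-- The displacement has order `δ`, so its cube in the trapezoidal error and the difference of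
squared forces times `δ²` both give `δ³`. Both ends of the segment are within `(1 + δ + δ²L/2)|z -
z⋆|` of `x⋆`, which controls the polynomial weight of the Hessian bound. -/
theorem two_mul_abs_energyErr_le_pol (hV : ContDiff ℝ 2 V) {ℓ Lℓ : ℝ}
    (hℓ : 2 ≤ ℓ) (hLℓ : 0 ≤ Lℓ)
    (hH : ∀ x y, ‖fderiv ℝ (gradient V) y - fderiv ℝ (gradient V) x‖ ≤
      Lℓ * ‖x - y‖ * (2 + ‖x - xstar‖ ^ (ℓ - 2) + ‖y - xstar‖ ^ (ℓ - 2)) / 4)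
    (hG : IsConvexField (gradient V) m L xstar) (hL : 0 ≤ L) (hδ : 0 ≤ δ) (z : F × F) :
    2 * |energyErr V δ z| ≤
      δ ^ 3 * (gradientErr L δ * phaseNorm (z - (xstar, 0)) ^ 2 +
        trapezoidErr L δ ℓ Lℓ * (phaseNorm (z - (xstar, 0)) ^ 3 +
          phaseNorm (z - (xstar, 0)) ^ (ℓ + 1))) := by
  set x₁ := (verletField (gradient V) δ z).1 with hx₁
  have hdisp := norm_verletField_fst_sub_le hG hδ z
  rw [← hx₁] at hdisp
  obtain ⟨N, hN⟩ : ∃ N, N = phaseNorm (z - (xstar, 0)) := ⟨_, rfl⟩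
  have hN0 : 0 ≤ N := hN ▸ phaseNorm_nonneg _
  have hNa : ‖z.1 - xstar‖ ≤ N := by
    have := norm_fst_le_phaseNorm (z - (xstar, 0))
    rwa [← hN] at this
  have hNb : ‖z.2‖ ≤ N := by
    have := norm_snd_le_phaseNorm (z - (xstar, 0))
    rw [← hN] at this
    simpa using this
  have hD : ‖x₁ - z.1‖ ≤ δ * ((1 + L * δ / 2) * N) := by
    refine hdisp.trans ?_
    have : ‖z.2‖ + δ * L / 2 * ‖z.1 - xstar‖ ≤ N + δ * L / 2 * N := by gcongr
    have := mul_le_mul_of_nonneg_left this hδ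
    linarith
  set c := 1 + δ + δ ^ 2 * L / 2 with hc
  have hc1 : 1 ≤ c := by
    have : 0 ≤ δ ^ 2 * L / 2 := by positivity
    linarith
  have hρ1 : ‖z.1 - xstar‖ ≤ c * N := hNa.trans (le_mul_of_one_le_left hN0 hc1)
  have hρ2 : ‖x₁ - xstar‖ ≤ c * N := by
    have h1 := norm_add_le (x₁ - z.1) (z.1 - xstar)
    rw [sub_add_sub_cancel] at h1
    rw [hc]
    linarith
  have hR := abs_trapezoid_gradient_le hV hℓ hLℓ hH hρ1 hρ2
  have h3 := two_mul_abs_energyErr_le hG hL hR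
  rw [← hx₁] at h3
  obtain ⟨h4, h5⟩ := displacement_bounds (norm_nonneg (z.1 - xstar)) hδ hL (b := ‖z.2‖)
    (N := N) (by rw [hN, phaseNorm_sq]; simp) (norm_nonneg (x₁ - z.1)) hdisp
  rw [← hN]
  have hcp : 1 ≤ c ^ (ℓ - 2) := Real.one_le_rpow hc1 (by linarith)
  have hNp : N ^ (ℓ + 1) = N ^ 3 * N ^ (ℓ - 2) := by
    rw [← Real.rpow_natCast, ← Real.rpow_add_of_nonneg hN0 (by norm_num) (by linarith)]
    congr 1
    push_cast; ring
  have h6 : ‖x₁ - z.1‖ ^ 3 * (1 + (c * N) ^ (ℓ - 2)) ≤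
      δ ^ 3 * ((1 + L * δ / 2) ^ 3 * c ^ (ℓ - 2)) * (N ^ 3 + N ^ (ℓ + 1)) := by
    rw [Real.mul_rpow (by linarith) hN0, hNp]
    have hNq : 0 ≤ N ^ (ℓ - 2) := by positivity
    calc ‖x₁ - z.1‖ ^ 3 * (1 + c ^ (ℓ - 2) * N ^ (ℓ - 2))
        ≤ (δ * ((1 + L * δ / 2) * N)) ^ 3 * (c ^ (ℓ - 2) + c ^ (ℓ - 2) * N ^ (ℓ - 2)) := by gcongr
      _ = _ := by ring
  have h7 := mul_le_mul_of_nonneg_left h6 (by positivity : 0 ≤ Lℓ / 12)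
  have h8 := mul_le_mul_of_nonneg_left (add_le_add h5 h4)
    (by positivity : 0 ≤ δ ^ 2 * L ^ 2 / 4)
  rw [gradientErr, trapezoidErr, ← hc]
  linarith

end VerletEnergy

/-! ### Linear images of the chain. -/

theorem map_verletField {F F' : Type*} [NormedAddCommGroup F] [InnerProductSpace ℝ F]
    [NormedAddCommGroup F'] [InnerProductSpace ℝ F'] {G : F → F} {G' : F' → F'} (T : F →L[ℝ] F')
    (hTG : ∀ x, T (G x) = G' (T x))
    (δ : ℝ) (z : F × F) :
    Prod.map T T (verletField G δ z) = verletField G' δ (Prod.map T T z) := by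
  simp [verletField, hTG]

section Intertwining

variable {F F' : Type*} [NormedAddCommGroup F] [InnerProductSpace ℝ F] [FiniteDimensional ℝ F]
  [MeasurableSpace F] [BorelSpace F] [NormedAddCommGroup F'] [InnerProductSpace ℝ F']
  [FiniteDimensional ℝ F'] [MeasurableSpace F'] [BorelSpace F']

theorem map_refresh (T : F →L[ℝ] F') (hT : (stdGaussian F).map T = stdGaussian F') (a b : ℝ)
    (ρ : Measure (F × F)) [SFinite ρ] :
    (refresh a b ρ).map (Prod.map T T) = refresh a b (ρ.map (Prod.map T T)) := by
  have hr := measurable_refreshMap (F := F) a b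
  have hr' := measurable_refreshMap (F := F') a b
  have hTm : Measurable (Prod.map T T) := T.measurable.prodMap T.measurable
  rw [refresh, refresh, Measure.map_map hTm hr, ← hT, Measure.map_prod_map _ _ hTm T.measurable,
    Measure.map_map hr' (hTm.prodMap T.measurable)]
  congr 1
  ext w
  · simp [refreshMap]
  · simp [refreshMap]

/-- Applied to coordinate projections: each coordinate of the chain of a separable potential is the
one-dimensional chain of `U_i`. -/
theorem map_preVerletLaw {G : F → F} {G' : F' → F'} (hG : Continuous G) (hG' : Continuous G')
    (T : F →L[ℝ] F') (hT : (stdGaussian F).map T = stdGaussian F')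
    (hTG : ∀ x, T (G x) = G' (T x)) (δ η σ a s : ℝ) (ν : Measure (F × F)) [IsProbabilityMeasure ν]
    (k : ℕ) :
    (preVerletLaw G δ η σ a s ν k).map (Prod.map T T) =
      preVerletLaw G' δ η σ a s (ν.map (Prod.map T T)) k := by
  have hTm : Measurable (Prod.map T T) := T.measurable.prodMap T.measurable
  have hV := measurable_verletField hG δ
  have hV' := measurable_verletField hG' δ
  induction k with
  | zero => exact map_refresh T hT _ _ _
  | succ k ih =>
    have := isProbabilityMeasure_preVerletLaw (ν := ν) (δ := δ) (η := η) (σ := σ) (a := a) (s := s)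
      hG k
    rw [preVerletLaw, map_refresh T hT, preVerletLaw, ← ih, Measure.map_map hTm hV,
      Measure.map_map hV' hTm]
    congr 2
    ext1 z
    exact map_verletField T hTG δ z

theorem map_inner_stdGaussian {u : F} (hu : ‖u‖ = 1) :
    (stdGaussian F).map (innerSL ℝ u) = stdGaussian ℝ := by
  have : IsProbabilityMeasure ((stdGaussian F).map (innerSL ℝ u)) :=
    Measure.isProbabilityMeasure_map (by fun_prop)
  apply Measure.ext_of_charFun
  ext t
  have h1 : charFun ((stdGaussian F).map (innerSL ℝ u)) t = charFun (stdGaussian F) (t • u) := by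
    rw [charFun_apply, charFun_apply, integral_map (by fun_prop) (by fun_prop)]
    simp [real_inner_smul_right, real_inner_comm]
  rw [h1, charFun_stdGaussian, charFun_stdGaussian, norm_smul, hu, mul_one]

end Intertwining

/-! ### Separable potentials in their orthonormal frame. -/

section Coordinates

variable {d : ℕ} {U : E d → ℝ} {xstar : E d} {m L δ ℓ Lℓ : ℝ} {Q : E d ≃ₗᵢ[ℝ] E d}
  {Ui : Fin d → ℝ → ℝ}

/-- The `i`-th coordinate in the orthonormal frame given by `Q`. -/
def coord (Q : E d ≃ₗᵢ[ℝ] E d) (i : Fin d) : E d →L[ℝ] ℝ :=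
  innerSL ℝ (Q (EuclideanSpace.single i 1))

theorem coord_apply (i : Fin d) (x : E d) : coord Q i x = Q.symm x i := by
  have h := Q.inner_map_map (EuclideanSpace.single i (1 : ℝ)) (Q.symm x)
  rw [Q.apply_symm_apply] at h
  rw [coord, innerSL_apply_apply, h, EuclideanSpace.inner_single_left]
  simp

theorem coordLaw_eq (ν : Measure (E d × E d)) (i : Fin d) :
    coordLaw Q ν i = ν.map (Prod.map (coord Q i) (coord Q i)) := by
  rw [coordLaw]
  congr 1
  ext1 z
  exact Prod.ext (coord_apply i z.1).symm (coord_apply i z.2).symm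

theorem map_coord_stdGaussian (i : Fin d) :
    (stdGaussian (E d)).map (coord Q i) = stdGaussian ℝ :=
  map_inner_stdGaussian (by simp)

theorem norm_sq_eq_sum_coord (x : E d) : ‖x‖ ^ 2 = ∑ i, ‖coord Q i x‖ ^ 2 := by
  rw [← Q.symm.norm_map x, EuclideanSpace.norm_sq_eq]
  simp_rw [coord_apply]

theorem phaseNorm_coord_le (i : Fin d) (z : E d × E d) :
    phaseNorm (Prod.map (coord Q i) (coord Q i) z) ≤ phaseNorm z := by
  have h : ∀ x : E d, ‖coord Q i x‖ ≤ ‖x‖ := fun x => by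
    refine ((coord Q i).le_opNorm x).trans ?_
    rw [coord, innerSL_apply_norm]
    simp
  unfold phaseNorm
  simp only [Prod.map_fst, Prod.map_snd]
  gcongr <;> exact h _

theorem Separable.apply_eq (h : Separable U xstar ℓ Lℓ Q Ui) (x : E d) :
    U x = ∑ i, Ui i (coord Q i x) := by
  have := h.2.2.2.1 (Q.symm x)
  rw [Q.apply_symm_apply] at this
  simp only [this, coord_apply]

/-- Differentiating `U` along the `i`-th frame vector in two ways: by the gradient, and through the
sum of the `U_i`. -/
theorem Separable.coord_gradient (hU : Differentiable ℝ U) (h : Separable U xstar ℓ Lℓ Q Ui)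
    (i : Fin d) (x : E d) : coord Q i (gradient U x) = gradient (Ui i) (coord Q i x) := by
  set e := Q (EuclideanSpace.single i (1 : ℝ)) with he
  have h1 := hasDerivAt_comp_line hU x e 0
  have hc : ∀ j, coord Q j e = if j = i then 1 else 0 := fun j => by
    rw [coord_apply, he, Q.symm_apply_apply, PiLp.single_apply]
  have h2 : HasDerivAt (fun t : ℝ => ∑ j, Ui j (coord Q j x + t * coord Q j e))
      (∑ j, deriv (Ui j) (coord Q j x) * coord Q j e) 0 := by
    refine HasDerivAt.fun_sum fun j _ => ?_
    have h3 : HasDerivAt (fun t : ℝ => coord Q j x + t * coord Q j e) (coord Q j e) 0 := by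
      simpa using ((hasDerivAt_id (0 : ℝ)).mul_const (coord Q j e)).const_add (coord Q j x)
    have h4 : HasDerivAt (Ui j) (deriv (Ui j) (coord Q j x)) (coord Q j x + 0 * coord Q j e) := by
      rw [zero_mul, add_zero]
      exact ((h.2.2.1 j).differentiable (by norm_num) _).hasDerivAt
    exact h4.comp (0 : ℝ) h3
  have h5 : (fun t : ℝ => U (x + t • e)) = fun t : ℝ => ∑ j, Ui j (coord Q j x + t * coord Q j e) := by
    ext t
    rw [h.apply_eq]
    simp
  rw [h5] at h1
  have h6 := h1.unique h2
  simp only [hc, mul_ite, mul_one, mul_zero, Finset.sum_ite_eq', Finset.mem_univ, if_true,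
    zero_smul, add_zero] at h6
  rw [gradient_eq_deriv', ← h6, coord, innerSL_apply_apply, real_inner_comm]

/-- The `i`-th component of the force depends only on the `i`-th coordinate, so it is read on the
line spanned by the `i`-th frame vector. There the constants `m` and `L` are inherited. -/
theorem Separable.isConvexField (hU : Differentiable ℝ U) (h : Separable U xstar ℓ Lℓ Q Ui)
    (hG : IsConvexField (gradient U) m L xstar) (hm : 0 < m) (hL : 0 < L) (i : Fin d) :
    IsConvexField (gradient (Ui i)) m L (coord Q i xstar) := by
  set e := Q (EuclideanSpace.single i (1 : ℝ)) with he
  have hc : ∀ t : ℝ, coord Q i (t • e) = t := fun t => by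
    rw [map_smul, coord_apply, he, Q.symm_apply_apply]; simp
  have hne : ‖e‖ = 1 := by rw [he, Q.norm_map]; simp
  have hdiff : ∀ s t : ℝ, gradient (Ui i) s - gradient (Ui i) t =
      coord Q i (gradient U (s • e) - gradient U (t • e)) := fun s t => by
    rw [map_sub, h.coord_gradient hU, h.coord_gradient hU, hc, hc]
  have hnorm : ∀ s t : ℝ, ‖s • e - t • e‖ = ‖s - t‖ := fun s t => by
    rw [← sub_smul, norm_smul, hne, mul_one]
  refine isConvexField_gradient ((h.2.2.1 i).differentiable (by norm_num)) hm hL (fun s t => ?_)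
    (fun s t => ?_) ?_
  · rw [hdiff, ← hnorm]
    refine le_trans ?_ (hG.lip _ _)
    refine ((coord Q i).le_opNorm _).trans ?_
    rw [coord, innerSL_apply_norm, ← he, hne, one_mul]
  · have h1 := hG.mono (s • e) (t • e)
    rw [hnorm, ← sub_smul, real_inner_smul_left] at h1
    rw [hdiff, coord, innerSL_apply_apply, ← he]
    refine h1.trans (le_of_eq ?_)
    simp [mul_comm]
  · rw [← h.coord_gradient hU, hG.zero, map_zero]

theorem Separable.energyErr_eq (hU : Differentiable ℝ U) (h : Separable U xstar ℓ Lℓ Q Ui)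
    (z : E d × E d) :
    energyErr U δ z = ∑ i, energyErr (Ui i) δ (Prod.map (coord Q i) (coord Q i) z) := by
  have hv := fun i => map_verletField (coord Q i) (h.coord_gradient hU i) δ z
  simp only [energyErr, ← hv]
  rw [h.apply_eq, h.apply_eq z.1, norm_sq_eq_sum_coord (Q := Q),
    norm_sq_eq_sum_coord (Q := Q) z.2, Finset.sum_div, Finset.sum_div, ← Finset.sum_add_distrib,
    ← Finset.sum_add_distrib, ← Finset.sum_sub_distrib]
  rfl

theorem Separable.norm_fderiv_gradient_sub_le (h : Separable U xstar ℓ Lℓ Q Ui) (i : Fin d)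
    (s t : ℝ) : ‖fderiv ℝ (gradient (Ui i)) t - fderiv ℝ (gradient (Ui i)) s‖ ≤
      Lℓ * ‖s - t‖ * (2 + ‖s - coord Q i xstar‖ ^ (ℓ - 2) + ‖t - coord Q i xstar‖ ^ (ℓ - 2)) / 4 := by
  have e : gradient (Ui i) = deriv (Ui i) := funext fun u => gradient_eq_deriv'
  have h2 := h.2.2.2.2 i s t
  rw [iteratedDeriv_succ, iteratedDeriv_one] at h2
  rw [e, coord_apply]
  have e2 : ‖fderiv ℝ (deriv (Ui i)) t - fderiv ℝ (deriv (Ui i)) s‖ ≤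
      |deriv (deriv (Ui i)) t - deriv (deriv (Ui i)) s| :=
    ContinuousLinearMap.opNorm_le_bound _ (abs_nonneg _) fun u => by
      rw [sub_apply, fderiv_eq_smul_deriv, fderiv_eq_smul_deriv, ← smul_sub, norm_smul, mul_comm]
      exact le_rfl
  exact e2.trans h2

end Coordinates

/-! ### Finite sums in mean, and moments of the initial law. -/

theorem MeanLE.sum {S ι : Type*} [MeasurableSpace S] {μ : Measure S} {s : Finset ι}
    {f : ι → S → ℝ} {C : ι → ℝ} (hf : ∀ i, Measurable (f i)) (hC : ∀ i, 0 ≤ C i)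
    (h : ∀ i, MeanLE μ (f i) (C i)) :
    MeanLE μ (fun x => ∑ i ∈ s, f i x) (∑ i ∈ s, C i) := by
  classical
  induction s using Finset.induction_on with
  | empty => simp [MeanLE]
  | insert i s hi ih =>
    simp only [Finset.sum_insert hi]
    exact (h i).add ih (hf i) (hC i) (Finset.sum_nonneg fun j _ => hC j)

theorem moment_nonneg {F : Type*} [NormedAddCommGroup F] [MeasurableSpace F] (xstar : F) (p : ℝ) (ν : Measure (F × F)) : 0 ≤ moment xstar p ν :=
  integral_nonneg fun _ => Real.rpow_nonneg (phaseNorm_nonneg _) _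

section Moments

variable {F : Type*} [NormedAddCommGroup F] [MeasurableSpace F] [BorelSpace F]
  [SecondCountableTopology F] {ν : Measure (F × F)} {p : ℝ}

theorem MemP.meanLE (hp : 1 ≤ p) (h : MemP p ν) (xstar : F) :
    MeanLE ν (fun z => phaseNorm (z - (xstar, 0)) ^ p) (moment xstar p ν) := by
  have := h.1
  have hm := (continuous_phaseNorm (F := F)).measurable
  have hmp : Measurable fun z : F × F => phaseNorm (z - (xstar, 0)) ^ p := by fun_prop
  have hint : Integrable (fun z => phaseNorm (z - (xstar, 0)) ^ p) ν := by
    refine ((h.2.const_mul (2 ^ p)).add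
      (integrable_const (2 ^ p * phaseNorm (-(xstar, (0 : F))) ^ p))).mono'
        hmp.aestronglyMeasurable ?_
    refine Filter.Eventually.of_forall fun z => ?_
    have ha := phaseNorm_nonneg z
    have hb := phaseNorm_nonneg (-(xstar, (0 : F)))
    rw [Real.norm_of_nonneg (Real.rpow_nonneg (phaseNorm_nonneg _) _)]
    have h1 := rpow_add_le_weighted ha hb one_half_pos one_half_lt_one hp
    rw [show (1 : ℝ) - 1 / 2 = 1 / 2 by norm_num, div_div_eq_mul_div, div_div_eq_mul_div, div_one,
      div_one, mul_comm (phaseNorm z), mul_comm (phaseNorm (-(xstar, (0 : F)))),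
      Real.mul_rpow two_pos.le ha, Real.mul_rpow two_pos.le hb] at h1
    have h2 : phaseNorm (z - (xstar, 0)) ^ p ≤
        (phaseNorm z + phaseNorm (-(xstar, (0 : F)))) ^ p :=
      Real.rpow_le_rpow (phaseNorm_nonneg _) (by rw [sub_eq_add_neg]; exact phaseNorm_add_le _ _)
        (by linarith)
    have h3 : 0 ≤ (2 : ℝ) ^ p * phaseNorm z ^ p := by positivity
    have h4 : 0 ≤ (2 : ℝ) ^ p * phaseNorm (-(xstar, (0 : F))) ^ p := by positivity
    simp only [Pi.add_apply]
    linarith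
  rw [MeanLE, moment, ofReal_integral_eq_lintegral_ofReal hint
    (Filter.Eventually.of_forall fun z => Real.rpow_nonneg (phaseNorm_nonneg _) _)]

end Moments

theorem MemP.coordLaw {d : ℕ} {ν : Measure (E d × E d)} {p : ℝ} (hp : 0 ≤ p) (h : MemP p ν)
    (Q : E d ≃ₗᵢ[ℝ] E d) (i : Fin d) : MemP p (coordLaw Q ν i) := by
  have := h.1
  have hT : Measurable (Prod.map (coord Q i) (coord Q i)) :=
    (coord Q i).measurable.prodMap (coord Q i).measurable
  have hm := (continuous_phaseNorm (F := ℝ)).measurable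
  rw [coordLaw_eq]
  refine ⟨Measure.isProbabilityMeasure_map hT.aemeasurable, ?_⟩
  have hmp : Measurable fun z : ℝ × ℝ => phaseNorm z ^ p := by fun_prop
  rw [integrable_map_measure hmp.aestronglyMeasurable hT.aemeasurable]
  refine h.2.mono' (hmp.comp hT).aestronglyMeasurable (Filter.Eventually.of_forall fun z => ?_)
  simp only [Function.comp]
  rw [Real.norm_of_nonneg (Real.rpow_nonneg (phaseNorm_nonneg _) _)]
  exact Real.rpow_le_rpow (phaseNorm_nonneg _) (phaseNorm_coord_le i z) hp

/-! ### The three bounds of the error function. -/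

section Final

variable {d : ℕ} {U : E d → ℝ} {xstar : E d} {m L γ δ : ℝ} {ν : Measure (E d × E d)}

/-- The distance at time `n` between the laws of the adjusted and of the unadjusted chain. -/
def chainErr (U : E d → ℝ) (δ γ : ℝ) (ν : Measure (E d × E d)) (n : ℕ) : ℝ :=
  tvDist (lawAt (kernelM U δ γ) ν n) (lawAt (kernelP U δ γ) ν n)

theorem tvDist_lawAt_le_add_chainErr (hU : ContDiff ℝ 2 U) (ν μ : Measure (E d × E d))
    [IsProbabilityMeasure ν] [IsProbabilityMeasure μ] (n : ℕ) :
    tvDist (lawAt (kernelM U δ γ) ν n) (lawAt (kernelM U δ γ) μ n) ≤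
      tvDist (lawAt (kernelP U δ γ) ν n) (lawAt (kernelP U δ γ) μ n) +
        chainErr U δ γ ν n + chainErr U δ γ μ n := by
  have hG := (contDiff_gradient hU).continuous
  have := isMarkovKernel_kernelM (δ := δ) (γ := γ) hU.continuous hG
  have := isMarkovKernel_kernelP (δ := δ) (γ := γ) hG
  have := isProbabilityMeasure_lawAt (kernelM U δ γ) ν n
  have := isProbabilityMeasure_lawAt (kernelM U δ γ) μ n
  have := isProbabilityMeasure_lawAt (kernelP U δ γ) ν n
  have := isProbabilityMeasure_lawAt (kernelP U δ γ) μ n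
  have h1 := tvDist_triangle (lawAt (kernelM U δ γ) ν n) (lawAt (kernelP U δ γ) ν n)
    (lawAt (kernelM U δ γ) μ n)
  have h2 := tvDist_triangle (lawAt (kernelP U δ γ) ν n) (lawAt (kernelP U δ γ) μ n)
    (lawAt (kernelM U δ γ) μ n)
  rw [tvDist_comm (lawAt (kernelP U δ γ) μ n) (lawAt (kernelM U δ γ) μ n)] at h2
  unfold chainErr
  linarith

theorem eta_nonneg (δ γ : ℝ) : 0 ≤ eta δ γ := (Real.exp_pos _).le

theorem eta_le_one {ε β : ℝ} (h : Regime m L γ δ ε β) : eta δ γ ≤ 1 := by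
  rw [eta, Real.exp_le_one_iff]
  have := mul_pos h.δ_pos h.γ_pos
  linarith

theorem measurable_energyErr (hU : Continuous U) (hG : Continuous (gradient U)) :
    Measurable (energyErr U δ) := by
  have h1 := measurable_ham hU
  have h2 := measurable_verlet (δ := δ) hG
  exact (h1.comp h2).sub h1

theorem chainErr_le_quadratic (hd : 1 ≤ d) (hU : ContDiff ℝ 2 U)
    (hG : IsConvexField (gradient U) m L xstar)
    (h : Regime m L γ δ (1 - eta δ γ ^ 2) (δ / (1 - eta δ γ ^ 2))) (hν : MemP 2 ν) (n : ℕ) :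
    chainErr U δ γ ν n ≤ δ * K9 L m γ δ * (moment xstar 2 ν + δ * n * d) := by
  have := hν.1
  have hη1 := eta_le_one h
  have hε := h.ε_pos
  have hcG := (contDiff_gradient hU).continuous
  have hf : Measurable fun z => 2 * |energyErr U δ z| := by
    have := measurable_energyErr (δ := δ) hU.continuous hcG
    fun_prop
  have hη2 : (eta δ γ ^ 2) ^ 2 ≤ 1 := pow_le_one₀ (sq_nonneg _) (by linarith)
  obtain ⟨C, hC, hsum⟩ := energy_sum_quadratic (η := eta δ γ)
    (σ := Real.sqrt (1 - eta δ γ ^ 2)) (s := Real.sqrt (1 - (eta δ γ ^ 2) ^ 2))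
    (by simpa using hd) hG h
    (by rw [sub_sub_cancel, Real.sq_sqrt (by linarith)]) (Real.sq_sqrt hε.le) (eta_nonneg _ _) hη1
    (moment_nonneg xstar 2 ν) (hν.meanLE one_le_two xstar) hf
    (two_mul_abs_energyErr_le_quadratic (hU.differentiable (by norm_num)) hG h.L_pos.le h.δ_pos.le)
  simp only [sub_sub_cancel] at hC
  refine (tvDist_lawAt_le_of_meanLE hU.continuous hcG hη1 ν (fun k => (hC k).1)
    (fun k => (hC k).2) n).trans ((hsum n).trans (le_of_eq ?_))
  rw [finrank_euclideanSpace_fin]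

theorem chainErr_le_pol (hd : 1 ≤ d) (hU : ContDiff ℝ 2 U)
    (hG : IsConvexField (gradient U) m L xstar)
    (h : Regime m L γ δ (1 - eta δ γ ^ 2) (δ / (1 - eta δ γ ^ 2))) {ℓ Lℓ : ℝ}
    (hH : HessPol U xstar ℓ Lℓ) (hν : MemP (ℓ + 1) ν) (n : ℕ) :
    chainErr U δ γ ν n ≤ δ ^ 2 * K10 L m γ δ ℓ Lℓ *
      (moment xstar (ℓ + 1) ν + δ * n * ((d : ℝ) + ℓ - 1) ^ ((ℓ + 1) / 2)) := by
  have := hν.1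
  obtain ⟨hℓ, hLℓ, hH⟩ := hH
  have hη1 := eta_le_one h
  have hε := h.ε_pos
  have hcG := (contDiff_gradient hU).continuous
  have hη2 : (eta δ γ ^ 2) ^ 2 ≤ 1 := pow_le_one₀ (sq_nonneg _) (by linarith)
  obtain ⟨C, hC, hsum⟩ := energy_sum_pol (η := eta δ γ)
    (σ := Real.sqrt (1 - eta δ γ ^ 2)) (s := Real.sqrt (1 - (eta δ γ ^ 2) ^ 2)) hℓ hLℓ
    (by simpa using hd) hG h
    (by rw [sub_sub_cancel, Real.sq_sqrt (by linarith)]) (Real.sq_sqrt hε.le) (eta_nonneg _ _) hη1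
    (moment_nonneg xstar (ℓ + 1) ν) (hν.meanLE (by linarith) xstar)
    (two_mul_abs_energyErr_le_pol hU hℓ hLℓ hH hG h.L_pos.le h.δ_pos.le)
  simp only [sub_sub_cancel] at hC
  refine (tvDist_lawAt_le_of_meanLE hU.continuous hcG hη1 ν (fun k => (hC k).1)
    (fun k => (hC k).2) n).trans ((hsum n).trans (le_of_eq ?_))
  rw [finrank_euclideanSpace_fin]

/-- The rejection cost involves one energy error for the whole chain. It is the sum of the
one-dimensional errors, so the triangle inequality reduces it to the coordinate chains before any
moment is taken. -/
theorem chainErr_le_separable (hU : ContDiff ℝ 2 U)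
    (hG : IsConvexField (gradient U) m L xstar)
    (h : Regime m L γ δ (1 - eta δ γ ^ 2) (δ / (1 - eta δ γ ^ 2))) {ℓ Lℓ : ℝ}
    {Q : E d ≃ₗᵢ[ℝ] E d} {Ui : Fin d → ℝ → ℝ} (hS : Separable U xstar ℓ Lℓ Q Ui)
    (hν : MemP (ℓ + 1) ν) (n : ℕ) :
    chainErr U δ γ ν n ≤ δ ^ 2 * K10 L m γ δ ℓ Lℓ *
      (∑ i, moment (Q.symm xstar i) (ℓ + 1) (coordLaw Q ν i) +
        δ * n * d * ℓ ^ ((ℓ + 1) / 2)) := by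
  have := hν.1
  have hℓ := hS.1
  have hUd : Differentiable ℝ U := hU.differentiable (by norm_num)
  have hη1 := eta_le_one h
  have hε := h.ε_pos
  have hcG := (contDiff_gradient hU).continuous
  have hη2 : (eta δ γ ^ 2) ^ 2 ≤ 1 := pow_le_one₀ (sq_nonneg _) (by linarith)
  have hcoord : ∀ i, ∃ C : ℕ → ℝ, (∀ k, 0 ≤ C k ∧ MeanLE (preVerletLaw (gradient U) δ (eta δ γ)
        (Real.sqrt (1 - eta δ γ ^ 2)) (eta δ γ ^ 2) (Real.sqrt (1 - (eta δ γ ^ 2) ^ 2)) ν k)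
        (fun z => 2 * |energyErr (Ui i) δ (Prod.map (coord Q i) (coord Q i) z)|) (C k)) ∧
      ∀ n : ℕ, ∑ k ∈ Finset.range n, C k ≤ δ ^ 2 * K10 L m γ δ ℓ Lℓ *
        (moment (Q.symm xstar i) (ℓ + 1) (coordLaw Q ν i) + δ * n * ℓ ^ ((ℓ + 1) / 2)) := by
    intro i
    have hGi := hS.isConvexField hUd hG h.m_pos h.L_pos i
    have hνi := hν.coordLaw (by linarith) Q i
    have := hνi.1
    have hcGi := (contDiff_gradient (hS.2.2.1 i)).continuous
    obtain ⟨C, hC, hsum⟩ := energy_sum_pol (η := eta δ γ)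
      (σ := Real.sqrt (1 - eta δ γ ^ 2)) (s := Real.sqrt (1 - (eta δ γ ^ 2) ^ 2)) hℓ hS.2.1
      (by simp) hGi h
      (by rw [sub_sub_cancel, Real.sq_sqrt (by linarith)]) (Real.sq_sqrt hε.le) (eta_nonneg _ _)
      hη1 (moment_nonneg (coord Q i xstar) (ℓ + 1) (coordLaw Q ν i))
      (hνi.meanLE (by linarith) _)
      (two_mul_abs_energyErr_le_pol (hS.2.2.1 i) hℓ hS.2.1 (hS.norm_fderiv_gradient_sub_le i) hGi
        h.L_pos.le h.δ_pos.le)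
    refine ⟨C, fun k => ⟨(hC k).1, ?_⟩, fun n => ?_⟩
    · have h1 := (hC k).2
      have hT : Measurable (Prod.map (coord Q i) (coord Q i)) :=
        (coord Q i).measurable.prodMap (coord Q i).measurable
      have hf : Measurable fun z => 2 * |energyErr (Ui i) δ z| := by
        have hV := measurable_verletField hcGi δ
        have := (hS.2.2.1 i).continuous.measurable
        unfold energyErr
        fun_prop
      rw [sub_sub_cancel, coordLaw_eq, ← map_preVerletLaw hcG hcGi (coord Q i)
        (map_coord_stdGaussian i) (hS.coord_gradient hUd i), meanLE_map_iff hT hf] at h1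
      exact h1
    · have h1 := hsum n
      -- In dimension one, `d + ℓ - 1 = ℓ`.
      rw [Module.finrank_self, Nat.cast_one, add_sub_cancel_left, coord_apply] at h1
      exact h1
  choose C hC hsum using hcoord
  have hmeas : ∀ i, Measurable fun z =>
      2 * |energyErr (Ui i) δ (Prod.map (coord Q i) (coord Q i) z)| := fun i => by
    have hT : Measurable (Prod.map (coord Q i) (coord Q i)) :=
      (coord Q i).measurable.prodMap (coord Q i).measurable
    have hV := (measurable_verletField (contDiff_gradient (hS.2.2.1 i)).continuous δ).comp hT
    have := (hS.2.2.1 i).continuous.measurable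
    simp only [Function.comp_def] at hV
    unfold energyErr
    fun_prop
  refine (tvDist_lawAt_le_of_meanLE hU.continuous hcG hη1 ν (C := fun k => ∑ i, C i k)
    (fun k => Finset.sum_nonneg fun i _ => (hC i k).1)
    (fun k => (MeanLE.sum hmeas (fun i => (hC i k).1) (fun i => (hC i k).2)).mono fun z => ?_)
    n).trans ?_
  · rw [← Finset.mul_sum]
    have e : ham U (verlet U δ z) - ham U z = energyErr U δ z := rfl
    rw [e, hS.energyErr_eq hUd]
    exact mul_le_mul_of_nonneg_left (Finset.abs_sum_le_sum_abs _ _) zero_le_two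
  · rw [Finset.sum_comm]
    refine (Finset.sum_le_sum fun i _ => hsum i n).trans (le_of_eq ?_)
    rw [← Finset.mul_sum, Finset.sum_add_distrib, Finset.sum_const, Finset.card_univ,
      Fintype.card_fin, nsmul_eq_mul]
    ring

theorem le_of_gradLip_of_conv (hd : 1 ≤ d) (hLip : GradLip U L) (hConv : Conv U m) : m ≤ L := by
  have : Nonempty (Fin d) := ⟨⟨0, hd⟩⟩
  obtain ⟨x, hx⟩ := exists_ne (0 : E d)
  have h1 := hConv.2 x 0
  have h2 := hLip.2 x 0
  have h3 := real_inner_le_norm (x - 0) (gradient U x - gradient U 0)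
  have h4 : 0 < ‖x - 0‖ := by simpa using hx
  have h5 := mul_le_mul_of_nonneg_left h2 h4.le
  refine le_of_mul_le_mul_right ?_ (pow_pos h4 2)
  linarith

/-- Phase space is a single point, so every Verlet move is accepted. -/
theorem chainErr_nonpos_of_dim_zero {U : E 0 → ℝ} (hU : ContDiff ℝ 2 U) {δ γ : ℝ}
    {ν : Measure (E 0 × E 0)} [IsProbabilityMeasure ν] (n : ℕ) : chainErr U δ γ ν n ≤ 0 := by
  refine (tvDist_lawAt_le hU.continuous (contDiff_gradient hU).continuous ν n).trans
    (le_of_eq (Finset.sum_eq_zero fun k _ => ?_))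
  have h : ∀ z : E 0 × E 0, accept U δ z = 1 := fun z => by
    rw [accept, Subsingleton.elim (verlet U δ z) z]
    simp
  simp [h]

theorem K9_nonneg (hL : 0 < L) (hm : 0 < m) (hγ : 0 < γ) (hδ : 0 < δ) : 0 ≤ K9 L m γ δ := by
  have : 0 ≤ kappa m γ := by unfold kappa; positivity
  unfold K9; positivity

theorem K10_nonneg (hL : 0 < L) (hm : 0 < m) (hγ : 0 < γ) (hδ : 0 < δ) {ℓ Lℓ : ℝ} (hLℓ : 0 ≤ Lℓ) :
    0 ≤ K10 L m γ δ ℓ Lℓ := by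
  have : 0 ≤ kappa m γ := by unfold kappa; positivity
  have : 0 ≤ K1 L := by unfold K1; positivity
  have : 0 ≤ momentFactor L m γ δ := by unfold momentFactor K3; positivity
  unfold K10; positivity

end Final

end OBABO

end

theorem mainTheorem8 (d : ℕ) (U : OBABO.E d → ℝ) (hU : ContDiff ℝ 2 U)
    (L m γ δ : ℝ) (hLip : OBABO.GradLip U L) (hConv : OBABO.Conv U m)
    (hγ : 2 * Real.sqrt L ≤ γ) (hδ : 0 < δ) (hδm : δ ≤ m / (33 * γ ^ 3)) :
    ∃ xstar : OBABO.E d, (∀ y, y ≠ xstar → U xstar < U y) ∧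
    ∃ Err : MeasureTheory.Measure (OBABO.E d × OBABO.E d) → ℕ → ℝ,
      (∀ n : ℕ, 1 ≤ n → ∀ ν μ : MeasureTheory.Measure (OBABO.E d × OBABO.E d),
        OBABO.MemP 2 ν → OBABO.MemP 2 μ →
        OBABO.tvDist (OBABO.lawAt (OBABO.kernelM U δ γ) ν n)
            (OBABO.lawAt (OBABO.kernelM U δ γ) μ n) ≤
          OBABO.tvDist (OBABO.lawAt (OBABO.kernelP U δ γ) ν n)
            (OBABO.lawAt (OBABO.kernelP U δ γ) μ n) + Err ν n + Err μ n) ∧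
      (∀ n : ℕ, 1 ≤ n → ∀ ν : MeasureTheory.Measure (OBABO.E d × OBABO.E d),
        OBABO.MemP 2 ν →
        Err ν n ≤ δ * OBABO.K9 L m γ δ * (OBABO.moment xstar 2 ν + δ * n * d)) ∧
      (∀ ℓ Lℓ : ℝ, OBABO.HessPol U xstar ℓ Lℓ →
        ∀ n : ℕ, 1 ≤ n → ∀ ν : MeasureTheory.Measure (OBABO.E d × OBABO.E d),
        OBABO.MemP (ℓ + 1) ν →
        Err ν n ≤ δ ^ 2 * OBABO.K10 L m γ δ ℓ Lℓ *
          (OBABO.moment xstar (ℓ + 1) ν + δ * n * ((d : ℝ) + ℓ - 1) ^ ((ℓ + 1) / 2))) ∧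
      (∀ (ℓ Lℓ : ℝ) (Q : OBABO.E d ≃ₗᵢ[ℝ] OBABO.E d) (Ui : Fin d → ℝ → ℝ),
        OBABO.Separable U xstar ℓ Lℓ Q Ui →
        ∀ n : ℕ, 1 ≤ n → ∀ ν : MeasureTheory.Measure (OBABO.E d × OBABO.E d),
        OBABO.MemP (ℓ + 1) ν →
        Err ν n ≤ δ ^ 2 * OBABO.K10 L m γ δ ℓ Lℓ *
          (∑ i, OBABO.moment (Q.symm xstar i) (ℓ + 1) (OBABO.coordLaw Q ν i) +
            δ * n * d * ℓ ^ ((ℓ + 1) / 2))) := by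
  have hL := hLip.1
  have hm := hConv.1
  have hUd : Differentiable ℝ U := hU.differentiable (by norm_num)
  obtain ⟨xstar, hx⟩ := OBABO.exists_gradient_eq_zero hUd hm hConv.2
  refine ⟨xstar, fun y hy => OBABO.lt_of_gradient_eq_zero hUd hm hConv.2 hx hy,
    OBABO.chainErr U δ γ, fun n _ ν μ hν hμ => ?_, ?_⟩
  · have := hν.1
    have := hμ.1
    exact OBABO.tvDist_lawAt_le_add_chainErr hU ν μ n
  -- The comparison `m ≤ L`, on which the parameter regime rests, requires a nonzero vector, so
  -- dimension zero is treated apart.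
  rcases Nat.eq_zero_or_pos d with rfl | hd
  · have hγ0 : 0 < γ := lt_of_lt_of_le (by have := Real.sqrt_pos.2 hL; linarith) hγ
    refine ⟨fun n _ ν hν => ?_, fun ℓ Lℓ hH n _ ν hν => ?_, fun ℓ Lℓ Q Ui hS n _ ν hν => ?_⟩
    · have := hν.1
      have := OBABO.K9_nonneg hL hm hγ0 hδ
      have := OBABO.moment_nonneg xstar 2 ν
      exact (OBABO.chainErr_nonpos_of_dim_zero hU n).trans (by positivity)
    · have := hν.1
      have hℓ := hH.1
      have := OBABO.K10_nonneg hL hm hγ0 hδ (ℓ := ℓ) hH.2.1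
      have := OBABO.moment_nonneg xstar (ℓ + 1) ν
      have : 0 ≤ (((0 : ℕ) : ℝ) + ℓ - 1) ^ ((ℓ + 1) / 2) :=
        Real.rpow_nonneg (by push_cast; linarith) _
      exact (OBABO.chainErr_nonpos_of_dim_zero hU n).trans (by positivity)
    · have := hν.1
      have := OBABO.K10_nonneg hL hm hγ0 hδ (ℓ := ℓ) hS.2.1
      refine (OBABO.chainErr_nonpos_of_dim_zero hU n).trans ?_
      simp
  · have h := OBABO.regime_of_le hm (OBABO.le_of_gradLip_of_conv hd hLip hConv) hγ hδ hδm
    have hG := OBABO.isConvexField_gradient hUd hm hL hLip.2 hConv.2 hx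
    exact ⟨fun n _ ν hν => OBABO.chainErr_le_quadratic hd hU hG h hν n,
      fun ℓ Lℓ hH n _ ν hν => OBABO.chainErr_le_pol hd hU hG h hH hν n,
      fun ℓ Lℓ Q Ui hS n _ ν hν => OBABO.chainErr_le_separable hU hG h hS hν n⟩
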